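/- A \emph{marked biscaled simplicial set} is a simplicial set $X$ together with a set $E_X\subseteq X_1$ of \emph{marked} edges containing all degenerate edges, a set $T_X\subseteq X_2$ of \emph{thin} triangles containing all degenerate triangles, and a set $C_X\subseteq X_2$ of \emph{lean} triangles with $T_X\subseteq C_X$; it is written $(X,E_X,T_X\subseteq C_X)$, or $(X,E_X,T_X)$ if $T_X=C_X$. Maps are maps of simplicial sets that preserve marked edges, thin triangles and lean triangles. We list only non-degenerate decorated simplices; $\flat$ stands for "only degenerate simplices" and $\sharp$ for "all simplices". On a horn, the indicated decorations are those that lie in the horn. A map is a \emph{cofibration} if its underlying map of simplicial sets is a monomorphism. The generating $\mathbf{MB}$-anodyne maps are the following, where $\Delta^n\coprod_{\Delta^{\{0,1\}}}\Delta^0$ denotes $\Delta^n$ with the edge from $0$ to $1$ collapsed: (A1) $(\Lambda^n_i,\flat,\{\Delta^{\{i-1,i,i+1\}}\})\to(\Delta^n,\flat,\{\Delta^{\{i-1,i,i+1\}}\})$ for $n\ge 2$, $0<i<n$; (A2) $(\Delta^4,\flat,T)\to(\Delta^4,\flat,T\cup\{\Delta^{\{0,3,4\}},\Delta^{\{0,1,4\}}\})$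 with $T=\{\Delta^{\{0,2,4\}},\Delta^{\{1,2,3\}},\Delta^{\{0,1,3\}},\Delta^{\{1,3,4\}},\Delta^{\{0,1,2\}}\}$; (A3) $(\Lambda^n_0\coprod_{\Delta^{\{0,1\}}}\Delta^0,\flat,\flat\subset\{\Delta^{\{0,1,n\}}\})\to(\Delta^n\coprod_{\Delta^{\{0,1\}}}\Delta^0,\flat,\flat\subset\{\Delta^{\{0,1,n\}}\})$ for $n\ge2$; (A4) $(\Lambda^n_n,\{\Delta^{\{n-1,n\}}\},\flat\subset\{\Delta^{\{0,n-1,n\}}\})\to(\Delta^n,\{\Delta^{\{n-1,n\}}\},\flat\subset\{\Delta^{\{0,n-1,n\}}\})$ for $n\ge2$; (A5) the inclusion of the terminal vertex $(\Delta^0,\sharp,\sharp)\to(\Delta^1,\sharp,\sharp)$; (S1) $(\Delta^2,\{\Delta^{\{0,1\}},\Delta^{\{1,2\}}\},\sharp)\to(\Delta^2,\sharp,\sharp)$; (S2) $(\Delta^2,\flat,\flat\subset\sharp)\to(\Delta^2,\flat,\sharp)$; (S3) $(\Delta^3,\flat,\{\Delta^{\{i-1,i,i+1\}}\}\subset U_i)\to(\Delta^3,\flat,\{\Delta^{\{i-1,i,i+1\}}\}\subset\sharp)$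 for $0<i<3$, where $U_i$ consists of all triangles except the $i$-th face; (S4) $(\Delta^3\coprod_{\Delta^{\{0,1\}}}\Delta^0,\flat,\flat\subset U_0)\to(\Delta^3\coprod_{\Delta^{\{0,1\}}}\Delta^0,\flat,\flat\subset\sharp)$, where $U_0$ consists of all triangles except the (image of the) $0$-th face; (S5) $(\Delta^3,\{\Delta^{\{2,3\}}\},\flat\subset U_3)\to(\Delta^3,\{\Delta^{\{2,3\}}\},\flat\subset\sharp)$, where $U_3$ consists of all triangles except the $3$-rd face; (E) $(K,\flat,\sharp)\to(K,\sharp,\sharp)$ for every Kan complex $K$. A map is \emph{$\mathbf{MB}$-anodyne} if it belongs to the smallest class of maps that contains these maps and is stable under pushouts, transfinite compositions and retracts. \textbf{Proposition.} Let $f:X\to Y$ be an $\mathbf{MB}$-anodyne map and let $g:A\to B$ be a cofibration of marked biscaled simplicial sets. Then the pushout-product $$f\wedge g:\; X\times B\coprod_{X\times A}Y\times A\longrightarrow Y\times B,$$ formed in the category of marked biscaled simplicial sets, is $\mathbf{MB}$-anodyne. -/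

import Mathlib

universe u

open CategoryTheory Limits MonoidalCategory CartesianMonoidalCategory Simplicial Opposite

/-- Morphisms of simplicial sets send degenerate simplices to degenerate simplices. -/
theorem SSet.app_mem_degenerate {X Y : SSet.{u}} (f : X ⟶ Y) {n : ℕ} {x : X _⦋n⦌}
    (hx : x ∈ X.degenerate n) : f.app _ x ∈ Y.degenerate n := by
  obtain ⟨m, hm, p, y, rfl⟩ := hx
  exact ⟨m, hm, p, f.app _ y, (NatTrans.naturality_apply f p.op y).symm⟩

/-- A marked biscaled simplicial set: a simplicial set with a set of marked edges containing all
degenerate edges, and two nested sets of triangles (thin triangles and lean triangles),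
containing all degenerate triangles. -/
structure MBSSet : Type (u + 1) where
  /-- The underlying simplicial set. -/
  toSSet : SSet.{u}
  /-- The marked edges. -/
  marked : Set (toSSet _⦋1⦌)
  /-- The thin triangles. -/
  thin : Set (toSSet _⦋2⦌)
  /-- The lean triangles. -/
  lean : Set (toSSet _⦋2⦌)
  degenerate_subset_marked : toSSet.degenerate 1 ⊆ marked
  degenerate_subset_thin : toSSet.degenerate 2 ⊆ thin
  thin_subset_lean : thin ⊆ lean

namespace MBSSet

/-- Maps of marked biscaled simplicial sets: maps of simplicial sets which preserve marked edges,
thin triangles and lean triangles. -/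
@[ext]
structure Hom (X Y : MBSSet.{u}) : Type u where
  /-- The underlying map of simplicial sets. -/
  hom : X.toSSet ⟶ Y.toSSet
  map_marked : ∀ e ∈ X.marked, hom.app _ e ∈ Y.marked
  map_thin : ∀ t ∈ X.thin, hom.app _ t ∈ Y.thin
  map_lean : ∀ t ∈ X.lean, hom.app _ t ∈ Y.lean

/-- The category of marked biscaled simplicial sets. -/
instance : Category MBSSet.{u} where
  Hom X Y := Hom X Y
  id X := ⟨𝟙 _, fun _ h => h, fun _ h => h, fun _ h => h⟩
  comp f g := ⟨f.hom ≫ g.hom, fun e h => g.map_marked _ (f.map_marked e h),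
    fun t h => g.map_thin _ (f.map_thin t h), fun t h => g.map_lean _ (f.map_lean t h)⟩

@[ext]
theorem hom_ext {X Y : MBSSet.{u}} {f g : X ⟶ Y} (h : f.hom = g.hom) : f = g :=
  Hom.ext h

@[simp]
theorem id_hom (X : MBSSet.{u}) : Hom.hom (𝟙 X) = 𝟙 X.toSSet := rfl

@[simp]
theorem comp_hom {X Y Z : MBSSet.{u}} (f : X ⟶ Y) (g : Y ⟶ Z) :
    Hom.hom (f ≫ g) = f.hom ≫ g.hom := rfl

/-- The functor forgetting all decorations. -/
def forget : MBSSet.{u} ⥤ SSet.{u} where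
  obj X := X.toSSet
  map f := f.hom

/-! ### Products -/

/-- The product: a simplex is decorated if and only if both of its components are. -/
def prod (X Y : MBSSet.{u}) : MBSSet.{u} where
  toSSet := X.toSSet ⊗ Y.toSSet
  marked := {e | (fst X.toSSet Y.toSSet).app _ e ∈ X.marked ∧
    (snd X.toSSet Y.toSSet).app _ e ∈ Y.marked}
  thin := {t | (fst X.toSSet Y.toSSet).app _ t ∈ X.thin ∧
    (snd X.toSSet Y.toSSet).app _ t ∈ Y.thin}
  lean := {t | (fst X.toSSet Y.toSSet).app _ t ∈ X.lean ∧
    (snd X.toSSet Y.toSSet).app _ t ∈ Y.lean}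
  degenerate_subset_marked _ h :=
    ⟨X.degenerate_subset_marked (SSet.app_mem_degenerate _ h),
      Y.degenerate_subset_marked (SSet.app_mem_degenerate _ h)⟩
  degenerate_subset_thin _ h :=
    ⟨X.degenerate_subset_thin (SSet.app_mem_degenerate _ h),
      Y.degenerate_subset_thin (SSet.app_mem_degenerate _ h)⟩
  thin_subset_lean _ h := ⟨X.thin_subset_lean h.1, Y.thin_subset_lean h.2⟩

/-- The first projection. -/
def prodFst (X Y : MBSSet.{u}) : prod X Y ⟶ X :=
  ⟨fst X.toSSet Y.toSSet, fun _ h => h.1, fun _ h => h.1, fun _ h => h.1⟩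

/-- The second projection. -/
def prodSnd (X Y : MBSSet.{u}) : prod X Y ⟶ Y :=
  ⟨snd X.toSSet Y.toSSet, fun _ h => h.2, fun _ h => h.2, fun _ h => h.2⟩

/-- `prod X Y` is the product of `X` and `Y` in the category `MBSSet`. -/
def prodIsLimit (X Y : MBSSet.{u}) : IsLimit (BinaryFan.mk (prodFst X Y) (prodSnd X Y)) :=
  BinaryFan.IsLimit.mk _
    (fun f g => ⟨lift f.hom g.hom, fun e h => ⟨f.map_marked e h, g.map_marked e h⟩,
      fun t h => ⟨f.map_thin t h, g.map_thin t h⟩, fun t h => ⟨f.map_lean t h, g.map_lean t h⟩⟩)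
    (fun f g => hom_ext (lift_fst f.hom g.hom))
    (fun f g => hom_ext (lift_snd f.hom g.hom))
    (fun f g _ hf hg => hom_ext (CartesianMonoidalCategory.hom_ext _ _
      ((congrArg Hom.hom hf).trans (lift_fst f.hom g.hom).symm)
      ((congrArg Hom.hom hg).trans (lift_snd f.hom g.hom).symm)))

/-- The product of two maps. -/
def prodMap {X Y A B : MBSSet.{u}} (f : X ⟶ Y) (g : A ⟶ B) : prod X A ⟶ prod Y B where
  hom := f.hom ⊗ₘ g.hom
  map_marked _ h := ⟨f.map_marked _ h.1, g.map_marked _ h.2⟩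
  map_thin _ h := ⟨f.map_thin _ h.1, g.map_thin _ h.2⟩
  map_lean _ h := ⟨f.map_lean _ h.1, g.map_lean _ h.2⟩

theorem prodMap_comp {X Y Z A B C : MBSSet.{u}} (f : X ⟶ Y) (f' : Y ⟶ Z) (g : A ⟶ B)
    (g' : B ⟶ C) : prodMap f g ≫ prodMap f' g' = prodMap (f ≫ f') (g ≫ g') :=
  hom_ext (MonoidalCategory.tensorHom_comp_tensorHom f.hom g.hom f'.hom g'.hom)

/-! ### Colimits -/

section Colimits

variable {J : Type} [Category.{0} J] (F : J ⥤ MBSSet.{u})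

/-- The colimit of a diagram: the colimit of the underlying simplicial sets, where a simplex is
decorated if and only if it is degenerate or the image of a decorated simplex. -/
noncomputable def colimitCocone : Cocone F where
  pt :=
    { toSSet := colimit (F ⋙ forget)
      marked := SSet.degenerate _ 1 ∪
        ⋃ j, ((colimit.ι (F ⋙ forget) j).app _) '' (F.obj j).marked
      thin := SSet.degenerate _ 2 ∪
        ⋃ j, ((colimit.ι (F ⋙ forget) j).app _) '' (F.obj j).thin
      lean := SSet.degenerate _ 2 ∪
        ⋃ j, ((colimit.ι (F ⋙ forget) j).app _) '' (F.obj j).lean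
      degenerate_subset_marked := Set.subset_union_left
      degenerate_subset_thin := Set.subset_union_left
      thin_subset_lean := Set.union_subset_union_right _
        (Set.iUnion_mono fun j => Set.image_mono (F.obj j).thin_subset_lean) }
  ι :=
    { app j := ⟨colimit.ι (F ⋙ forget) j,
        fun _ h => Or.inr (Set.mem_iUnion.2 ⟨j, Set.mem_image_of_mem _ h⟩),
        fun _ h => Or.inr (Set.mem_iUnion.2 ⟨j, Set.mem_image_of_mem _ h⟩),
        fun _ h => Or.inr (Set.mem_iUnion.2 ⟨j, Set.mem_image_of_mem _ h⟩)⟩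
      naturality _ _ p := hom_ext ((colimit.w (F ⋙ forget) p).trans (Category.comp_id _).symm) }

theorem colimit_map_aux (s : Cocone F) {n : ℕ} (D : ∀ X : MBSSet.{u}, Set (X.toSSet _⦋n⦌))
    (hdeg : s.pt.toSSet.degenerate n ⊆ D s.pt)
    (hD : ∀ j, ∀ x ∈ D (F.obj j), (s.ι.app j).hom.app _ x ∈ D s.pt)
    (x : (colimit (F ⋙ forget)) _⦋n⦌)
    (hx : x ∈ SSet.degenerate _ n ∪ ⋃ j, ((colimit.ι (F ⋙ forget) j).app _) '' D (F.obj j)) :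
    (colimit.desc (F ⋙ forget) (forget.mapCocone s)).app _ x ∈ D s.pt := by
  rcases hx with hx | hx
  · exact hdeg (SSet.app_mem_degenerate _ hx)
  · obtain ⟨j, y, hy, rfl⟩ := Set.mem_iUnion.1 hx
    have h := hD j y hy
    have e : colimit.ι (F ⋙ forget) j ≫ colimit.desc (F ⋙ forget) (forget.mapCocone s) =
      (s.ι.app j).hom := colimit.ι_desc (forget.mapCocone s) j
    rw [← e] at h
    exact h

/-- The cocone `colimitCocone F` is a colimit. -/
noncomputable def colimitCoconeIsColimit : IsColimit (colimitCocone F) where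
  desc s := ⟨colimit.desc (F ⋙ forget) (forget.mapCocone s),
    colimit_map_aux F s (fun X => X.marked) s.pt.degenerate_subset_marked
      (fun j => (s.ι.app j).map_marked),
    colimit_map_aux F s (fun X => X.thin) s.pt.degenerate_subset_thin
      (fun j => (s.ι.app j).map_thin),
    colimit_map_aux F s (fun X => X.lean)
      (s.pt.degenerate_subset_thin.trans s.pt.thin_subset_lean)
      (fun j => (s.ι.app j).map_lean)⟩
  fac s j := hom_ext (colimit.ι_desc (forget.mapCocone s) j)
  uniq s m h := hom_ext (colimit.hom_ext fun j =>
    (congrArg Hom.hom (h j)).trans (colimit.ι_desc (forget.mapCocone s) j).symm)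

instance : HasColimitsOfShape J MBSSet.{u} where
  has_colimit F := ⟨⟨colimitCocone F, colimitCoconeIsColimit F⟩⟩

end Colimits

/-- The pushout-product `X × B ⨿_{X × A} Y × A ⟶ Y × B` of `f : X ⟶ Y` and `g : A ⟶ B`. -/
noncomputable def pushoutProduct {X Y A B : MBSSet.{u}} (f : X ⟶ Y) (g : A ⟶ B) :
    pushout (prodMap (𝟙 X) g) (prodMap f (𝟙 A)) ⟶ prod Y B :=
  pushout.desc (prodMap f (𝟙 B)) (prodMap (𝟙 Y) g) (by simp [prodMap_comp])

/-! ### Constructing objects and maps -/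

/-- The marked biscaled simplicial set `(X, E, T ⊆ T ∪ C)`, where all degenerate edges are added
to `E`, and all degenerate triangles to `T`. -/
def mk' (X : SSet.{u}) (E : Set (X _⦋1⦌)) (T C : Set (X _⦋2⦌)) : MBSSet.{u} where
  toSSet := X
  marked := X.degenerate 1 ∪ E
  thin := X.degenerate 2 ∪ T
  lean := X.degenerate 2 ∪ (T ∪ C)
  degenerate_subset_marked := Set.subset_union_left
  degenerate_subset_thin := Set.subset_union_left
  thin_subset_lean := Set.union_subset_union_right _ Set.subset_union_left

/-- The identity of `X`, seen as a map between two decorations of `X`, the second of which has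
more marked edges, thin triangles and lean triangles. -/
def enlarge (X : SSet.{u}) {E E' : Set (X _⦋1⦌)} {T C T' C' : Set (X _⦋2⦌)}
    (hE : E ⊆ E') (hT : T ⊆ T') (hC : T ∪ C ⊆ T' ∪ C') : mk' X E T C ⟶ mk' X E' T' C' where
  hom := 𝟙 X
  map_marked _ h := Set.union_subset_union_right _ hE h
  map_thin _ h := Set.union_subset_union_right _ hT h
  map_lean _ h := Set.union_subset_union_right _ hC h

/-- The simplicial set `A` with the decorations induced along `i : A ⟶ X`: a simplex of `A` is
decorated if and only if its image in `X` is. -/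
def induced {A : SSet.{u}} (X : MBSSet.{u}) (i : A ⟶ X.toSSet) : MBSSet.{u} where
  toSSet := A
  marked := {e | i.app _ e ∈ X.marked}
  thin := {t | i.app _ t ∈ X.thin}
  lean := {t | i.app _ t ∈ X.lean}
  degenerate_subset_marked _ h := X.degenerate_subset_marked (SSet.app_mem_degenerate i h)
  degenerate_subset_thin _ h := X.degenerate_subset_thin (SSet.app_mem_degenerate i h)
  thin_subset_lean _ h := X.thin_subset_lean h

/-- The map `i : A ⟶ X`, where `A` has the decorations induced from `X`. -/
def inducedHom {A : SSet.{u}} (X : MBSSet.{u}) (i : A ⟶ X.toSSet) : induced X i ⟶ X :=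
  ⟨i, fun _ h => h, fun _ h => h, fun _ h => h⟩

/-! ### Simplices of standard simplices -/

/-- The edge `Δ^{a,b}` of `Δ[n]`, as a one-element set. -/
def dEdge (n a b : ℕ) : Set ((Δ[n] : SSet.{u}) _⦋1⦌) :=
  {e | (e 0 : ℕ) = a ∧ (e 1 : ℕ) = b}

/-- The triangle `Δ^{a,b,c}` of `Δ[n]`, as a one-element set. -/
def dTri (n a b c : ℕ) : Set ((Δ[n] : SSet.{u}) _⦋2⦌) :=
  {t | (t 0 : ℕ) = a ∧ (t 1 : ℕ) = b ∧ (t 2 : ℕ) = c}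

/-- The set `{Δ^{0,2,4}, Δ^{1,2,3}, Δ^{0,1,3}, Δ^{1,3,4}, Δ^{0,1,2}}` of triangles of `Δ[4]`. -/
def tri4 : Set ((Δ[4] : SSet.{u}) _⦋2⦌) :=
  dTri 4 0 2 4 ∪ dTri 4 1 2 3 ∪ dTri 4 0 1 3 ∪ dTri 4 1 3 4 ∪ dTri 4 0 1 2

/-- The face of `Δ[3]` opposite to the vertex `i`, as a triangle of `Δ[3]`. -/
def face3 (i : Fin 4) : (Δ[3] : SSet.{u}) _⦋2⦌ :=
  SSet.stdSimplex.objEquiv.symm (SimplexCategory.δ i)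

/-! ### Collapsing the edge from `0` to `1` -/

/-- The inclusion `Δ^{0,1} ⟶ Δ[n]`, for `n ≥ 1`. -/
def edge01 (n : ℕ) : (Δ[1] : SSet.{u}) ⟶ Δ[n + 1] :=
  SSet.yonedaEquiv.symm (SSet.stdSimplex.edge (n + 1) 0 1 (Fin.zero_le _))

/-- The inclusion `Δ^{0,1} ⟶ Λ[n, 0]`, for `n ≥ 2`. -/
def hornEdge01 (n : ℕ) : (Δ[1] : SSet.{u}) ⟶ (Λ[n + 2, 0] : SSet.{u}) :=
  SSet.yonedaEquiv.symm (SSet.horn.edge (n + 2) 0 0 1 (Fin.zero_le _) (by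
    have : ({0, 0, 1} : Finset (Fin (n + 2 + 1))).card ≤ 2 := by
      simp
    lia))

theorem hornEdge01_ι (n : ℕ) :
    hornEdge01.{u} n ≫ (SSet.horn (n + 2) 0).ι = edge01 (n + 1) := by
  apply SSet.yonedaEquiv.injective
  rfl

/-- The map `Δ[1] ⟶ Δ[0]`. -/
def toPoint : (Δ[1] : SSet.{u}) ⟶ Δ[0] := SSet.stdSimplex.σ 0

/-- The simplicial set `Δ^n ⨿_{Δ^{0,1}} Δ^0`, for `n ≥ 1`. -/
noncomputable abbrev collapse (n : ℕ) : SSet.{u} := pushout (edge01.{u} n) toPoint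

/-- The quotient map `Δ^n ⟶ Δ^n ⨿_{Δ^{0,1}} Δ^0`, for `n ≥ 1`. -/
noncomputable abbrev collapseMap (n : ℕ) : (Δ[n + 1] : SSet.{u}) ⟶ collapse n :=
  pushout.inl _ _

/-- The map `Λ^n_0 ⨿_{Δ^{0,1}} Δ^0 ⟶ Δ^n ⨿_{Δ^{0,1}} Δ^0`, for `n ≥ 2`. -/
noncomputable def collapseHorn (n : ℕ) :
    pushout (hornEdge01.{u} n) toPoint ⟶ collapse.{u} (n + 1) :=
  pushout.map _ _ _ _ (SSet.horn (n + 2) 0).ι (𝟙 _) (𝟙 _)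
    (by rw [hornEdge01_ι, Category.id_comp]) (by simp)

/-! ### Anodyne maps -/

/-- The class of generating `MB`-anodyne maps. -/
inductive MBGen : MorphismProperty MBSSet.{u}
  /-- `(Λ^n_i, ♭, {Δ^{i-1,i,i+1}}) ⟶ (Δ^n, ♭, {Δ^{i-1,i,i+1}})` for `0 < i < n`. -/
  | innerHorn (n : ℕ) (i : Fin (n + 1)) (h0 : 0 < i) (hn : i < Fin.last n) :
      MBGen (inducedHom (mk' Δ[n] ∅ (dTri n (i - 1) i (i + 1)) ∅) (SSet.horn n i).ι)
  /-- `(Δ^4, ♭, T) ⟶ (Δ^4, ♭, T ∪ {Δ^{0,3,4}, Δ^{0,1,4}})`. -/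
  | wonky4 :
      MBGen (enlarge Δ[4] (E := ∅) (E' := ∅) (C := ∅) (C' := ∅)
        (T := tri4) (T' := tri4 ∪ (dTri 4 0 3 4 ∪ dTri 4 0 1 4))
        subset_rfl Set.subset_union_left
        (Set.union_subset_union_left _ Set.subset_union_left))
  /-- `(Λ^n_0 ⨿_{Δ^{0,1}} Δ^0, ♭, ♭ ⊆ {Δ^{0,1,n}}) ⟶
  (Δ^n ⨿_{Δ^{0,1}} Δ^0, ♭, ♭ ⊆ {Δ^{0,1,n}})`, where `n` is replaced by `n + 2`. -/
  | leftDegenerate (n : ℕ) :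
      MBGen (inducedHom
        (mk' (collapse (n + 1)) ∅ ∅ ((collapseMap (n + 1)).app _ '' dTri (n + 2) 0 1 (n + 2)))
        (collapseHorn n))
  /-- `(Λ^n_n, {Δ^{n-1,n}}, ♭ ⊆ {Δ^{0,n-1,n}}) ⟶ (Δ^n, {Δ^{n-1,n}}, ♭ ⊆ {Δ^{0,n-1,n}})`,
  where `n` is replaced by `n + 2`. -/
  | outerHorn (n : ℕ) :
      MBGen (inducedHom
        (mk' Δ[n + 2] (dEdge (n + 2) (n + 1) (n + 2)) ∅ (dTri (n + 2) 0 (n + 1) (n + 2)))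
        (SSet.horn (n + 2) (Fin.last (n + 2))).ι)
  /-- `(Δ^0, ♯, ♯) ⟶ (Δ^1, ♯, ♯)`, the inclusion of the vertex `1`. -/
  | terminalVertex :
      MBGen (inducedHom (mk' Δ[1] Set.univ Set.univ Set.univ)
        (SSet.stdSimplex.δ (0 : Fin 2) : (Δ[0] : SSet.{u}) ⟶ Δ[1]))
  /-- `(Δ^2, {Δ^{0,1}, Δ^{1,2}}, ♯) ⟶ (Δ^2, ♯, ♯)`. -/
  | compose :
      MBGen (enlarge Δ[2] (E := dEdge 2 0 1 ∪ dEdge 2 1 2) (E' := Set.univ)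
        (T := Set.univ) (T' := Set.univ) (C := Set.univ) (C' := Set.univ)
        (Set.subset_univ _) subset_rfl subset_rfl)
  /-- `(Δ^2, ♭, ♭ ⊆ ♯) ⟶ (Δ^2, ♭, ♯)`. -/
  | leanToThin :
      MBGen (enlarge Δ[2] (E := ∅) (E' := ∅) (T := ∅) (T' := Set.univ)
        (C := Set.univ) (C' := Set.univ) subset_rfl (Set.empty_subset _)
        (Set.union_subset_union_left _ (Set.empty_subset _)))
  /-- `(Δ^3, ♭, {Δ^{i-1,i,i+1}} ⊆ U_i) ⟶ (Δ^3, ♭, {Δ^{i-1,i,i+1}} ⊆ ♯)` for `0 < i < 3`,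
  where `U_i` consists of all triangles except the `i`-th face. -/
  | innerSaturation (i : Fin 4) (h0 : 0 < i) (h3 : i < 3) :
      MBGen (enlarge Δ[3] (E := ∅) (E' := ∅)
        (T := dTri 3 (i - 1) i (i + 1)) (T' := dTri 3 (i - 1) i (i + 1))
        (C := {face3 i}ᶜ) (C' := Set.univ) subset_rfl subset_rfl
        (Set.union_subset_union_right _ (Set.subset_univ _)))
  /-- `(Δ^3 ⨿_{Δ^{0,1}} Δ^0, ♭, ♭ ⊆ U_0) ⟶ (Δ^3 ⨿_{Δ^{0,1}} Δ^0, ♭, ♭ ⊆ ♯)`. -/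
  | leftSaturation :
      MBGen (enlarge (collapse 2) (E := ∅) (E' := ∅) (T := ∅) (T' := ∅)
        (C := {(collapseMap 2).app _ (face3 0)}ᶜ) (C' := Set.univ) subset_rfl subset_rfl
        (Set.union_subset_union_right _ (Set.subset_univ _)))
  /-- `(Δ^3, {Δ^{2,3}}, ♭ ⊆ U_3) ⟶ (Δ^3, {Δ^{2,3}}, ♭ ⊆ ♯)`. -/
  | outerSaturation :
      MBGen (enlarge Δ[3] (E := dEdge 3 2 3) (E' := dEdge 3 2 3) (T := ∅) (T' := ∅)
        (C := {face3 3}ᶜ) (C' := Set.univ) subset_rfl subset_rfl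
        (Set.union_subset_union_right _ (Set.subset_univ _)))
  /-- `(K, ♭, ♯) ⟶ (K, ♯, ♯)` for every Kan complex `K`. -/
  | equivalences (K : SSet.{u}) (hK : SSet.KanComplex K) :
      MBGen (enlarge K (E := ∅) (E' := Set.univ) (T := Set.univ) (T' := Set.univ)
        (C := Set.univ) (C' := Set.univ) (Set.empty_subset _) subset_rfl subset_rfl)

/-- A class of morphisms is weakly saturated if it is stable under pushouts, transfinite
compositions and retracts. -/
class IsWeaklySaturated (W : MorphismProperty MBSSet.{u}) : Prop where
  cobaseChange : W.IsStableUnderCobaseChange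
  transfinite : MorphismProperty.IsStableUnderTransfiniteComposition.{u} W
  retracts : W.IsStableUnderRetracts

/-- The class of `MB`-anodyne maps: the weakly saturated closure of the generating maps, i.e. the
intersection of all weakly saturated classes which contain them. -/
def mbAnodyne : MorphismProperty MBSSet.{u} := fun _ _ f =>
  ∀ W : MorphismProperty MBSSet.{u}, IsWeaklySaturated W → MBGen ≤ W → W f

/-- A map is a cofibration if the underlying map of simplicial sets is a monomorphism. -/
def cofibration : MorphismProperty MBSSet.{u} := fun _ _ f => Mono f.hom

end MBSSet

/-! The maps whose pushout-product with a fixed `g` is anodyne form a weakly saturated class,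
because `X ↦ X × A` preserves colimits. It therefore suffices to treat the generators
(`mbGen_le_pushoutProductLeft`). For monomorphisms the pushout-product is an inclusion of decorated
subcomplexes of `Y × B` (`pushoutProduct_mem_iff_subExtends`), which is factored into attachments of
cells and additions of decorations.

Additions of decorations obey a closure principle (`subExtends_of_isClosed`): passing from
decorations `D` to `T` is anodyne if every family between them which is closed under anodyne changes
of decorations equals `T`. The generators (S1)-(S5) and (E) thereby become inference rules about
faces of a triangle or a 3-simplex. By (S2), a lean triangle of the closed family which is thin in
`T` is already thin in the family, so only marked edges and lean triangles need attention. If `f`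
itself is a change of decorations, it can be applied over each vertex of `B`, and the rules for
3-simplices such as `(σ₂ t, σ₁ b)` spread the result to all pairs (`pushoutProduct_enlarge`).

For the horn generators (A1), (A3), (A4), (A5), saturation in the second variable reduces `g` to
undecorated boundary inclusions and a change of decorations (`pushoutProduct_mem_of_boundary`). The
nondegenerate simplices of `Δ^N × Δ^m` outside the horn and the boundary are paired: a simplex
containing an edge from `(a, t)` to `(a + 1, t)` goes with the face opposite to one end of that edge
(`StepPairing`). Attaching such a pair is a pushout of (A1), except that an edge at the first or
last position may call for (A3), (A4) or (A5). The decorations needed on the horn sit on edges or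
triangles containing this edge, so they are degenerate over `Δ^m` and are decided in `Y`. The
remaining decorations follow from closure (`pushoutProduct_boundary`).

The case (A5) needs one rule which is not a generator: if a thin triangle has marked edges `1 → 2`
and `0 → 2`, then `0 → 1` is marked (`IsClosed.δ_two_mem_marked`). To prove it, the initial vertex
of the triangle is doubled by an isomorphic copy with a marked edge to the middle vertex. The
resulting nerve `dblTri` is built from the triangle by (A1), (A4) and (A5). There (E) marks the
isomorphism, (S1) composes it with the new marked edge, and the triangle is a retract of the nerve.
-/

namespace MBSSet

/-! ### The three kinds of decorations -/

/-- The kinds of decorations of a marked biscaled simplicial set. -/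
inductive Kind
  | marked
  | thin
  | lean

/-- The dimension of the simplices with a decoration of a given kind. -/
abbrev Kind.dim (k : Kind) : ℕ :=
  match k with
  | marked => 1
  | thin => 2
  | lean => 2

/-- The set of simplices with a decoration of a given kind. -/
def deco (X : MBSSet.{u}) (k : Kind) : Set (X.toSSet _⦋k.dim⦌) :=
  match k with
  | Kind.marked => X.marked
  | Kind.thin => X.thin
  | Kind.lean => X.lean

theorem degenerate_subset_deco (X : MBSSet.{u}) (k : Kind) :
    X.toSSet.degenerate k.dim ⊆ X.deco k := by
  cases k
  exacts [X.degenerate_subset_marked, X.degenerate_subset_thin,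
    X.degenerate_subset_thin.trans X.thin_subset_lean]

theorem Hom.map_deco {X Y : MBSSet.{u}} (f : X ⟶ Y) (k : Kind) {e : X.toSSet _⦋k.dim⦌}
    (he : e ∈ X.deco k) : (Hom.hom f).app _ e ∈ Y.deco k := by
  cases k
  exacts [f.map_marked e he, f.map_thin e he, f.map_lean e he]

/-- A map of simplicial sets which preserves all decorations. -/
def homMk {X Y : MBSSet.{u}} (f : X.toSSet ⟶ Y.toSSet)
    (h : ∀ k, ∀ e ∈ X.deco k, f.app _ e ∈ Y.deco k) : X ⟶ Y :=
  ⟨f, h .marked, h .thin, h .lean⟩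

/-- A marked biscaled simplicial set given by its decorations of each kind. -/
def ofDeco (X : SSet.{u}) (D : (k : Kind) → Set (X _⦋k.dim⦌))
    (hdeg : ∀ k, X.degenerate k.dim ⊆ D k) (h : D .thin ⊆ D .lean) : MBSSet.{u} :=
  ⟨X, D .marked, D .thin, D .lean, hdeg .marked, hdeg .thin, h⟩

theorem ofDeco_deco (X : SSet.{u}) (D : (k : Kind) → Set (X _⦋k.dim⦌))
    (hdeg : ∀ k, X.degenerate k.dim ⊆ D k) (h : D .thin ⊆ D .lean) (k : Kind) :
    (ofDeco X D hdeg h).deco k = D k := by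
  cases k <;> rfl

theorem thin_subset_lean' (X : MBSSet.{u}) : X.deco .thin ⊆ X.deco .lean := X.thin_subset_lean

@[simp]
theorem mem_prod_deco {X Y : MBSSet.{u}} (k : Kind) (e : (prod X Y).toSSet _⦋k.dim⦌) :
    e ∈ (prod X Y).deco k ↔ e.1 ∈ X.deco k ∧ e.2 ∈ Y.deco k := by
  cases k <;> rfl

@[simp]
theorem mem_induced_deco {A : SSet.{u}} (X : MBSSet.{u}) (i : A ⟶ X.toSSet) (k : Kind)
    (e : A _⦋k.dim⦌) : e ∈ (induced X i).deco k ↔ i.app _ e ∈ X.deco k := by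
  cases k <;> rfl

/-- The decorations of a given kind of `mk' X E T C` which are not required to be degenerate. -/
def Kind.select {X : SSet.{u}} (E : Set (X _⦋1⦌)) (T C : Set (X _⦋2⦌)) (k : Kind) :
    Set (X _⦋k.dim⦌) :=
  match k with
  | marked => E
  | thin => T
  | lean => T ∪ C

theorem mk'_deco (X : SSet.{u}) (E : Set (X _⦋1⦌)) (T C : Set (X _⦋2⦌)) (k : Kind) :
    (mk' X E T C).deco k = X.degenerate k.dim ∪ k.select E T C := by
  cases k <;> rfl

/-! ### Isomorphisms -/

theorem app_app {X Y Z : SSet.{u}} {f : X ⟶ Y} {g : Y ⟶ Z} {h : X ⟶ Z} (e : f ≫ g = h)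
    {n : SimplexCategoryᵒᵖ} (x : X.obj n) : g.app n (f.app n x) = h.app n x := by
  subst e
  rfl

/-- An isomorphism of simplicial sets which preserves and reflects all decorations. -/
def isoMk {X Y : MBSSet.{u}} (e : X.toSSet ≅ Y.toSSet)
    (h : ∀ k, ∀ x, x ∈ X.deco k ↔ e.hom.app _ x ∈ Y.deco k) : X ≅ Y where
  hom := homMk e.hom fun k x hx => (h k x).1 hx
  inv := homMk e.inv fun k x hx =>
    (h k _).2 (Set.mem_of_eq_of_mem (app_app e.inv_hom_id x) hx)
  hom_inv_id := hom_ext e.hom_inv_id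
  inv_hom_id := hom_ext e.inv_hom_id

/-! ### Colimits -/

/-- The simplicial set `X`, where all simplices are decorated. -/
def sharp : SSet.{u} ⥤ MBSSet.{u} where
  obj X := ⟨X, Set.univ, Set.univ, Set.univ, Set.subset_univ _, Set.subset_univ _, subset_rfl⟩
  map f := ⟨f, fun _ _ => Set.mem_univ _, fun _ _ => Set.mem_univ _, fun _ _ => Set.mem_univ _⟩

/-- Forgetting the decorations is left adjoint to decorating all simplices. -/
def forgetAdjSharp : forget.{u} ⊣ sharp :=
  Adjunction.mkOfHomEquiv
    { homEquiv _ _ :=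
        { toFun f := ⟨f, fun _ _ => Set.mem_univ _, fun _ _ => Set.mem_univ _,
            fun _ _ => Set.mem_univ _⟩
          invFun f := f.hom
          left_inv _ := rfl
          right_inv _ := rfl }
      homEquiv_naturality_left_symm _ _ := rfl
      homEquiv_naturality_right _ _ := rfl }

universe w w'

instance (J : Type w) [Category.{w'} J] : PreservesColimitsOfShape J forget.{u} :=
  forgetAdjSharp.leftAdjoint_preservesColimits.preservesColimitsOfShape

section

variable {J : Type w} [Category.{w'} J] {F : J ⥤ MBSSet.{u}} (c : Cocone F)

/-- A cocone is a colimit if the underlying cocone of simplicial sets is, and if all nondegenerate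
decorated simplices are images of decorated simplices. -/
noncomputable def isColimitOfForget (hc : IsColimit (forget.mapCocone c))
    (h : ∀ k, ∀ x ∈ c.pt.deco k, x ∈ c.pt.toSSet.degenerate k.dim ∨
      ∃ j, ∃ y ∈ (F.obj j).deco k, (Hom.hom (c.ι.app j)).app _ y = x) : IsColimit c where
  desc s := homMk (hc.desc (forget.mapCocone s)) fun k x hx => by
    rcases h k x hx with hx | ⟨j, y, hy, rfl⟩
    · exact s.pt.degenerate_subset_deco k (SSet.app_mem_degenerate _ hx)
    · have e : Hom.hom (c.ι.app j) ≫ hc.desc (forget.mapCocone s) = Hom.hom (s.ι.app j) :=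
        hc.fac (forget.mapCocone s) j
      exact Set.mem_of_eq_of_mem (app_app e y) (Hom.map_deco (s.ι.app j) k hy)
  fac s j := hom_ext (hc.fac (forget.mapCocone s) j)
  uniq s m hm := hom_ext (hc.uniq (forget.mapCocone s) (Hom.hom m) fun j => congrArg Hom.hom (hm j))

/-- The underlying simplicial set of the colimit can be given only the decorations coming from the
stages. The cocone still maps to this object, so the universal property sends the colimit to it over
the identity, and no further decoration can exist. Degenerate simplices lift to degenerate, hence
decorated, simplices of a stage. -/
theorem exists_of_isColimit (hc : IsColimit c) (k : Kind) (x : c.pt.toSSet _⦋k.dim⦌)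
    (hx : x ∈ c.pt.deco k) :
    ∃ j, ∃ y ∈ (F.obj j).deco k, (Hom.hom (c.ι.app j)).app _ y = x := by
  suffices h : x ∈ c.pt.toSSet.degenerate k.dim ∨
      ∃ j, ∃ y ∈ (F.obj j).deco k, (Hom.hom (c.ι.app j)).app _ y = x by
    rcases h with h | h
    · obtain ⟨m, hm, p, y, rfl⟩ := h
      obtain ⟨j, z, rfl⟩ := Types.jointly_surjective_of_isColimit
        (isColimitOfPreserves ((evaluation _ _).obj (op ⦋m⦌)) (isColimitOfPreserves forget hc)) y
      refine ⟨j, (F.obj j).toSSet.map p.op z, (F.obj j).degenerate_subset_deco k ⟨m, hm, p, z, rfl⟩,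
        ?_⟩
      exact NatTrans.naturality_apply (Hom.hom (c.ι.app j)) p.op z
    · exact h
  let T : MBSSet.{u} := ofDeco c.pt.toSSet
    (fun k => {x | x ∈ c.pt.toSSet.degenerate k.dim ∨
      ∃ j, ∃ y ∈ (F.obj j).deco k, (Hom.hom (c.ι.app j)).app _ y = x})
    (fun k x hx => Or.inl hx)
    (fun x hx => hx.imp id fun ⟨j, y, hy, e⟩ => ⟨j, y, (F.obj j).thin_subset_lean hy, e⟩)
  have hT (k : Kind) (x : T.toSSet _⦋k.dim⦌) : x ∈ T.deco k ↔ x ∈ c.pt.toSSet.degenerate k.dim ∨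
      ∃ j, ∃ y ∈ (F.obj j).deco k, (Hom.hom (c.ι.app j)).app _ y = x :=
    Set.ext_iff.1 (ofDeco_deco _ _ _ _ k) x
  let s : Cocone F :=
    { pt := T
      ι :=
        { app j := homMk (X := F.obj j) (Y := T) (Hom.hom (Y := c.pt) (c.ι.app j)) fun k y hy =>
            (hT k _).2 (Or.inr ⟨j, y, hy, rfl⟩)
          naturality _ _ p := hom_ext
            ((congrArg Hom.hom (c.w p)).trans (Category.comp_id _).symm) } }
  let p : T ⟶ c.pt := homMk (𝟙 c.pt.toSSet) fun k x hx => by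
    rcases (hT k x).1 hx with hx | ⟨j, y, hy, rfl⟩
    · exact c.pt.degenerate_subset_deco k hx
    · exact Hom.map_deco (c.ι.app j) k hy
  have hs : hc.desc s ≫ p = 𝟙 c.pt := hc.hom_ext fun j => by
    rw [← Category.assoc, hc.fac]
    exact hom_ext rfl
  refine (hT k x).1 (Set.mem_of_eq_of_mem ?_ (Hom.map_deco (hc.desc s) k hx))
  exact (app_app (g := 𝟙 c.pt.toSSet) (congrArg Hom.hom hs) x).symm

end

/-- A commutative square is a pushout if the underlying square of simplicial sets is, and if all
nondegenerate decorated simplices come from decorated simplices. -/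
theorem isPushout_of_forget {X Y Z T : MBSSet.{u}} {t : X ⟶ Y} {l : X ⟶ Z} {r : Y ⟶ T} {b : Z ⟶ T}
    (sq : IsPushout (Hom.hom t) (Hom.hom l) (Hom.hom r) (Hom.hom b))
    (h : ∀ k, ∀ x ∈ T.deco k, x ∈ T.toSSet.degenerate k.dim ∨
      (∃ y ∈ Y.deco k, (Hom.hom r).app _ y = x) ∨ (∃ z ∈ Z.deco k, (Hom.hom b).app _ z = x)) :
    IsPushout t l r b where
  w := hom_ext sq.w
  isColimit' := ⟨PushoutCocone.IsColimit.mk _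
    (fun s => homMk (sq.desc (Hom.hom s.inl) (Hom.hom s.inr) (congrArg Hom.hom s.condition))
      fun k x hx => by
        rcases h k x hx with hx | ⟨y, hy, rfl⟩ | ⟨y, hy, rfl⟩
        · exact s.pt.degenerate_subset_deco k (SSet.app_mem_degenerate _ hx)
        · exact Set.mem_of_eq_of_mem (app_app (sq.inl_desc _ _ _) y) (Hom.map_deco s.inl k hy)
        · exact Set.mem_of_eq_of_mem (app_app (sq.inr_desc _ _ _) y) (Hom.map_deco s.inr k hy))
    (fun s => hom_ext (sq.inl_desc _ _ _))
    (fun s => hom_ext (sq.inr_desc _ _ _))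
    (fun s m h₁ h₂ => hom_ext (sq.hom_ext
      ((congrArg Hom.hom h₁).trans (sq.inl_desc _ _ (congrArg Hom.hom s.condition)).symm)
      ((congrArg Hom.hom h₂).trans (sq.inr_desc _ _ (congrArg Hom.hom s.condition)).symm)))⟩

/-! ### Products preserve colimits -/

/-- The functor `X ↦ X × A`. -/
def prodRight (A : MBSSet.{u}) : MBSSet.{u} ⥤ MBSSet.{u} where
  obj X := prod X A
  map f := prodMap f (𝟙 A)
  map_id X := hom_ext (by simp [prodMap]; rfl)
  map_comp f g := by rw [prodMap_comp, Category.id_comp]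

/-- The natural transformation `X × A ⟶ X × B` induced by `A ⟶ B`. -/
def prodRightMap {A B : MBSSet.{u}} (g : A ⟶ B) : prodRight A ⟶ prodRight B where
  app X := prodMap (𝟙 X) g
  naturality X Y f := by
    simp only [prodRight, prodMap_comp, Category.id_comp, Category.comp_id]

/-- Products of simplicial sets preserve colimits. A decorated simplex of the product has a
decorated first component, which lifts to a decorated simplex of a stage by `exists_of_isColimit`.
-/
instance (A : MBSSet.{u}) (J : Type w) [Category.{w'} J] :
    PreservesColimitsOfShape J (prodRight A) where
  preservesColimit {F} := ⟨fun {c} hc => ⟨isColimitOfForget _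
    (by
      have := isColimitOfPreserves (tensorRight A.toSSet) (isColimitOfPreserves forget hc)
      exact (IsColimit.equivOfNatIsoOfIso
        (NatIso.ofComponents (fun j => Iso.refl _) (fun {i j} f => by
          dsimp [prodRight, prodMap, forget]
          simp)) _ _
        (Cocone.ext (Iso.refl _) (fun j => by
          dsimp [prodRight, prodMap, forget]
          simp)) this))
    (fun k x hx => by
      have hx := (mem_prod_deco (X := c.pt) (Y := A) k x).1 hx
      obtain ⟨j, y, hy, e⟩ := exists_of_isColimit c hc k _ hx.1
      refine Or.inr ⟨j, (y, x.2), ?_, Prod.ext e rfl⟩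
      exact (mem_prod_deco (X := F.obj j) (Y := A) k _).2 ⟨hy, hx.2⟩)⟩⟩

end MBSSet

namespace MBSSet

/-! ### The Leibniz construction for a natural transformation -/

section Leibniz

universe v₁ v₂ u₁ u₂ w

variable {D : Type u₁} [Category.{v₁} D] {C : Type u₂} [Category.{v₂} C] [HasPushouts C]
  {F G : D ⥤ C} (η : F ⟶ G)

/-- The map `G X ⨿_{F X} F Y ⟶ G Y` induced by `f : X ⟶ Y`. -/
noncomputable def leibniz {X Y : D} (f : X ⟶ Y) : pushout (η.app X) (F.map f) ⟶ G.obj Y :=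
  pushout.desc (G.map f) (η.app Y) (η.naturality f).symm

@[simp]
theorem inl_leibniz {X Y : D} (f : X ⟶ Y) : pushout.inl _ _ ≫ leibniz η f = G.map f :=
  pushout.inl_desc _ _ _

@[simp]
theorem inl_leibniz_assoc {X Y : D} (f : X ⟶ Y) {Z : C} (k : G.obj Y ⟶ Z) :
    pushout.inl _ _ ≫ leibniz η f ≫ k = G.map f ≫ k := by
  rw [← Category.assoc, inl_leibniz]

@[simp]
theorem inr_leibniz {X Y : D} (f : X ⟶ Y) : pushout.inr _ _ ≫ leibniz η f = η.app Y :=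
  pushout.inr_desc _ _ _

@[simp]
theorem inr_leibniz_assoc {X Y : D} (f : X ⟶ Y) {Z : C} (k : G.obj Y ⟶ Z) :
    pushout.inr _ _ ≫ leibniz η f ≫ k = η.app Y ≫ k := by
  rw [← Category.assoc, inr_leibniz]

/-- The functoriality of the source of `leibniz η f`. -/
noncomputable def leibnizMap {X Y X' Y' : D} (f : X ⟶ Y) (f' : X' ⟶ Y') (a : X ⟶ X') (b : Y ⟶ Y')
    (h : f ≫ b = a ≫ f') :
    pushout (η.app X) (F.map f) ⟶ pushout (η.app X') (F.map f') :=
  pushout.map _ _ _ _ (G.map a) (F.map b) (F.map a) (η.naturality a).symm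
    (by rw [← F.map_comp, ← F.map_comp, h])

@[simp]
theorem inl_leibnizMap {X Y X' Y' : D} (f : X ⟶ Y) (f' : X' ⟶ Y') (a : X ⟶ X') (b : Y ⟶ Y')
    (h : f ≫ b = a ≫ f') :
    pushout.inl _ _ ≫ leibnizMap η f f' a b h = G.map a ≫ pushout.inl _ _ :=
  pushout.inl_desc _ _ _

@[simp]
theorem inl_leibnizMap_assoc {X Y X' Y' : D} (f : X ⟶ Y) (f' : X' ⟶ Y') (a : X ⟶ X') (b : Y ⟶ Y')
    (h : f ≫ b = a ≫ f') {Z : C} (k : pushout (η.app X') (F.map f') ⟶ Z) :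
    pushout.inl _ _ ≫ leibnizMap η f f' a b h ≫ k = G.map a ≫ pushout.inl _ _ ≫ k := by
  rw [← Category.assoc, inl_leibnizMap, Category.assoc]

@[simp]
theorem inr_leibnizMap {X Y X' Y' : D} (f : X ⟶ Y) (f' : X' ⟶ Y') (a : X ⟶ X') (b : Y ⟶ Y')
    (h : f ≫ b = a ≫ f') :
    pushout.inr _ _ ≫ leibnizMap η f f' a b h = F.map b ≫ pushout.inr _ _ :=
  pushout.inr_desc _ _ _

@[simp]
theorem inr_leibnizMap_assoc {X Y X' Y' : D} (f : X ⟶ Y) (f' : X' ⟶ Y') (a : X ⟶ X') (b : Y ⟶ Y')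
    (h : f ≫ b = a ≫ f') {Z : C} (k : pushout (η.app X') (F.map f') ⟶ Z) :
    pushout.inr _ _ ≫ leibnizMap η f f' a b h ≫ k = F.map b ≫ pushout.inr _ _ ≫ k := by
  rw [← Category.assoc, inr_leibnizMap, Category.assoc]

theorem inr_leibnizMap_id {X X' Y : D} (f : X ⟶ Y) (f' : X' ⟶ Y) (a : X ⟶ X')
    (h : f ≫ 𝟙 Y = a ≫ f') :
    pushout.inr _ _ ≫ leibnizMap η f f' a (𝟙 Y) h = pushout.inr _ _ := by
  rw [inr_leibnizMap, F.map_id, Category.id_comp]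

@[simp]
theorem leibnizMap_leibniz {X Y X' Y' : D} (f : X ⟶ Y) (f' : X' ⟶ Y') (a : X ⟶ X') (b : Y ⟶ Y')
    (h : f ≫ b = a ≫ f') :
    leibnizMap η f f' a b h ≫ leibniz η f' = leibniz η f ≫ G.map b := by
  apply pushout.hom_ext
  · rw [inl_leibnizMap_assoc, inl_leibniz, inl_leibniz_assoc, ← G.map_comp, ← G.map_comp, h]
  · simp

theorem leibnizMap_id {X Y : D} (f : X ⟶ Y) :
    leibnizMap η f f (𝟙 X) (𝟙 Y) (by simp) = 𝟙 _ := by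
  apply pushout.hom_ext <;> simp

theorem leibnizMap_comp {X Y X' Y' X'' Y'' : D} (f : X ⟶ Y) (f' : X' ⟶ Y') (f'' : X'' ⟶ Y'')
    (a : X ⟶ X') (b : Y ⟶ Y') (h : f ≫ b = a ≫ f') (a' : X' ⟶ X'') (b' : Y' ⟶ Y'')
    (h' : f' ≫ b' = a' ≫ f'') :
    leibnizMap η f f'' (a ≫ a') (b ≫ b') (by rw [reassoc_of% h, h', Category.assoc]) =
      leibnizMap η f f' a b h ≫ leibnizMap η f' f'' a' b' h' := by
  apply pushout.hom_ext <;> simp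

/-- The functor which sends `f` to `leibniz η f`. -/
noncomputable def leibnizFunctor : Arrow D ⥤ Arrow C where
  obj f := Arrow.mk (leibniz η f.hom)
  map {f f'} φ := Arrow.homMk (leibnizMap η f.hom f'.hom φ.left φ.right φ.w.symm) (G.map φ.right)
    (leibnizMap_leibniz η _ _ _ _ _)
  map_id f := Arrow.hom_ext _ _ (leibnizMap_id η f.hom) (G.map_id _)
  map_comp φ ψ := Arrow.hom_ext _ _ (leibnizMap_comp η _ _ _ _ _ φ.w.symm _ _ ψ.w.symm)
    (G.map_comp _ _)

/-- The morphisms `f` such that `leibniz η f` belongs to `W`. -/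
def leibnizInverseImage (W : MorphismProperty C) : MorphismProperty D :=
  fun _ _ f => W (leibniz η f)

instance (W : MorphismProperty C) [W.IsStableUnderRetracts] :
    (leibnizInverseImage η W).IsStableUnderRetracts where
  of_retract h hg := W.of_retract (Retract.map h (leibnizFunctor η)) hg

/-- Pasting the image of the square under `F` with the pushout defining the source for `f'`, and
cancelling the pushout for `f`, leaves a pushout along `G.map a`. Cancelling that one from the image
of the square under `G` gives the claim. -/
theorem isPushout_leibniz_of_isPushout [PreservesColimitsOfShape WalkingSpan F]
    [PreservesColimitsOfShape WalkingSpan G] {X Y X' Y' : D} {f : X ⟶ Y} {f' : X' ⟶ Y'}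
    {a : X ⟶ X'} {b : Y ⟶ Y'} (sq : IsPushout a f f' b) :
    IsPushout (leibnizMap η f f' a b sq.w.symm) (leibniz η f) (leibniz η f') (G.map b) := by
  have h₁ : IsPushout (F.map f) (η.app X) (pushout.inr (η.app X) (F.map f)) (pushout.inl _ _) :=
    (IsPushout.of_hasPushout _ _).flip
  have h₂ := (sq.map F).paste_horiz
    (IsPushout.of_hasPushout (η.app X') (F.map f'))
  have h₃ : IsPushout (G.map a) (pushout.inl (η.app X) (F.map f)) (pushout.inl _ _)
      (leibnizMap η f f' a b sq.w.symm) := by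
    refine IsPushout.of_left (h₁₁ := η.app X) (h₂₁ := pushout.inr _ _) (v₁₁ := F.map f) ?_
      (by simp) (IsPushout.of_hasPushout _ _)
    simpa using h₂
  exact IsPushout.of_top (v₁₁ := pushout.inl _ _) (v₁₂ := pushout.inl _ _)
    (by simpa using sq.map G) (by simp) h₃

instance (W : MorphismProperty C) [W.IsStableUnderCobaseChange]
    [PreservesColimitsOfShape WalkingSpan F]
    [PreservesColimitsOfShape WalkingSpan G] :
    (leibnizInverseImage η W).IsStableUnderCobaseChange where
  of_isPushout sq hf :=
    W.of_isPushout (isPushout_leibniz_of_isPushout η sq) hf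

/-- The first factor of a composition contributes a pushout of its own Leibniz map; this gives the
successor steps for transfinite compositions. -/
theorem isPushout_leibniz_comp {L L' Y : D} (p : L ⟶ L') (q : L' ⟶ Y) (r : L ⟶ Y)
    (h : p ≫ q = r) :
    IsPushout (leibnizMap η p r (𝟙 L) q (by simp [h])) (leibniz η p)
      (leibnizMap η r q p (𝟙 Y) (by simp [h])) (pushout.inl _ _) := by
  subst h
  have h₁ : IsPushout (F.map q) (pushout.inr (η.app L) (F.map p))
      (pushout.inr (η.app L) (F.map (p ≫ q)))
      (leibnizMap η p (p ≫ q) (𝟙 L) q (by simp)) := by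
    refine IsPushout.of_left (h₁₁ := F.map p) (h₂₁ := pushout.inl _ _) (v₁₁ := η.app L) ?_
      (by simp) (IsPushout.of_hasPushout _ _).flip
    simpa using (IsPushout.of_hasPushout (η.app L) (F.map (p ≫ q))).flip
  exact IsPushout.of_top (v₁₁ := pushout.inr _ _) (v₁₂ := pushout.inr _ _)
    (by simpa using (IsPushout.of_hasPushout (η.app L') (F.map q)).flip)
    (by apply pushout.hom_ext <;> simp [pushout.condition]) h₁

/-- The cocones of the sources of Leibniz maps over a fixed object are colimits. -/
theorem nonempty_isColimit_leibniz {I : Type w} [LinearOrder I] [Nonempty I] {K : I ⥤ D}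
    (c : Cocone K) (hF : IsColimit (F.mapCocone c)) (hG : IsColimit (G.mapCocone c)) {Y : D}
    (p : c.pt ⟶ Y) (q : ∀ i, K.obj i ⟶ Y) (hq : ∀ i, c.ι.app i ≫ p = q i)
    {H : I ⥤ C} (s : Cocone H) (inl : ∀ i, G.obj (K.obj i) ⟶ H.obj i)
    (hinl : ∀ i j (h : i ⟶ j), inl i ≫ H.map h = G.map (K.map h) ≫ inl j)
    (inr : ∀ i, F.obj Y ⟶ H.obj i)
    (hinr : ∀ i j (h : i ⟶ j), inr i ≫ H.map h = inr j)
    (sq : ∀ i, IsPushout (η.app (K.obj i)) (F.map (q i)) (inl i) (inr i))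
    {u : G.obj c.pt ⟶ s.pt} {v : F.obj Y ⟶ s.pt} (sq' : IsPushout (η.app c.pt) (F.map p) u v)
    (hu : ∀ i, inl i ≫ s.ι.app i = G.map (c.ι.app i) ≫ u)
    (hv : ∀ i, inr i ≫ s.ι.app i = v) : Nonempty (IsColimit s) := by
  -- The maps out of `F.obj Y` agree at all indices because any two indices are comparable.
  have hr (t : Cocone H) (i j : I) : inr i ≫ t.ι.app i = inr j ≫ t.ι.app j := by
    wlog h : i ≤ j
    · exact (this η c hF hG p q hq s inl hinl inr hinr sq sq' hu hv t j i (le_of_not_ge h)).symm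
    rw [← hinr i j (homOfLE h), Category.assoc, t.w]
  let i₀ : I := Classical.arbitrary I
  let T (t : Cocone H) : Cocone (K ⋙ G) :=
    ⟨t.pt, { app i := inl i ≫ t.ι.app i
             naturality i j h := by
              dsimp
              rw [Category.comp_id, ← Category.assoc, ← hinl, Category.assoc, t.w] }⟩
  have fac (t : Cocone H) (i : I) :
      G.map (c.ι.app i) ≫ hG.desc (T t) = inl i ≫ t.ι.app i := hG.fac (T t) i
  have key (t : Cocone H) : η.app c.pt ≫ hG.desc (T t) = F.map p ≫ inr i₀ ≫ t.ι.app i₀ := by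
    apply hF.hom_ext
    intro i
    dsimp
    have e : F.map (c.ι.app i) ≫ η.app c.pt ≫ hG.desc (T t) =
      η.app (K.obj i) ≫ G.map (c.ι.app i) ≫ hG.desc (T t) :=
        η.naturality_assoc (c.ι.app i) (hG.desc (T t))
    rw [e, fac t i, hr t i₀ i, ← Category.assoc, (sq i).w, ← hq, F.map_comp]
    simp
  refine ⟨⟨fun t => sq'.desc (hG.desc (T t)) (inr i₀ ≫ t.ι.app i₀) (key t), ?_, ?_⟩⟩
  · intro t i
    apply (sq i).hom_ext
    · rw [← Category.assoc, hu, Category.assoc, sq'.inl_desc, fac]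
    · rw [← Category.assoc, hv, sq'.inr_desc, hr t i₀ i]
  · intro t m hm
    apply sq'.hom_ext
    · rw [sq'.inl_desc]
      apply hG.hom_ext
      intro i
      refine Eq.trans ?_ ((congrArg (inl i ≫ ·) (hm i)).trans (fac t i).symm)
      dsimp
      rw [← Category.assoc, ← hu, Category.assoc]
    · rw [sq'.inr_desc, ← hv i₀, Category.assoc, hm]

/-- The sources of the Leibniz maps of a cocone. -/
noncomputable def leibnizDiagram {I : Type w} [Preorder I] {K : I ⥤ D} {Y : D}
    (q : ∀ i, K.obj i ⟶ Y) (hq : ∀ i j (h : i ⟶ j), K.map h ≫ q j = q i) : I ⥤ C where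
  obj i := pushout (η.app (K.obj i)) (F.map (q i))
  map {i j} h := leibnizMap η (q i) (q j) (K.map h) (𝟙 Y) ((Category.comp_id _).trans (hq i j h).symm)
  map_id i := by apply pushout.hom_ext <;> simp
  map_comp f g := by apply pushout.hom_ext <;> simp

theorem leibnizDiagram_isWellOrderContinuous [PreservesColimitsOfSize.{w, w} F]
    [PreservesColimitsOfSize.{w, w} G] {J : Type w} [LinearOrder J] {K : J ⥤ D}
    [K.IsWellOrderContinuous] {Y : D}
    (q : ∀ i, K.obj i ⟶ Y) (hq : ∀ i j (h : i ⟶ j), K.map h ≫ q j = q i) :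
    (leibnizDiagram η q hq).IsWellOrderContinuous where
  nonempty_isColimit m hm := by
    have : Nonempty (Set.Iio m) := by
      obtain ⟨i, hi⟩ := not_isMin_iff.1 hm.1
      exact ⟨⟨i, hi⟩⟩
    have hc := K.isColimitOfIsWellOrderContinuous m hm
    exact nonempty_isColimit_leibniz η _ (isColimitOfPreserves F hc) (isColimitOfPreserves G hc)
      (q m) (fun i => q i.1) (fun i => hq i.1 m (homOfLE i.2.le)) _
      (fun i => pushout.inl (η.app (K.obj i.1)) (F.map (q i.1)))
      (fun i j h => inl_leibnizMap η _ _ _ _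
        ((Category.comp_id _).trans (hq _ _ _).symm))
      (fun i => pushout.inr _ _) (fun i j h => inr_leibnizMap_id η _ _ _
        ((Category.comp_id _).trans (hq _ _ _).symm))
      (fun i => IsPushout.of_hasPushout (η.app (K.obj i)) (F.map (q i.1)))
      (IsPushout.of_hasPushout (η.app (K.obj m)) (F.map (q m)))
      (fun i => inl_leibnizMap η _ _ _ _
        ((Category.comp_id _).trans (hq _ _ _).symm)) (fun i => inr_leibnizMap_id η _ _ _
        ((Category.comp_id _).trans (hq _ _ _).symm))

/-- A transfinite composition with stages `Xᵢ` and colimit `Y` becomes one with stages `G Xᵢ ⨿_{F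
Xᵢ} F Y` and colimit `G Y`. Its successor maps are pushouts of the Leibniz maps of the original
ones, by `isPushout_leibniz_comp`. -/
instance [PreservesColimitsOfSize.{w, w} F] [PreservesColimitsOfSize.{w, w} G]
    (W : MorphismProperty C) [MorphismProperty.IsStableUnderTransfiniteComposition.{w} W]
    [W.IsStableUnderCobaseChange] :
    MorphismProperty.IsStableUnderTransfiniteComposition.{w} (leibnizInverseImage η W) where
  isStableUnderTransfiniteCompositionOfShape J _ _ _ _ := ⟨by
    rintro X Y f ⟨c⟩
    let e : Arrow.mk f ≅ Arrow.mk (c.incl.app ⊥) :=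
      Arrow.isoMk c.isoBot.symm (Iso.refl _) (by simp)
    let q (i : J) : c.F.obj i ⟶ Y := c.incl.app i
    have hq (i j : J) (h : i ⟶ j) : c.F.map h ≫ q j = q i :=
      (c.incl.naturality h).trans (Category.comp_id _)
    change W (leibniz η f)
    refine (W.arrow_mk_iso_iff ((leibnizFunctor η).mapIso e)).2 ?_
    refine W.transfiniteCompositionsOfShape_le J _ ⟨?_⟩
    refine
      { F := leibnizDiagram η q hq
        isoBot := Iso.refl _
        isWellOrderContinuous := leibnizDiagram_isWellOrderContinuous η q hq
        incl :=
          { app j := leibniz η (q j)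
            naturality i j h := by
              refine (leibnizMap_leibniz η (q i) (q j) (c.F.map h) (𝟙 Y) ?_).trans ?_
              · rw [Category.comp_id, hq]
              · rw [G.map_id]
                rfl }
        isColimit := Nonempty.some ?_
        fac := Category.id_comp _
        map_mem := ?_ }
    · exact nonempty_isColimit_leibniz η ⟨Y, c.incl⟩ (isColimitOfPreserves F c.isColimit)
        (isColimitOfPreserves G c.isColimit) (𝟙 Y) q (fun i => Category.comp_id _) _
        (fun i => pushout.inl (η.app (c.F.obj i)) (F.map (q i)))
        (fun i j h => inl_leibnizMap η _ _ _ _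
        ((Category.comp_id _).trans (hq _ _ _).symm))
        (fun i => pushout.inr _ _) (fun i j h => inr_leibnizMap_id η _ _ _
        ((Category.comp_id _).trans (hq _ _ _).symm))
        (fun i => IsPushout.of_hasPushout (η.app (c.F.obj i)) (F.map (q i))) (u := 𝟙 _)
        (v := η.app Y) (IsPushout.of_vert_isIso ⟨by simp⟩)
        (fun i => (inl_leibniz η _).trans (Category.comp_id _).symm) (fun i => inr_leibniz η _)
    · intro j hj
      exact W.of_isPushout (isPushout_leibniz_comp η (c.F.map (homOfLE (Order.le_succ j)))
        (q (Order.succ j)) (q j) (hq _ _ _)) (c.map_mem j hj)⟩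

end Leibniz

end MBSSet

namespace MBSSet

/-! ### Weakly saturated classes -/

section

variable (W : MorphismProperty MBSSet.{u}) [hW : IsWeaklySaturated W]

instance : W.IsStableUnderCobaseChange := hW.cobaseChange

instance : MorphismProperty.IsStableUnderTransfiniteComposition.{u} W := hW.transfinite

instance : W.IsStableUnderRetracts := hW.retracts

end

theorem mbGen_le_mbAnodyne : MBGen.{u} ≤ mbAnodyne := fun _ _ f hf _ _ h => h f hf

instance : IsWeaklySaturated mbAnodyne.{u} where
  cobaseChange := ⟨fun sq hf W _ h => W.of_isPushout sq (hf W ‹_› h)⟩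
  transfinite := ⟨fun J _ _ _ _ => ⟨fun _ _ _ hf W _ h => W.transfiniteCompositionsOfShape_le J _
    (MorphismProperty.transfiniteCompositionsOfShape_monotone J
      (fun _ _ g hg => hg W ‹_› h) _ hf)⟩⟩
  retracts := ⟨fun r hf W _ h => W.of_retract r (hf W ‹_› h)⟩

theorem mbAnodyne_le {W : MorphismProperty MBSSet.{u}} [hW : IsWeaklySaturated W]
    (h : MBGen ≤ W) : mbAnodyne ≤ W := fun _ _ _ hf => hf W hW h

/-- The maps `f` such that the pushout-product of `f` and `g` belongs to `W`. -/
def pushoutProductLeft (W : MorphismProperty MBSSet.{u}) {A B : MBSSet.{u}} (g : A ⟶ B) :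
    MorphismProperty MBSSet.{u} := fun _ _ f => W (pushoutProduct f g)

/-- The maps `g` such that the pushout-product of `f` and `g` belongs to `W`. -/
def pushoutProductRight (W : MorphismProperty MBSSet.{u}) {X Y : MBSSet.{u}} (f : X ⟶ Y) :
    MorphismProperty MBSSet.{u} := fun _ _ g => W (pushoutProduct f g)

/-- The symmetry of the product. -/
def prodComm (X Y : MBSSet.{u}) : prod X Y ≅ prod Y X where
  hom := homMk (β_ X.toSSet Y.toSSet).hom fun k x hx =>
    (mem_prod_deco (X := Y) (Y := X) k _).2 ((mem_prod_deco (X := X) (Y := Y) k x).1 hx).symm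
  inv := homMk (β_ Y.toSSet X.toSSet).hom fun k x hx =>
    (mem_prod_deco (X := X) (Y := Y) k _).2 ((mem_prod_deco (X := Y) (Y := X) k x).1 hx).symm
  hom_inv_id := rfl
  inv_hom_id := rfl

/-- If the source of the pushout-product of `f` and `g` is written as a pushout in another way,
then the induced map is isomorphic to the pushout-product. -/
noncomputable def pushoutProductIso {X Y A B P : MBSSet.{u}} {f : X ⟶ Y} {g : A ⟶ B}
    {inl : prod X B ⟶ P} {inr : prod Y A ⟶ P}
    (sq : IsPushout (prodMap (𝟙 X) g) (prodMap f (𝟙 A)) inl inr) (h : P ⟶ prod Y B)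
    (hl : inl ≫ h = prodMap f (𝟙 B)) (hr : inr ≫ h = prodMap (𝟙 Y) g) :
    Arrow.mk (pushoutProduct f g) ≅ Arrow.mk h :=
  Arrow.isoMk ((IsPushout.of_hasPushout _ _).isoIsPushout _ _ sq) (Iso.refl _) (by
    dsimp
    rw [Category.comp_id]
    apply pushout.hom_ext
    · rw [IsPushout.inl_isoIsPushout_hom_assoc, hl]
      exact (pushout.inl_desc _ _ _).symm
    · rw [IsPushout.inr_isoIsPushout_hom_assoc, hr]
      exact (pushout.inr_desc _ _ _).symm)

theorem pushoutProduct_mem_iff (W : MorphismProperty MBSSet.{u}) [W.RespectsIso]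
    {X Y A B P : MBSSet.{u}} {f : X ⟶ Y} {g : A ⟶ B}
    {inl : prod X B ⟶ P} {inr : prod Y A ⟶ P}
    (sq : IsPushout (prodMap (𝟙 X) g) (prodMap f (𝟙 A)) inl inr) (h : P ⟶ prod Y B)
    (hl : inl ≫ h = prodMap f (𝟙 B)) (hr : inr ≫ h = prodMap (𝟙 Y) g) :
    W (pushoutProduct f g) ↔ W h :=
  W.arrow_mk_iso_iff (pushoutProductIso sq h hl hr)

theorem pushoutProduct_comm_mem_iff (W : MorphismProperty MBSSet.{u}) [W.RespectsIso]
    {X Y A B : MBSSet.{u}} (f : X ⟶ Y) (g : A ⟶ B) :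
    W (pushoutProduct f g) ↔ W (pushoutProduct g f) := by
  have sq : IsPushout (prodMap (𝟙 X) g) (prodMap f (𝟙 A))
      ((prodComm X B).hom ≫ pushout.inr (prodMap (𝟙 A) f) (prodMap g (𝟙 X)))
      ((prodComm Y A).hom ≫ pushout.inl (prodMap (𝟙 A) f) (prodMap g (𝟙 X))) :=
    IsPushout.of_iso (IsPushout.of_hasPushout (prodMap (𝟙 A) f) (prodMap g (𝟙 X))).flip
      (prodComm A X) (prodComm B X) (prodComm A Y) (Iso.refl _) rfl rfl rfl rfl
  refine (pushoutProduct_mem_iff W sq (pushoutProduct g f ≫ (prodComm B Y).hom) ?_ ?_).trans ?_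
  · rw [Category.assoc, pushoutProduct, pushout.inr_desc_assoc]
    rfl
  · rw [Category.assoc, pushoutProduct, pushout.inl_desc_assoc]
    rfl
  · exact MorphismProperty.cancel_right_of_respectsIso W _ _

section

variable (W : MorphismProperty MBSSet.{u}) [hW : IsWeaklySaturated W]

instance (A : MBSSet.{u}) : PreservesColimitsOfSize.{u, u} (prodRight A) := ⟨inferInstance⟩

instance {A B : MBSSet.{u}} (g : A ⟶ B) : IsWeaklySaturated (pushoutProductLeft W g) where
  cobaseChange := inferInstanceAs
    (leibnizInverseImage (prodRightMap g) W).IsStableUnderCobaseChange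
  transfinite := inferInstanceAs (MorphismProperty.IsStableUnderTransfiniteComposition.{u}
    (leibnizInverseImage (prodRightMap g) W))
  retracts := inferInstanceAs (leibnizInverseImage (prodRightMap g) W).IsStableUnderRetracts

/-- The symmetry of the product transports saturation from the first variable to the second. It is
used to cut `g` into cells. -/
instance {X Y : MBSSet.{u}} (f : X ⟶ Y) : IsWeaklySaturated (pushoutProductRight W f) := by
  have : pushoutProductRight W f = pushoutProductLeft W f := by
    ext A B g
    exact pushoutProduct_comm_mem_iff W f g
  rw [this]
  infer_instance

end

end MBSSet

namespace MBSSet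

/-! ### Transfinite compositions along increasing families -/

section Chain

universe v' w u'

variable {L : Type u} [CompleteLattice L] {C : Type u'} [Category.{v'} C] (F : L ⥤ C)
  (W : MorphismProperty C)

/-- For `p ≤ q`, the condition that `F.obj p ⟶ F.obj q` belongs to `W`. -/
def Extends (p q : L) : Prop := ∃ h : p ≤ q, W (F.map (homOfLE h))

variable {F W}

theorem Extends.refl [W.ContainsIdentities] (p : L) : Extends F W p p :=
  ⟨le_rfl, by
    have := W.id_mem (F.obj p)
    rwa [← F.map_id] at this⟩

theorem Extends.trans [W.IsStableUnderComposition] {p q r : L} (h : Extends F W p q)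
    (h' : Extends F W q r) : Extends F W p r :=
  ⟨h.1.trans h'.1, by
    rw [← homOfLE_comp h.1 h'.1, F.map_comp]
    exact W.comp_mem _ _ h.2 h'.2⟩

/-- The stages are `p` joined with the `s i` for `i < j`, where `j` runs through `WithTop I`, so
that the stage `⊤` contains every `s i`. A limit stage is the supremum of the earlier ones, which
`F` preserves; only nonempty chains occur, so nothing is required of `F` on the least element. -/
theorem extends_of_wellOrder
    [MorphismProperty.IsStableUnderTransfiniteComposition.{u} W] [W.RespectsIso]
    [hF : ∀ (J : Type u) [LinearOrder J] [Nonempty J], PreservesColimitsOfShape J F]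
    {I : Type u} [LinearOrder I] [WellFoundedLT I] (p : L) (s : I → L)
    (h : ∀ i, Extends F W (p ⊔ ⨆ (j) (_ : j < i), s j) (p ⊔ (⨆ (j) (_ : j < i), s j) ⊔ s i)) :
    Extends F W p (p ⊔ ⨆ i, s i) := by
  let J := WithTop I
  let : SuccOrder J := SuccOrder.ofLinearWellFoundedLT J
  let : OrderBot J := WellFoundedLT.toOrderBot J
  let G (j : J) : L := p ⊔ ⨆ (i : I) (_ : (i : J) < j), s i
  have hG : Monotone G := fun j j' hj => sup_le_sup_left
    (iSup₂_le fun i hi => le_iSup₂_of_le (f := fun (i : I) (_ : (i : J) < j') => s i) i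
      (hi.trans_le hj) le_rfl) _
  have hbot : G ⊥ = p := by
    simp [G]
  have htop : G ⊤ = p ⊔ ⨆ i, s i := by
    have (i : I) : (i : J) < ⊤ := WithTop.coe_lt_top i
    simp [G, this]
  refine ⟨le_sup_left, ?_⟩
  have key : W (F.map (homOfLE (hG (bot_le (a := (⊤ : J)))))) := by
    refine W.transfiniteCompositionsOfShape_le J _ ⟨?_⟩
    refine
      { F := hG.functor ⋙ F
        isoBot := Iso.refl _
        isWellOrderContinuous := ⟨fun m hm => ?_⟩
        incl :=
          { app j := F.map (homOfLE (hG le_top))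
            naturality i j h := by
              refine (F.map_comp _ _).symm.trans ?_
              exact (Category.comp_id _).symm }
        isColimit := ?_
        fac := Category.id_comp _
        map_mem := ?_ }
    · have : Nonempty (Set.Iio m) := by
        obtain ⟨i, hi⟩ := not_isMin_iff.1 hm.1
        exact ⟨⟨i, hi⟩⟩
      have hl : IsLUB (Set.range ((Set.principalSegIio m).monotone.functor ⋙ hG.functor).obj)
          (G m) := by
        refine ⟨?_, fun b hb => ?_⟩
        · rintro _ ⟨j, rfl⟩
          exact hG j.2.le
        · have hb' (j : J) (hj : j < m) : G j ≤ b := hb ⟨⟨j, hj⟩, rfl⟩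
          refine sup_le (le_sup_left.trans (hb' ⊥ hm.bot_lt)) (iSup₂_le fun i hi => ?_)
          refine le_trans ?_ (hb' (Order.succ (i : J)) (hm.succ_lt hi))
          exact (le_iSup₂_of_le (f := fun (k : I) (_ : (k : J) < Order.succ (i : J)) => s k) i
            (Order.lt_succ_of_not_isMax (not_isMax_of_lt hi)) le_rfl).trans le_sup_right
      have := isColimitOfPreserves F (Preorder.colimitCoconeOfIsLUB _ hl).isColimit
      exact ⟨IsColimit.ofIsoColimit this (Cocone.ext (Iso.refl _) (fun j => Category.comp_id _))⟩
    · have hl : IsLUB (Set.range hG.functor.obj) (G ⊤) :=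
        ⟨by rintro _ ⟨j, rfl⟩; exact hG le_top, fun b hb => hb ⟨⊤, rfl⟩⟩
      exact IsColimit.ofIsoColimit
        (isColimitOfPreserves F (Preorder.colimitCoconeOfIsLUB _ hl).isColimit)
        (Cocone.ext (Iso.refl _) (fun j => Category.comp_id _))
    · intro j hj
      obtain ⟨i, rfl⟩ := WithTop.ne_top_iff_exists.1 (fun e : j = ⊤ => hj (e ▸ isMax_top))
      have hi : G i = p ⊔ ⨆ (j) (_ : j < i), s j := by
        simp [G]
      have hs : G (Order.succ (i : J)) = p ⊔ (⨆ (j) (_ : j < i), s j) ⊔ s i := by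
        dsimp only [G]
        rw [sup_assoc]
        congr 1
        have (k : I) : (k : J) < Order.succ (i : J) ↔ k < i ∨ k = i := by
          rw [Order.lt_succ_iff_of_not_isMax hj, WithTop.coe_le_coe, le_iff_lt_or_eq]
        simp only [this, iSup_or, iSup_sup_eq, iSup_iSup_eq_left]
      have : Extends F W (G i) (G (Order.succ (i : J))) := by
        rw [hi, hs]
        exact h i
      exact this.2
  have h' : Extends F W (G ⊥) (G ⊤) := ⟨hG bot_le, key⟩
  rw [hbot, htop] at h'
  exact h'.2

/-- A variant of `extends_of_wellOrder`, for a family indexed by a type with a rank function. -/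
theorem extends_of_rank
    [MorphismProperty.IsStableUnderTransfiniteComposition.{u} W] [W.RespectsIso]
    [hF : ∀ (J : Type u) [LinearOrder J] [Nonempty J], PreservesColimitsOfShape J F]
    {I : Type u} (ρ : I → ℕ) (p : L) (s : I → L)
    (h : ∀ (i : I) (T : Set I), (∀ j, ρ j < ρ i → j ∈ T) → (∀ j ∈ T, ρ j ≤ ρ i) → i ∉ T →
      Extends F W (p ⊔ ⨆ j ∈ T, s j) (p ⊔ (⨆ j ∈ T, s j) ⊔ s i)) :
    Extends F W p (p ⊔ ⨆ i, s i) := by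
  -- This well-order refines the comparison of ranks: the elements below `i` include all those of
  -- smaller rank and none of larger rank.
  let : LinearOrder I := IsWellFounded.wellOrderExtension (InvImage (· < ·) ρ)
  have : WellFoundedLT I := IsWellFounded.wellOrderExtension.isWellFounded_lt _
  have hr (i j : I) (hij : ρ i < ρ j) : i < j :=
    Prod.Lex.left _ _ (IsWellFounded.rank_lt_of_rel (r := InvImage (· < ·) ρ) hij)
  refine extends_of_wellOrder (hF := hF) p s fun i => h i {j | j < i} (fun j hj => hr _ _ hj)
    (fun j hj => ?_) (lt_irrefl i)
  by_contra h'
  exact lt_asymm hj (hr _ _ (not_le.1 h'))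

end Chain

end MBSSet

namespace MBSSet

/-! ### Decorated subcomplexes of a simplicial set -/

section Sub

variable {Z : SSet.{u}}

/-- The families of decorations generating a marked biscaled structure on subcomplexes of `Z`. -/
abbrev DecoSet (Z : SSet.{u}) : Type u := (k : Kind) → Set (Z _⦋k.dim⦌)

/-- The decorations generated by a family: degenerate simplices are added, and thin triangles
are made lean. -/
def DecoSet.sat (D : DecoSet Z) (k : Kind) : Set (Z _⦋k.dim⦌) :=
  match k with
  | .marked => Z.degenerate 1 ∪ D .marked
  | .thin => Z.degenerate 2 ∪ D .thin
  | .lean => Z.degenerate 2 ∪ (D .thin ∪ D .lean)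

theorem DecoSet.degenerate_subset_sat (D : DecoSet Z) (k : Kind) :
    Z.degenerate k.dim ⊆ D.sat k := by
  cases k <;> exact Set.subset_union_left

theorem DecoSet.subset_sat (D : DecoSet Z) (k : Kind) : D k ⊆ D.sat k := by
  cases k
  exacts [Set.subset_union_right, Set.subset_union_right,
    Set.subset_union_right.trans Set.subset_union_right]

theorem DecoSet.thin_sat_subset (D : DecoSet Z) : D.sat .thin ⊆ D.sat .lean :=
  Set.union_subset_union_right _ Set.subset_union_left

theorem DecoSet.sat_mono {D D' : DecoSet Z} (h : D ≤ D') (k : Kind) : D.sat k ⊆ D'.sat k := by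
  cases k
  exacts [Set.union_subset_union_right _ (h _), Set.union_subset_union_right _ (h _),
    Set.union_subset_union_right _ (Set.union_subset_union (h _) (h _))]

theorem DecoSet.sat_subset {D : DecoSet Z} {T : DecoSet Z} (hdeg : ∀ k, Z.degenerate k.dim ⊆ T k)
    (hT : T .thin ⊆ T .lean) (h : D ≤ T) (k : Kind) : D.sat k ⊆ T k := by
  cases k
  exacts [Set.union_subset (hdeg .marked) (h _), Set.union_subset (hdeg .thin) (h _),
    Set.union_subset (hdeg .lean) (Set.union_subset ((h .thin).trans hT) (h _))]

theorem DecoSet.mem_sat_iSup {J : Type*} (D : J → DecoSet Z) (k : Kind) (x : Z _⦋k.dim⦌) :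
    x ∈ (⨆ j, D j).sat k ↔ x ∈ Z.degenerate k.dim ∨ ∃ j, x ∈ (D j).sat k := by
  constructor
  · intro h
    refine DecoSet.sat_subset (T := fun k => {x | x ∈ Z.degenerate k.dim ∨ ∃ j, x ∈ (D j).sat k})
      (fun k x hx => Or.inl hx) (fun x hx => hx.imp_right fun ⟨j, hj⟩ => ⟨j, thin_sat_subset _ hj⟩)
      (fun k => ?_) k h
    rw [iSup_apply]
    exact iSup_le fun j x hx => Or.inr ⟨j, subset_sat _ _ hx⟩
  · rintro (h | ⟨j, h⟩)
    · exact degenerate_subset_sat _ _ h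
    · exact sat_mono (le_iSup D j) k h

/-- Subcomplexes of `Z`, together with decorations. -/
def Sub (Z : SSet.{u}) : Type u := Z.Subcomplex × DecoSet Z

instance : CompleteLattice (Sub Z) := inferInstanceAs (CompleteLattice (Z.Subcomplex × DecoSet Z))

/-- The decorated subcomplex given by a subcomplex and decorations. -/
def Sub.mk (S : Z.Subcomplex) (D : DecoSet Z) : Sub Z := ⟨S, D⟩

theorem Sub.mk_le {S S' : Z.Subcomplex} {D D' : DecoSet Z} (h : S ≤ S') (h' : D ≤ D') :
    Sub.mk S D ≤ Sub.mk S' D' := ⟨h, h'⟩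

theorem Sub.mk_sup (S S' : Z.Subcomplex) (D D' : DecoSet Z) :
    Sub.mk S D ⊔ Sub.mk S' D' = Sub.mk (S ⊔ S') (D ⊔ D') := rfl

theorem Sub.fst_le {p q : Sub Z} (h : p ≤ q) : p.1 ≤ q.1 := And.left h

theorem Sub.snd_le {p q : Sub Z} (h : p ≤ q) : p.2 ≤ q.2 := And.right h

theorem Sub.fst_iSup {J : Sort*} (p : J → Sub Z) : (⨆ j, p j).1 = ⨆ j, (p j).1 :=
  Prod.fst_iSup (α := Z.Subcomplex) (β := DecoSet Z) p

theorem Sub.snd_iSup {J : Sort*} (p : J → Sub Z) : (⨆ j, p j).2 = ⨆ j, (p j).2 :=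
  Prod.snd_iSup (α := Z.Subcomplex) (β := DecoSet Z) p

theorem Sub.iSup_mk {J : Sort*} (S : J → Z.Subcomplex) (D : J → DecoSet Z) :
    ⨆ j, Sub.mk (S j) (D j) = Sub.mk (⨆ j, S j) (⨆ j, D j) :=
  Prod.ext (Sub.fst_iSup _) (Sub.snd_iSup _)

/-- The marked biscaled simplicial set given by a subcomplex and decorations. -/
def Sub.toMB (p : Sub Z) : MBSSet.{u} :=
  ofDeco p.1.toSSet (fun k => {x | x.1 ∈ p.2.sat k})
    (fun k _ hx => p.2.degenerate_subset_sat k (SSet.app_mem_degenerate p.1.ι hx))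
    (fun _ hx => p.2.thin_sat_subset hx)

theorem Sub.mem_toMB_deco (p : Sub Z) (k : Kind) (x : p.toMB.toSSet _⦋k.dim⦌) :
    x ∈ p.toMB.deco k ↔ x.1 ∈ p.2.sat k :=
  Set.ext_iff.1 (ofDeco_deco _ _ _ _ k) x

/-- The inclusion of decorated subcomplexes. -/
def Sub.homOfLE {p q : Sub Z} (h : p ≤ q) : p.toMB ⟶ q.toMB :=
  homMk (SSet.Subcomplex.homOfLE (Sub.fst_le h)) fun k x hx =>
    (q.mem_toMB_deco k _).2 (DecoSet.sat_mono (Sub.snd_le h) k ((p.mem_toMB_deco k x).1 hx))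

variable (Z) in
/-- The functor sending decorated subcomplexes to marked biscaled simplicial sets. -/
def Sub.functor : Sub Z ⥤ MBSSet.{u} where
  obj p := p.toMB
  map h := Sub.homOfLE (leOfHom h)

/-- The first projection, as a functor. -/
def Sub.fstFunctor : Sub Z ⥤ Z.Subcomplex := Monotone.functor (f := fun p : Sub Z => p.1) fun _ _ h => Sub.fst_le h

/-- A supremum of a chain of subcomplexes is a union, and a nondegenerate decoration generated by a
supremum of families is generated by one of them. -/
instance (J : Type u) [LinearOrder J] [Nonempty J] :
    PreservesColimitsOfShape J (Sub.functor Z) where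
  preservesColimit {K} := preservesColimit_of_preserves_colimit_cocone
    (Preorder.colimitCoconeOfIsLUB K (pt := ⨆ j, K.obj j) isLUB_iSup).isColimit
    (isColimitOfForget _
      (by
        have hl : IsLUB (Set.range (K ⋙ Sub.fstFunctor).obj) (⨆ j, K.obj j).1 := by
          rw [Sub.fst_iSup]
          exact isLUB_iSup
        exact IsColimit.ofIsoColimit (isColimitOfPreserves SSet.Subcomplex.toSSetFunctor
          (Preorder.colimitCoconeOfIsLUB _ hl).isColimit) (Cocone.ext (Iso.refl _)
            (fun j => Category.comp_id _)))
      (fun k x hx => by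
        have hx' := (Sub.mem_toMB_deco (⨆ j, K.obj j) k x).1 hx
        have hS : x.1 ∈ (⨆ j, K.obj j).1.obj _ := x.2
        rw [Sub.fst_iSup, Subfunctor.iSup_obj, Set.mem_iUnion] at hS
        rw [Sub.snd_iSup, DecoSet.mem_sat_iSup] at hx'
        obtain ⟨j, hj⟩ := hS
        rcases hx' with hx' | ⟨j', hj'⟩
        · exact Or.inr ⟨j, ⟨x.1, hj⟩, (Sub.mem_toMB_deco (K.obj j) k _).2
            (DecoSet.degenerate_subset_sat _ _ hx'), Subtype.ext rfl⟩
        -- Decorations are recorded on all of `Z`, so a simplex may enter the subcomplex and the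
        -- decorations at different stages; the later stage has both.
        · refine Or.inr ⟨max j j', ⟨x.1, ?_⟩, (Sub.mem_toMB_deco (K.obj (max j j')) k _).2 ?_,
            Subtype.ext rfl⟩
          · exact Sub.fst_le (leOfHom (K.map (CategoryTheory.homOfLE (le_max_left j j')))) _ hj
          · exact DecoSet.sat_mono
              (Sub.snd_le (leOfHom (K.map (CategoryTheory.homOfLE (le_max_right j j'))))) k hj'))

/-- The inclusion of a decorated subcomplex in a decorated subcomplex belongs to `W`. -/
abbrev SubExtends (W : MorphismProperty MBSSet.{u}) (p q : Sub Z) : Prop :=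
  Extends (Sub.functor Z) W p q

theorem subExtends_of_rank {W : MorphismProperty MBSSet.{u}}
    [MorphismProperty.IsStableUnderTransfiniteComposition.{u} W] [W.RespectsIso]
    {I : Type u} (ρ : I → ℕ) (p : Sub Z) (s : I → Sub Z)
    (h : ∀ (i : I) (T : Set I), (∀ j, ρ j < ρ i → j ∈ T) → (∀ j ∈ T, ρ j ≤ ρ i) → i ∉ T →
      SubExtends W (p ⊔ ⨆ j ∈ T, s j) (p ⊔ (⨆ j ∈ T, s j) ⊔ s i)) :
    SubExtends W p (p ⊔ ⨆ i, s i) :=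
  extends_of_rank (hF := fun _ _ _ => inferInstance) ρ p s h

end Sub

/-! ### Pushouts -/

/-- A criterion for a commutative square of simplicial sets to be a pushout. -/
theorem isPushout_sset {X Y Z T : SSet.{u}} {t : X ⟶ Y} {l : X ⟶ Z} {r : Y ⟶ T} {b : Z ⟶ T}
    (w : t ≫ r = l ≫ b) [Mono t] [Mono b]
    (h₁ : ∀ n (x : T.obj n), (∃ y, r.app n y = x) ∨ ∃ z, b.app n z = x)
    (h₂ : ∀ n y z, r.app n y = b.app n z → ∃ x, t.app n x = y)
    (h₃ : ∀ n y y', r.app n y = r.app n y' → (∃ x, t.app n x = y) ∨ y = y') :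
    IsPushout t l r b where
  w := w
  isColimit' := ⟨evaluationJointlyReflectsColimits _ (fun n ↦ by
    refine (isColimitMapCoconePushoutCoconeEquiv _ _).symm
      (IsPushout.isColimit ?_)
    have ht : Function.Injective (t.app n) := (mono_iff_injective _).1 inferInstance
    have hb : Function.Injective (b.app n) := (mono_iff_injective _).1 inferInstance
    refine IsPushout.flip (Types.isPushout_of_isPullback_of_mono' ?_ ?_ ?_)
    · rw [Types.isPullback_iff]
      refine ⟨?_, ?_, ?_⟩
      · ext x
        exact (ConcreteCategory.congr_hom (congr_app w n) x).symm
      · intro x x' h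
        exact ht h.2
      · intro z y h
        obtain ⟨x, rfl⟩ := h₂ n y z h.symm
        refine ⟨x, hb ?_, rfl⟩
        exact (app_app w.symm x).trans ((app_app rfl x).symm.trans h.symm)
    · ext x
      simp
      exact (h₁ n x).symm
    · intro y y' hy hy' h
      exact (h₃ n y y' h).resolve_left hy)⟩

end MBSSet

/-! ### Attaching cells to decorated subcomplexes. -/

namespace MBSSet

section Attach

variable {Z : SSet.{u}} {W : MorphismProperty MBSSet.{u}} [W.IsStableUnderCobaseChange]

/-- Attaching `G` along `K` to a decorated subcomplex. -/
theorem subExtends_of_attach {K G : MBSSet.{u}} (φ : K ⟶ G) [Mono φ.hom] (hφ : W φ) {p q : Sub Z}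
    (hpq : p ≤ q) (x : G.toSSet ⟶ Z)
    (hq : ∀ n g, x.app n g ∈ q.1.obj n)
    (hp : ∀ n k, x.app n (φ.hom.app n k) ∈ p.1.obj n)
    (hcov : ∀ n, ∀ z ∈ q.1.obj n, z ∈ p.1.obj n ∨ ∃ g, x.app n g = z)
    (hinv : ∀ n g, x.app n g ∈ p.1.obj n → ∃ k, φ.hom.app n k = g)
    (hinj : ∀ n g g', x.app n g = x.app n g' → (∃ k, φ.hom.app n k = g) ∨ g = g')
    (hK : ∀ k, ∀ e ∈ K.deco k, x.app _ (φ.hom.app _ e) ∈ p.2.sat k)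
    (hG : ∀ k, ∀ e ∈ G.deco k, x.app _ e ∈ q.2.sat k)
    (hdec : ∀ k, ∀ z ∈ q.1.obj _, z ∈ q.2.sat k → z ∈ Z.degenerate k.dim ∨
      (z ∈ p.1.obj _ ∧ z ∈ p.2.sat k) ∨ ∃ e ∈ G.deco k, x.app _ e = z) :
    SubExtends W p q := by
  have hp' : SSet.Subcomplex.range (φ.hom ≫ x) ≤ p.1 := by
    rintro n _ ⟨k, rfl⟩
    exact hp n k
  have hq' : SSet.Subcomplex.range x ≤ q.1 := by
    rintro n _ ⟨g, rfl⟩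
    exact hq n g
  let l : K ⟶ p.toMB := homMk (X := K) (Y := p.toMB) (SSet.Subcomplex.lift (φ.hom ≫ x) hp')
    fun k e he => (p.mem_toMB_deco k _).2 (hK k e he)
  let r : G ⟶ q.toMB := homMk (X := G) (Y := q.toMB) (SSet.Subcomplex.lift x hq')
    fun k e he => (q.mem_toMB_deco k _).2 (hG k e he)
  have hm : Mono (Hom.hom (Sub.homOfLE hpq)) :=
    inferInstanceAs (Mono (SSet.Subcomplex.homOfLE (Sub.fst_le hpq)))
  have sq : IsPushout φ l r (Sub.homOfLE hpq) := by
    refine isPushout_of_forget (isPushout_sset rfl ?_ ?_ ?_) ?_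
    · intro n z
      rcases hcov n z.1 z.2 with h | ⟨g, h⟩
      · exact Or.inr ⟨⟨z.1, h⟩, Subtype.ext rfl⟩
      · exact Or.inl ⟨g, Subtype.ext h⟩
    · intro n y z h
      exact hinv n y (Set.mem_of_eq_of_mem (congrArg Subtype.val h) z.2)
    · intro n y y' h
      exact hinj n y y' (congrArg Subtype.val h)
    · intro k z hz
      have hz' := (q.mem_toMB_deco k z).1 hz
      rcases hdec k z.1 z.2 hz' with h | ⟨h, h'⟩ | ⟨e, he, h⟩
      · exact Or.inl ((SSet.Subcomplex.mem_degenerate_iff q.1 z).2 h)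
      · exact Or.inr (Or.inr ⟨⟨z.1, h⟩, (p.mem_toMB_deco k _).2 h', Subtype.ext rfl⟩)
      · exact Or.inr (Or.inl ⟨e, he, Subtype.ext h⟩)
  exact ⟨hpq, W.of_isPushout sq.flip hφ⟩

/-- Such an inclusion is an isomorphism, presented here as a pushout of an identity. -/
theorem subExtends_of_sat_le [W.ContainsIdentities] {p q : Sub Z} (hpq : p ≤ q) (h₁ : q.1 ≤ p.1)
    (h₂ : ∀ k, q.2.sat k ⊆ p.2.sat k) : SubExtends W p q :=
  have : Mono (Hom.hom (𝟙 p.toMB)) := inferInstanceAs (Mono (𝟙 p.1.toSSet))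
  subExtends_of_attach (𝟙 p.toMB) (W.id_mem _) hpq p.1.ι
    (fun n g => Sub.fst_le hpq n g.2) (fun _ k => k.2) (fun n _ hz => Or.inl (h₁ n hz))
    (fun _ g _ => ⟨g, rfl⟩) (fun _ g _ _ => Or.inl ⟨g, rfl⟩)
    (fun k e he => (p.mem_toMB_deco k e).1 he)
    (fun k e he => DecoSet.sat_mono (Sub.snd_le hpq) k ((p.mem_toMB_deco k e).1 he))
    (fun k _ hz hz' => Or.inr (Or.inl ⟨h₁ _ hz, h₂ k hz'⟩))

end Attach

/-! ### Adding decorations: closed families. -/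

section Closure

variable {Z : SSet.{u}} (W : MorphismProperty MBSSet.{u})

/-- A family of decorations `D` is closed relative to `T` if it contains all decorations in `T`
which can be added by pushouts along maps in `W` between decorations of a simplicial set. -/
structure IsClosed (T D : DecoSet Z) : Prop where
  degenerate_subset : ∀ k, Z.degenerate k.dim ⊆ D k
  thin_subset : D .thin ⊆ D .lean
  rule : ∀ {G : SSet.{u}} {E E' : Set (G _⦋1⦌)} {S C S' C' : Set (G _⦋2⦌)}
    (hE : E ⊆ E') (hS : S ⊆ S') (hC : S ∪ C ⊆ S' ∪ C'), W (enlarge G hE hS hC) → ∀ u : G ⟶ Z,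
    (∀ e ∈ E, u.app _ e ∈ D .marked) → (∀ t ∈ S, u.app _ t ∈ D .thin) →
    (∀ t ∈ C, u.app _ t ∈ D .lean) →
    (∀ e ∈ E', u.app _ e ∈ T .marked) → (∀ t ∈ S', u.app _ t ∈ T .thin) →
    (∀ t ∈ C', u.app _ t ∈ T .lean) →
    (∀ e ∈ E', u.app _ e ∈ D .marked) ∧ (∀ t ∈ S', u.app _ t ∈ D .thin) ∧
    (∀ t ∈ C', u.app _ t ∈ D .lean)

variable {W} [IsWeaklySaturated W]

/-- All simplices of `Z`, with given decorations. -/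
abbrev DecoSet.toSub (D : DecoSet Z) : Sub Z := Sub.mk ⊤ D

theorem DecoSet.toSub_le {D D' : DecoSet Z} (h : D ≤ D') : D.toSub ≤ D'.toSub := ⟨le_rfl, h⟩

/-- One application of a rule: a pushout of `enlarge` along `u`, which exists because `u` sends the
source decorations into `D`. The new decorations `N` are the images of those in the target. -/
theorem subExtends_of_enlarge {G : SSet.{u}} {E E' : Set (G _⦋1⦌)} {S C S' C' : Set (G _⦋2⦌)}
    (hE : E ⊆ E') (hS : S ⊆ S') (hC : S ∪ C ⊆ S' ∪ C') (hW : W (enlarge G hE hS hC)) (u : G ⟶ Z)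
    (D N : DecoSet Z)
    (h₁ : ∀ e ∈ E, u.app _ e ∈ D .marked) (h₂ : ∀ t ∈ S, u.app _ t ∈ D .thin)
    (h₃ : ∀ t ∈ C, u.app _ t ∈ D .lean)
    (hN : ∀ k, N k = (u.app _) '' (k.select E' S' C')) :
    SubExtends W D.toSub (D ⊔ N).toSub := by
  have : Mono (Hom.hom (enlarge G hE hS hC)) := inferInstanceAs (Mono (𝟙 G))
  have hK (k : Kind) (e : G _⦋k.dim⦌) (he : e ∈ (mk' G E S C).deco k) : u.app _ e ∈ D.sat k := by
    rw [mk'_deco] at he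
    rcases he with he | he
    · exact D.degenerate_subset_sat k (SSet.app_mem_degenerate u he)
    · cases k
      · exact D.subset_sat _ (h₁ _ he)
      · exact D.subset_sat _ (h₂ _ he)
      · exact he.elim (fun h => D.thin_sat_subset (D.subset_sat _ (h₂ _ h)))
          (fun h => D.subset_sat _ (h₃ _ h))
  refine subExtends_of_attach (enlarge G hE hS hC) hW (DecoSet.toSub_le le_sup_left) u
    (fun _ _ => Set.mem_univ _) (fun _ _ => Set.mem_univ _) (fun _ _ _ => Or.inl (Set.mem_univ _))
    (fun _ g _ => ⟨g, rfl⟩) (fun _ g _ _ => Or.inl ⟨g, rfl⟩) hK ?_ ?_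
  · intro k e he
    rw [mk'_deco] at he
    rcases he with he | he
    · exact DecoSet.degenerate_subset_sat _ k (SSet.app_mem_degenerate u he)
    · refine DecoSet.subset_sat _ _ (Or.inr ?_)
      rw [hN]
      exact ⟨e, he, rfl⟩
  · intro k z _ hz
    have key : (D ⊔ N).sat k ⊆ D.sat k ∪ (u.app _) '' ((mk' G E' S' C').deco k) := by
      refine DecoSet.sat_subset
        (T := fun k => D.sat k ∪ (u.app _) '' ((mk' G E' S' C').deco k)) ?_ ?_ ?_ k
      · exact fun k => (D.degenerate_subset_sat k).trans Set.subset_union_left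
      · exact Set.union_subset_union D.thin_sat_subset
          (Set.image_mono (thin_subset_lean' _))
      · refine sup_le (fun k => (D.subset_sat k).trans Set.subset_union_left) (fun k => ?_)
        rw [hN, mk'_deco]
        exact (Set.image_mono Set.subset_union_right).trans Set.subset_union_right
    rcases key hz with h | h
    · exact Or.inr (Or.inl ⟨Set.mem_univ _, h⟩)
    · exact Or.inr (Or.inr h)

/-- Decorations can be added if they are contained in all closed families. -/
theorem subExtends_of_isClosed {D T : DecoSet Z} (hDT : D ≤ T)
    (hT : ∀ k, Z.degenerate k.dim ⊆ T k) (hT' : T .thin ⊆ T .lean)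
    (h : ∀ M : DecoSet Z, D ≤ M → M ≤ T → IsClosed W T M → T ≤ M) :
    SubExtends W D.toSub T.toSub := by
  -- `S` collects what can be added to every family between `D` and `T`. Quantifying over the
  -- starting family `N'` makes `S` stable under suprema, by transfinite composition.
  let S : Set (DecoSet Z) := {N | N ≤ T ∧ ∀ N', D ≤ N' → N' ≤ T →
    SubExtends W N'.toSub (N' ⊔ N).toSub}
  have hD : D ∈ S := ⟨hDT, fun N' h₁ h₂ => by
    rw [sup_eq_left.2 h₁]
    exact Extends.refl _⟩
  have hM : sSup S ∈ S := by
    refine ⟨sSup_le fun N hN => hN.1, fun N' h₁ h₂ => ?_⟩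
    have e (R : Set S) : N'.toSub ⊔ ⨆ i ∈ R, Sub.mk ⊥ i.1 = (N' ⊔ ⨆ i ∈ R, i.1).toSub := by
      simp only [Sub.iSup_mk, Sub.mk_sup, top_sup_eq]
    have key : SubExtends W N'.toSub (N'.toSub ⊔ ⨆ i : S, Sub.mk ⊥ i.1) := by
      refine subExtends_of_rank (fun _ => 0) N'.toSub (fun i : S => Sub.mk ⊥ i.1)
        fun i R _ _ _ => ?_
      rw [e R, Sub.mk_sup, top_sup_eq]
      exact i.2.2 _ (h₁.trans le_sup_left) (sup_le h₂ (iSup₂_le fun j _ => j.2.1))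
    rw [Sub.iSup_mk, Sub.mk_sup, top_sup_eq] at key
    rwa [sSup_eq_iSup']
  -- By maximality of `sSup S`, it is enough that `N` can be added to families already containing
  -- `sSup S`. This turns every rule into a closure property of `sSup S`.
  have hS {N : DecoSet Z} (hN : N ≤ T) (hN' : ∀ N', D ≤ N' → N' ≤ T → sSup S ≤ N' →
      SubExtends W N'.toSub (N' ⊔ N).toSub) : N ≤ sSup S := by
    refine le_sSup_of_le (b := sSup S ⊔ N) ⟨sup_le hM.1 hN, fun N' h₁ h₂ => ?_⟩ le_sup_right
    rw [← sup_assoc]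
    exact (hM.2 N' h₁ h₂).trans
      (hN' (N' ⊔ sSup S) (h₁.trans le_sup_left) (sup_le h₂ hM.1) le_sup_right)
  have hle : T ≤ sSup S := by
    refine h _ (le_sSup hD) hM.1 ⟨?_, ?_, ?_⟩
    · intro k
      refine fun x hx => (hS (N := fun k => Z.degenerate k.dim) hT fun N' _ _ _ => ?_) k hx
      refine subExtends_of_sat_le (DecoSet.toSub_le le_sup_left) le_rfl fun k => ?_
      exact DecoSet.sat_subset (T := N'.sat) N'.degenerate_subset_sat N'.thin_sat_subset
        (sup_le N'.subset_sat N'.degenerate_subset_sat) k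
    · have := hS (N := fun k => match k with
        | .marked => ∅
        | .thin => ∅
        | .lean => (sSup S) .thin)
        (fun k => match k with
          | .marked => Set.empty_subset _
          | .thin => Set.empty_subset _
          | .lean => (hM.1 .thin).trans hT') fun N' _ _ hN' => by
            refine subExtends_of_sat_le (DecoSet.toSub_le le_sup_left) le_rfl fun k => ?_
            refine DecoSet.sat_subset (T := N'.sat) N'.degenerate_subset_sat N'.thin_sat_subset
              (sup_le N'.subset_sat fun k => ?_) k
            cases k
            · exact Set.empty_subset _
            · exact Set.empty_subset _
            · exact (hN' .thin).trans ((N'.subset_sat .thin).trans N'.thin_sat_subset)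
      exact this .lean
    · intro G E E' R C R' C' hE hR hC hW u h₁ h₂ h₃ h₄ h₅ h₆
      have := hS (N := fun k => match k with
        | .marked => (u.app _) '' E'
        | .thin => (u.app _) '' R'
        | .lean => (u.app _) '' (R' ∪ C'))
        (fun k => match k with
          | .marked => Set.image_subset_iff.2 h₄
          | .thin => Set.image_subset_iff.2 h₅
          | .lean => Set.image_subset_iff.2
            (Set.union_subset (fun t ht => hT' (h₅ t ht)) h₆)) fun N' _ _ hN' => by
            refine subExtends_of_enlarge hE hR hC hW u N' _ (fun e he => hN' .marked (h₁ e he))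
              (fun e he => hN' .thin (h₂ e he)) (fun e he => hN' .lean (h₃ e he)) fun k => ?_
            cases k <;> rfl
      exact ⟨fun e he => this .marked ⟨e, he, rfl⟩, fun e he => this .thin ⟨e, he, rfl⟩,
        fun e he => this .lean ⟨e, Or.inr he, rfl⟩⟩
  have := hM.2 D le_rfl hDT
  rwa [le_antisymm hM.1 hle, sup_eq_right.2 hDT] at this

end Closure

end MBSSet

/-! ### Attachments checked on nondegenerate simplices. -/

namespace MBSSet

section

variable {Z : SSet.{u}} {W : MorphismProperty MBSSet.{u}} [W.IsStableUnderCobaseChange]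

/-- Attaching `G` along `K` to a subcomplex, where all decorations are restricted from fixed
decorations. -/
theorem subExtends_of_nonDegenerate {K G : MBSSet.{u}} (φ : K ⟶ G) [Mono φ.hom] (hφ : W φ)
    (S : Z.Subcomplex) (D : DecoSet Z) (x : G.toSSet ⟶ Z)
    (hp : SSet.Subcomplex.range φ.hom ≤ S.preimage x)
    (hS : ∀ (n : ℕ) (g : G.toSSet _⦋n⦌), g ∈ G.toSSet.nonDegenerate n → g ∉ (SSet.Subcomplex.range φ.hom).obj _ →
      x.app _ g ∉ S.obj _ ∧ x.app _ g ∈ Z.nonDegenerate n)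
    (hinj : ∀ (n : ℕ) (g : G.toSSet _⦋n⦌), g ∈ G.toSSet.nonDegenerate n → g ∉ (SSet.Subcomplex.range φ.hom).obj _ →
      ∀ (g' : G.toSSet _⦋n⦌), g' ∈ G.toSSet.nonDegenerate n → g' ∉ (SSet.Subcomplex.range φ.hom).obj _ →
      x.app _ g = x.app _ g' → g = g')
    (hK : ∀ k, ∀ e ∈ K.deco k, x.app _ (φ.hom.app _ e) ∈ D.sat k)
    (hG : ∀ k, ∀ e ∈ G.deco k, x.app _ e ∈ D.sat k)
    (hD : ∀ (k : Kind) (g : G.toSSet _⦋k.dim⦌), g ∈ G.toSSet.nonDegenerate k.dim → g ∉ (SSet.Subcomplex.range φ.hom).obj _ →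
      x.app _ g ∈ D.sat k → g ∈ G.deco k) :
    SubExtends W (Sub.mk S D) (Sub.mk (S ⊔ SSet.Subcomplex.range x) D) := by
  -- Together with `hp`, this says that the simplices of `G` sent into `S` are exactly those coming
  -- from `K`.
  have hpre : S.preimage x ≤ SSet.Subcomplex.range φ.hom := by
    rw [SSet.Subcomplex.le_iff_contains_nonDegenerate]
    intro n g hg
    by_contra hg'
    exact (hS n g.1 g.2 hg').1 hg
  have hfac (n : SimplexCategoryᵒᵖ) (g : G.toSSet.obj n)
      (hg : g ∉ (SSet.Subcomplex.range φ.hom).obj _) :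
      ∃ (m : ℕ) (f : n.unop ⟶ ⦋m⦌) (_ : Epi f) (y : G.toSSet _⦋m⦌), y ∈ G.toSSet.nonDegenerate m ∧
        y ∉ (SSet.Subcomplex.range φ.hom).obj _ ∧ g = G.toSSet.map f.op y := by
    obtain ⟨n⟩ := n
    induction n using SimplexCategory.rec with | _ n
    obtain ⟨m, f, hf, y, hy⟩ := G.toSSet.exists_nonDegenerate g
    refine ⟨m, f, hf, y.1, y.2, fun hy' => hg ?_, hy⟩
    rw [hy]
    exact (SSet.Subcomplex.range φ.hom).map f.op hy'
  have hx {n m : SimplexCategoryᵒᵖ} (f : n ⟶ m) (y : G.toSSet.obj n) :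
      x.app _ (G.toSSet.map f y) = Z.map f (x.app _ y) :=
    NatTrans.naturality_apply x f y
  refine subExtends_of_attach φ hφ (Sub.mk_le le_sup_left le_rfl) x
    (fun n g => Or.inr ⟨g, rfl⟩) (fun n k => hp n ⟨k, rfl⟩) (fun n z hz => hz)
    (fun n g hg => hpre n hg) ?_ hK hG ?_
  · intro n g g' h
    by_cases hg : g ∈ (SSet.Subcomplex.range φ.hom).obj _
    · exact Or.inl hg
    by_cases hg' : g' ∈ (SSet.Subcomplex.range φ.hom).obj _
    · exact (hg (hpre n (Set.mem_of_eq_of_mem (s := S.obj n) h (hp n hg')))).elim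
    right
    obtain ⟨m, f, _, y, hy₁, hy₂, rfl⟩ := hfac n g hg
    obtain ⟨m', f', _, y', hy₁', hy₂', rfl⟩ := hfac n g' hg'
    obtain ⟨n⟩ := n
    induction n using SimplexCategory.rec with | _ n
    rw [hx, hx] at h
    -- By the Eilenberg–Zilber lemma, equal images come from the same nondegenerate simplex by the
    -- same degeneracy, so injectivity on nondegenerate simplices is enough.
    obtain rfl : m = m' := Z.unique_nonDegenerate_dim _ f ⟨_, (hS m y hy₁ hy₂).2⟩ rfl f'
      ⟨_, (hS m' y' hy₁' hy₂').2⟩ h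
    have e := Z.unique_nonDegenerate_simplex _ f ⟨_, (hS m y hy₁ hy₂).2⟩ rfl f'
      ⟨_, (hS m y' hy₁' hy₂').2⟩ h
    have e' := Z.unique_nonDegenerate_map _ f ⟨_, (hS m y hy₁ hy₂).2⟩ rfl f'
      ⟨_, (hS m y' hy₁' hy₂').2⟩ h
    rw [hinj m y hy₁ hy₂ y' hy₁' hy₂' (congrArg Subtype.val e)]
    exact congrArg (fun f => G.toSSet.map (Quiver.Hom.op f) y') e'
  · intro k z hz hz'
    by_cases hzd : z ∈ Z.degenerate k.dim
    · exact Or.inl hzd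
    right
    rcases hz with hz | ⟨g, rfl⟩
    · exact Or.inl ⟨hz, hz'⟩
    · by_cases hg : g ∈ (SSet.Subcomplex.range φ.hom).obj _
      · exact Or.inl ⟨hp _ hg, hz'⟩
      · exact Or.inr ⟨g, hD k g (fun hg' => hzd (SSet.app_mem_degenerate x hg')) hg hz', rfl⟩

end

/-! ### Reduction of monomorphisms to boundary inclusions and changes of decorations -/

/-- The decorations of a marked biscaled simplicial set. -/
def decoSet (Q : MBSSet.{u}) : DecoSet Q.toSSet := Q.deco

theorem decoSet_sat (Q : MBSSet.{u}) (k : Kind) : Q.decoSet.sat k = Q.deco k :=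
  Set.Subset.antisymm
    (DecoSet.sat_subset Q.degenerate_subset_deco Q.thin_subset_lean' le_rfl k)
    (Q.decoSet.subset_sat k)

/-- A marked biscaled simplicial set is isomorphic to the corresponding decorated subcomplex. -/
def toSubIso (Q : MBSSet.{u}) : Q.decoSet.toSub.toMB ≅ Q :=
  isoMk (X := Q.decoSet.toSub.toMB) (Y := Q) (SSet.Subcomplex.topIso Q.toSSet) fun k x =>
    (Sub.mem_toMB_deco _ k x).trans (Set.ext_iff.1 (Q.decoSet_sat k) x.1)

/-- A subcomplex, with decorations contained in those of `Q`. -/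
def Sub.toHom {Q : MBSSet.{u}} (p : Sub Q.toSSet) (hp : p.2 ≤ Q.decoSet) : p.toMB ⟶ Q :=
  homMk (X := p.toMB) (Y := Q) p.1.ι fun k x hx => by
    rw [← Q.decoSet_sat]
    exact DecoSet.sat_mono hp k ((p.mem_toMB_deco k x).1 hx)

theorem mem_toHom_iff {W : MorphismProperty MBSSet.{u}} [W.RespectsIso] {Q : MBSSet.{u}}
    (p : Sub Q.toSSet) (hp : p.2 ≤ Q.decoSet) :
    W (p.toHom hp) ↔ SubExtends W p Q.decoSet.toSub := by
  have hle : p ≤ Q.decoSet.toSub := ⟨le_top, hp⟩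
  have e : p.toHom hp = Sub.homOfLE hle ≫ Q.toSubIso.hom := rfl
  rw [e, MorphismProperty.cancel_right_of_respectsIso W]
  exact ⟨fun h => ⟨hle, h⟩, fun h => h.2⟩

/-- The image of a map, with the images of decorated simplices. -/
def image {A B : MBSSet.{u}} (g : A ⟶ B) : Sub B.toSSet :=
  Sub.mk (SSet.Subcomplex.range g.hom) fun k => (g.hom.app _) '' (A.deco k)

theorem image_snd_le {A B : MBSSet.{u}} (g : A ⟶ B) : (image g).2 ≤ B.decoSet := by
  rintro k _ ⟨x, hx, rfl⟩
  exact Hom.map_deco g k hx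

theorem image_sat_subset {A B : MBSSet.{u}} (g : A ⟶ B) (k : Kind) :
    (image g).2.sat k ⊆ B.toSSet.degenerate k.dim ∪ (g.hom.app _) '' (A.deco k) :=
  DecoSet.sat_subset
    (T := fun k => B.toSSet.degenerate k.dim ∪ (g.hom.app _) '' (A.deco k))
    (fun _ => Set.subset_union_left)
    (Set.union_subset_union_right _ (Set.image_mono A.thin_subset_lean'))
    (fun _ => Set.subset_union_right) k

/-- A monomorphism reflects degeneracy, so completing the image decorations by degenerate simplices
adds nothing on `A`. -/
theorem mem_image_sat_iff {A B : MBSSet.{u}} (g : A ⟶ B) [Mono g.hom] (k : Kind)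
    (x : A.toSSet _⦋k.dim⦌) : g.hom.app _ x ∈ (image g).2.sat k ↔ x ∈ A.deco k := by
  constructor
  · intro h
    have hg : Function.Injective (g.hom.app (op ⦋k.dim⦌)) :=
      (mono_iff_injective _).1 inferInstance
    rcases image_sat_subset g k h with h | ⟨y, hy, e⟩
    · exact A.degenerate_subset_deco k ((SSet.degenerate_iff_of_mono g.hom x).1 h)
    · rwa [← hg e]
  · exact fun h => DecoSet.subset_sat _ k ⟨x, h, rfl⟩

theorem isIso_toRange {X Y : SSet.{u}} (f : X ⟶ Y) [Mono f] :
    IsIso (SSet.Subcomplex.toRange f) := by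
  have : Mono (SSet.Subcomplex.toRange f) := by
    have : Mono (SSet.Subcomplex.toRange f ≫ (SSet.Subcomplex.range f).ι) := ‹Mono f›
    exact mono_of_mono _ (SSet.Subcomplex.range f).ι
  exact isIso_of_mono_of_epi _

/-- Up to isomorphism a monomorphism is the inclusion of its range with the image decorations.
Questions about `g` become questions about decorated subcomplexes of `B`. -/
theorem mem_iff_image {W : MorphismProperty MBSSet.{u}} [W.RespectsIso] {A B : MBSSet.{u}}
    (g : A ⟶ B) [Mono g.hom] : W g ↔ SubExtends W (image g) B.decoSet.toSub := by
  let e : A ≅ (image g).toMB :=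
    isoMk (X := A) (Y := (image g).toMB) (@asIso _ _ _ _ (SSet.Subcomplex.toRange g.hom) (isIso_toRange g.hom)) fun k x =>
      (mem_image_sat_iff g k x).symm.trans
        (Sub.mem_toMB_deco (image g) k ((SSet.Subcomplex.toRange g.hom).app _ x)).symm
  have h : g = e.hom ≫ (image g).toHom (image_snd_le g) := rfl
  rw [← mem_toHom_iff _ (image_snd_le g)]
  conv_lhs => rw [h]
  exact MorphismProperty.cancel_left_of_respectsIso W _ _

/-- `X` without decorations except for degenerate simplices. -/
abbrev flat (X : SSet.{u}) : MBSSet.{u} := mk' X ∅ ∅ ∅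

theorem flat_deco (X : SSet.{u}) (k : Kind) : (flat X).deco k = X.degenerate k.dim := by
  rw [mk'_deco]
  have : k.select (∅ : Set (X _⦋1⦌)) ∅ ∅ = ∅ := by
    cases k
    exacts [rfl, rfl, Set.union_empty _]
  rw [this, Set.union_empty]

theorem nonDegenerate_stdSimplex_notMem_boundary {n d : ℕ} (x : (Δ[n] : SSet.{u}) _⦋d⦌)
    (hx : x ∈ (Δ[n] : SSet.{u}).nonDegenerate d) (hx' : x ∉ (SSet.boundary n).obj _) :
    ∃ h : d = n, x = SSet.stdSimplex.objEquiv.symm (SimplexCategory.Hom.mk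
      (h ▸ OrderHom.id : Fin (d + 1) →o Fin (n + 1))) := by
  have h₁ : n ≤ d := by
    by_contra! h
    exact hx' (by rw [SSet.boundary_obj_eq_univ d n h]; trivial)
  have h₂ : d ≤ n := by
    by_contra! h
    exact hx (by rw [SSet.degenerate_eq_univ_of_hasDimensionLT Δ[n] (n + 1) d h]; trivial)
  obtain rfl : d = n := le_antisymm h₂ h₁
  refine ⟨rfl, ?_⟩
  rw [SSet.stdSimplex.mem_nonDegenerate_iff_mono] at hx
  rw [Equiv.eq_symm_apply]
  exact SimplexCategory.eq_id_of_mono _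

/-- Any monomorphism belongs to a weakly saturated class which contains boundary inclusions
and additions of decorations. -/
theorem mem_of_boundary {W : MorphismProperty MBSSet.{u}} [IsWeaklySaturated W]
    (h₁ : ∀ n, W (inducedHom (flat Δ[n]) (SSet.boundary n).ι))
    {A B : MBSSet.{u}} (g : A ⟶ B) [Mono g.hom]
    (h₂ : SubExtends W (DecoSet.toSub (image g).2) B.decoSet.toSub) : W g := by
  rw [mem_iff_image (W := W)]
  refine Extends.trans ?_ h₂
  have htop : SSet.Subcomplex.range g.hom ⊔ ⨆ s : B.toSSet.N, s.subcomplex = ⊤ := by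
    rw [SSet.N.iSup_subcomplex_eq_top, sup_top_eq]
  have e (T : Set B.toSSet.N) : image g ⊔ ⨆ s ∈ T, Sub.mk s.subcomplex (image g).2 =
      Sub.mk (SSet.Subcomplex.range g.hom ⊔ ⨆ s ∈ T, s.subcomplex) (image g).2 := by
    simp only [Sub.iSup_mk]
    exact congrArg (Sub.mk _) (sup_eq_left.2 (iSup₂_le fun _ _ => le_rfl))
  have key : SubExtends W (image g)
      (image g ⊔ ⨆ s : B.toSSet.N, Sub.mk s.subcomplex (image g).2) := by
    -- Cells are attached in order of dimension, so that the boundary of a cell is present before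
    -- the cell.
    refine subExtends_of_rank (fun s => s.dim) _ _ fun s T hT _ _ => ?_
    rw [e, Sub.mk_sup, sup_idem]
    generalize hR : SSet.Subcomplex.range g.hom ⊔ ⨆ s ∈ T, s.subcomplex = R
    have hRs (t : B.toSSet.N) (ht : t.dim < s.dim) : t.subcomplex ≤ R := by
      rw [← hR]
      exact (le_iSup₂_of_le (f := fun (t : B.toSSet.N) (_ : t ∈ T) => t.subcomplex) t
        (hT t ht) le_rfl).trans le_sup_right
    have hRg : SSet.Subcomplex.range g.hom ≤ R := le_sup_left.trans hR.le
    by_cases hs : s.subcomplex ≤ R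
    · rw [sup_eq_left.2 hs]
      exact Extends.refl _
    induction s using SSet.N.induction with | _ n z
    obtain ⟨z, hz⟩ := z
    let x : (Δ[n] : SSet.{u}) ⟶ B.toSSet := SSet.yonedaEquiv.symm z
    have hx : SSet.Subcomplex.range x = (SSet.N.mk z hz).subcomplex :=
      by
      rw [SSet.Subcomplex.range_eq_ofSimplex, Equiv.apply_symm_apply]
      rfl
    rw [← hx]
    have hx' (d) (y : (Δ[n] : SSet.{u}) _⦋d⦌) (hy : y ∈ (Δ[n] : SSet.{u}).nonDegenerate d)
        (hy' : y ∉ (SSet.boundary n).obj _) : x.app _ y ∉ R.obj _ ∧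
          x.app _ y ∈ B.toSSet.nonDegenerate d := by
      obtain ⟨rfl, rfl⟩ := nonDegenerate_stdSimplex_notMem_boundary y hy hy'
      have : x.app _ (SSet.stdSimplex.objEquiv.symm (𝟙 ⦋d⦌)) = z :=
        Functor.map_id_apply B.toSSet _ z
      change x.app _ (SSet.stdSimplex.objEquiv.symm (𝟙 ⦋d⦌)) ∉ R.obj _ ∧
        x.app _ (SSet.stdSimplex.objEquiv.symm (𝟙 ⦋d⦌)) ∈ _
      rw [this]
      exact ⟨fun h => hs ((SSet.Subcomplex.ofSimplex_le_iff z R).2 h), hz⟩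
    have hrange : SSet.Subcomplex.range (SSet.boundary.{u} n).ι = SSet.boundary n :=
      Subfunctor.range_ι _
    have : Mono (Hom.hom (inducedHom (flat Δ[n]) (SSet.boundary.{u} n).ι)) :=
      inferInstanceAs (Mono (SSet.boundary n).ι)
    refine subExtends_of_nonDegenerate (inducedHom (flat Δ[n]) (SSet.boundary n).ι) (h₁ n) R _ x
      ?_ ?_ ?_ ?_ ?_ ?_
    · change SSet.Subcomplex.range (SSet.boundary.{u} n).ι ≤ _
      rw [hrange]
      refine (SSet.Subcomplex.le_iff_contains_nonDegenerate _ _).2 ?_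
      intro d y hy
      change x.app _ y.1 ∈ R.obj _
      have hd : d < n := by
        by_contra! hd
        exact y.2 ((SSet.Subcomplex.mem_degenerate_iff _ ⟨y.1, hy⟩).1 (by
          rw [SSet.degenerate_eq_univ_of_hasDimensionLT (SSet.boundary.{u} n) n d hd]
          trivial))
      obtain ⟨m, f, _, w, hw⟩ := B.toSSet.exists_nonDegenerate (x.app _ y.1)
      rw [hw]
      refine R.map f.op (hRs (SSet.N.mk w.1 w.2) ?_ _ (SSet.Subcomplex.mem_ofSimplex_obj w.1))
      exact (SimplexCategory.len_le_of_epi f).trans_lt hd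
    · intro d y hy hy'
      change y ∉ (SSet.Subcomplex.range (SSet.boundary.{u} n).ι).obj _ at hy'
      rw [hrange] at hy'
      exact hx' d y hy hy'
    · intro d y hy hy' w hw hw' _
      change y ∉ (SSet.Subcomplex.range (SSet.boundary.{u} n).ι).obj _ at hy'
      change w ∉ (SSet.Subcomplex.range (SSet.boundary.{u} n).ι).obj _ at hw'
      rw [hrange] at hy' hw'
      obtain ⟨_, h⟩ := nonDegenerate_stdSimplex_notMem_boundary y hy hy'
      obtain ⟨_, h'⟩ := nonDegenerate_stdSimplex_notMem_boundary w hw hw'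
      rw [h, h']
    · intro k e he
      have := Hom.map_deco (inducedHom (flat Δ[n]) (SSet.boundary n).ι) k he
      rw [flat_deco] at this
      exact DecoSet.degenerate_subset_sat _ k (SSet.app_mem_degenerate x this)
    · intro k e he
      rw [flat_deco] at he
      exact DecoSet.degenerate_subset_sat _ k (SSet.app_mem_degenerate x he)
    -- A new nondegenerate simplex is undecorated: the nondegenerate decorations come from `A`,
    -- whose image already lies in `R`.
    · intro k y hy hy' h
      change y ∉ (SSet.Subcomplex.range (SSet.boundary.{u} n).ι).obj _ at hy'
      rw [hrange] at hy'
      have hy'' := hx' _ y hy hy'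
      rcases image_sat_subset g k h with h | ⟨a, _, h⟩
      · exact (hy''.2 h).elim
      · exact (hy''.1 (hRg _ ⟨a, h⟩)).elim
  have e' := e Set.univ
  simp only [Set.mem_univ, iSup_pos] at e'
  rw [e', htop] at key
  exact key

end MBSSet

namespace MBSSet

/-! ### The pushout-product of monomorphisms -/

instance {X Y A B : MBSSet.{u}} (f : X ⟶ Y) (g : A ⟶ B) [Mono f.hom] [Mono g.hom] :
    Mono (Hom.hom (prodMap f g)) := by
  refine (NatTrans.mono_iff_mono_app _).2 fun n => (mono_iff_injective _).2 ?_
  have hf : Function.Injective (f.hom.app n) := (mono_iff_injective _).1 inferInstance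
  have hg : Function.Injective (g.hom.app n) := (mono_iff_injective _).1 inferInstance
  intro x y h
  exact Prod.ext (hf (congrArg Prod.fst h)) (hg (congrArg Prod.snd h))

instance (X : MBSSet.{u}) : Mono (Hom.hom (𝟙 X)) := inferInstanceAs (Mono (𝟙 X.toSSet))

/-- The source of the pushout-product of two monomorphisms, as a decorated subcomplex. -/
abbrev ppSub {X Y A B : MBSSet.{u}} (f : X ⟶ Y) (g : A ⟶ B) : Sub (prod Y B).toSSet :=
  image (prodMap f (𝟙 B)) ⊔ image (prodMap (𝟙 Y) g)

theorem ppSub_snd_le {X Y A B : MBSSet.{u}} (f : X ⟶ Y) (g : A ⟶ B) :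
    (ppSub f g).2 ≤ (prod Y B).decoSet :=
  sup_le (image_snd_le _) (image_snd_le _)

theorem ppSub_sat_subset {X Y A B : MBSSet.{u}} (f : X ⟶ Y) (g : A ⟶ B) (k : Kind) :
    (ppSub f g).2.sat k ⊆ (prod Y B).toSSet.degenerate k.dim ∪
      (((prodMap f (𝟙 B)).hom.app _) '' ((prod X B).deco k) ∪
      ((prodMap (𝟙 Y) g).hom.app _) '' ((prod Y A).deco k)) := by
  refine DecoSet.sat_subset (T := fun k => (prod Y B).toSSet.degenerate k.dim ∪
      (((prodMap f (𝟙 B)).hom.app _) '' ((prod X B).deco k) ∪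
      ((prodMap (𝟙 Y) g).hom.app _) '' ((prod Y A).deco k))) (fun _ => Set.subset_union_left) ?_
      (sup_le (fun k => ?_) (fun k => ?_)) k
  · exact Set.union_subset_union_right _ (Set.union_subset_union
      (Set.image_mono (thin_subset_lean' _)) (Set.image_mono (thin_subset_lean' _)))
  · exact Set.subset_union_left.trans Set.subset_union_right
  · exact Set.subset_union_right.trans Set.subset_union_right

/-- The pushout-product of monomorphisms is the inclusion of a decorated subcomplex. -/
theorem pushoutProduct_mem_iff_subExtends {W : MorphismProperty MBSSet.{u}} [W.RespectsIso]
    {X Y A B : MBSSet.{u}} (f : X ⟶ Y) (g : A ⟶ B) [Mono f.hom] [Mono g.hom] :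
    W (pushoutProduct f g) ↔ SubExtends W (ppSub f g) (prod Y B).decoSet.toSub := by
  let p := ppSub f g
  let r : prod X B ⟶ p.toMB := homMk (X := prod X B) (Y := p.toMB)
    (SSet.Subcomplex.lift (prodMap f (𝟙 B)).hom (show SSet.Subcomplex.range _ ≤ p.1 from
      le_sup_left (a := SSet.Subcomplex.range (prodMap f (𝟙 B)).hom)))
    fun k x hx => (p.mem_toMB_deco k _).2 (DecoSet.subset_sat _ _ (Or.inl ⟨x, hx, rfl⟩))
  let b : prod Y A ⟶ p.toMB := homMk (X := prod Y A) (Y := p.toMB)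
    (SSet.Subcomplex.lift (prodMap (𝟙 Y) g).hom (show SSet.Subcomplex.range _ ≤ p.1 from
      le_sup_right (b := SSet.Subcomplex.range (prodMap (𝟙 Y) g).hom)))
    fun k x hx => (p.mem_toMB_deco k _).2 (DecoSet.subset_sat _ _ (Or.inr ⟨x, hx, rfl⟩))
  have : Mono b.hom := by
    have : Mono (b.hom ≫ p.1.ι) := inferInstanceAs (Mono (prodMap (𝟙 Y) g).hom)
    exact mono_of_mono _ p.1.ι
  have sq : IsPushout (prodMap (𝟙 X) g) (prodMap f (𝟙 A)) r b := by
    refine isPushout_of_forget (isPushout_sset rfl ?_ ?_ ?_) ?_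
    · rintro n ⟨z, ⟨x, h⟩ | ⟨x, h⟩⟩
      · exact Or.inl ⟨x, Subtype.ext h⟩
      · exact Or.inr ⟨x, Subtype.ext h⟩
    · rintro n ⟨x, b⟩ ⟨y, a⟩ h
      exact ⟨(x, a), Prod.ext rfl (congrArg Prod.snd (congrArg Subtype.val h)).symm⟩
    · intro n y y' h
      have hf : Function.Injective ((prodMap f (𝟙 B)).hom.app n) :=
        (mono_iff_injective _).1 inferInstance
      exact Or.inr (hf (congrArg Subtype.val h))
    · intro k x hx
      rcases ppSub_sat_subset f g k ((p.mem_toMB_deco k x).1 hx) with h | ⟨y, hy, h⟩ | ⟨y, hy, h⟩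
      · exact Or.inl ((SSet.Subcomplex.mem_degenerate_iff p.1 x).2 h)
      · exact Or.inr (Or.inl ⟨y, hy, Subtype.ext h⟩)
      · exact Or.inr (Or.inr ⟨y, hy, Subtype.ext h⟩)
  rw [← mem_toHom_iff _ (ppSub_snd_le f g)]
  exact pushoutProduct_mem_iff W sq _ rfl rfl

end MBSSet

namespace MBSSet

/-! ### Simplices of standard simplices of codimension at most one -/

theorem degenerate_or_eq_id {n : ℕ} (t : (Δ[n] : SSet.{u}) _⦋n⦌) :
    t ∈ (Δ[n] : SSet.{u}).degenerate n ∨ t = SSet.stdSimplex.objEquiv.symm (𝟙 ⦋n⦌) := by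
  by_cases h : t ∈ (Δ[n] : SSet.{u}).degenerate n
  · exact Or.inl h
  · right
    have h' := (SSet.stdSimplex.mem_nonDegenerate_iff_mono t).1 h
    rw [Equiv.eq_symm_apply]
    exact SimplexCategory.eq_id_of_mono _

theorem degenerate_or_eq_δ {n : ℕ} (t : (Δ[n + 1] : SSet.{u}) _⦋n⦌) :
    t ∈ (Δ[n + 1] : SSet.{u}).degenerate n ∨
      ∃ i, t = SSet.stdSimplex.objEquiv.symm (SimplexCategory.δ i) := by
  by_cases h : t ∈ (Δ[n + 1] : SSet.{u}).degenerate n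
  · exact Or.inl h
  · right
    have h' := (SSet.stdSimplex.mem_nonDegenerate_iff_mono t).1 h
    obtain ⟨i, hi⟩ := SimplexCategory.eq_δ_of_mono (SSet.stdSimplex.objEquiv t)
    exact ⟨i, by rw [Equiv.eq_symm_apply, hi]⟩

theorem eq_face3_of_mem_dTri {a b c : ℕ} {t : (Δ[3] : SSet.{u}) _⦋2⦌} (i : Fin 4)
    (h : t ∈ dTri 3 a b c) (h₀ : (i.succAbove 0 : ℕ) = a) (h₁ : (i.succAbove 1 : ℕ) = b)
    (h₂ : (i.succAbove 2 : ℕ) = c) : t = face3 i := by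
  obtain ⟨e₀, e₁, e₂⟩ := h
  apply SSet.stdSimplex.ext
  intro j
  fin_cases j
  · exact Fin.ext (e₀.trans h₀.symm)
  · exact Fin.ext (e₁.trans h₁.symm)
  · exact Fin.ext (e₂.trans h₂.symm)

/-! ### The generators that change decorations, as rules for closed families. -/

section Rules

variable {Z : SSet.{u}} {T M : DecoSet Z}

theorem yonedaEquiv_symm_app_mem {n : ℕ} (y : Z _⦋n⦌) {D : Set (Z _⦋n⦌)}
    (hD : Z.degenerate n ⊆ D) (hy : y ∈ D) (t : (Δ[n] : SSet.{u}) _⦋n⦌) :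
    (SSet.yonedaEquiv.symm y).app _ t ∈ D := by
  rcases degenerate_or_eq_id t with h | rfl
  · exact hD (SSet.app_mem_degenerate _ h)
  · exact Set.mem_of_eq_of_mem (s := D) (Functor.map_id_apply Z _ y) hy

theorem yonedaEquiv_symm_app_mem_of_δ {n : ℕ} (y : Z _⦋n + 1⦌) {D : Set (Z _⦋n⦌)}
    (hD : Z.degenerate n ⊆ D) (t : (Δ[n + 1] : SSet.{u}) _⦋n⦌)
    (hy : ∀ i, t = SSet.stdSimplex.objEquiv.symm (SimplexCategory.δ i) → Z.δ i y ∈ D) :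
    (SSet.yonedaEquiv.symm y).app _ t ∈ D := by
  rcases degenerate_or_eq_δ t with h | ⟨i, rfl⟩
  · exact hD (SSet.app_mem_degenerate _ h)
  · exact hy i rfl

namespace IsClosed

theorem deg_mem (hM : IsClosed mbAnodyne T M) (k : Kind) {z : Z _⦋k.dim⦌} (h : z ∈ Z.degenerate k.dim) : z ∈ M k :=
  hM.degenerate_subset k h

/-- From (S2). Thanks to this rule, it is enough to reach the thin triangles of a product as lean
triangles. -/
theorem thin_of_lean (hM : IsClosed mbAnodyne T M) (hMT : M ≤ T) {t : Z _⦋2⦌} (h : t ∈ M .lean) (hT : t ∈ T .thin) :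
    t ∈ M .thin := by
  have hdT : Z.degenerate 2 ⊆ T .thin := (hM.degenerate_subset .thin).trans (hMT .thin)
  have := (hM.rule _ _ _ (mbGen_le_mbAnodyne _ .leanToThin) (SSet.yonedaEquiv.symm t)
    (fun _ h => h.elim) (fun _ h => h.elim)
    (fun s _ => yonedaEquiv_symm_app_mem t (hM.degenerate_subset .lean) h s)
    (fun _ h => h.elim) (fun s _ => yonedaEquiv_symm_app_mem t hdT hT s)
    (fun s _ => yonedaEquiv_symm_app_mem t ((hM.degenerate_subset .lean).trans (hMT .lean))
      (hMT .lean h) s)).2.1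
    (SSet.stdSimplex.objEquiv.symm (𝟙 _)) (Set.mem_univ _)
  exact Set.mem_of_eq_of_mem (s := M .thin) (Functor.map_id_apply Z _ t).symm this

/-- From (S3). The triangle `Δ^{i-1,i,i+1}` is the face opposite to the remaining vertex `j`, which
is 3 for `i = 1` and 0 for `i = 2`. -/
theorem δ_mem_lean_of_inner (hM : IsClosed mbAnodyne T M) (hMT : M ≤ T) (i : Fin 4) (h0 : 0 < i) (h3 : i < 3) (j : Fin 4)
    (hj : ∀ t : (Δ[3] : SSet.{u}) _⦋2⦌, t ∈ dTri 3 (i - 1) i (i + 1) → t = face3 j)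
    (y : Z _⦋3⦌) (hj' : Z.δ j y ∈ M .thin) (h : ∀ k, k ≠ i → Z.δ k y ∈ M .lean)
    (hT : Z.δ i y ∈ T .lean) : Z.δ i y ∈ M .lean := by
  have hy (t : (Δ[3] : SSet.{u}) _⦋2⦌) : (SSet.yonedaEquiv.symm y).app _ t ∈ T .lean := by
    refine yonedaEquiv_symm_app_mem_of_δ y ((hM.degenerate_subset .lean).trans (hMT .lean)) t
      fun k _ => ?_
    by_cases hk : k = i
    · rwa [hk]
    · exact hMT .lean (h k hk)
  have hthin (t : (Δ[3] : SSet.{u}) _⦋2⦌) (ht : t ∈ dTri 3 (i - 1) i (i + 1)) :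
      (SSet.yonedaEquiv.symm y).app _ t ∈ M .thin := by
    rw [hj t ht]
    exact hj'
  exact (hM.rule _ _ _ (mbGen_le_mbAnodyne _ (.innerSaturation i h0 h3)) (SSet.yonedaEquiv.symm y)
    (fun _ h => h.elim) hthin
    (fun t ht => yonedaEquiv_symm_app_mem_of_δ y (hM.degenerate_subset .lean) t
      fun k hk => h k fun hki => ht (by rw [hk, hki]; rfl))
    (fun _ h => h.elim) (fun t ht => hMT .thin (hthin t ht)) (fun t _ => hy t)).2.2
    (face3 i) (Set.mem_univ _)

theorem δ_one_mem_lean (hM : IsClosed mbAnodyne T M) (hMT : M ≤ T) (y : Z _⦋3⦌) (h₀ : Z.δ 0 y ∈ M .lean)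
    (h₂ : Z.δ 2 y ∈ M .lean) (h₃ : Z.δ 3 y ∈ M .thin) (hT : Z.δ 1 y ∈ T .lean) :
    Z.δ 1 y ∈ M .lean :=
  hM.δ_mem_lean_of_inner hMT 1 (by decide) (by decide) 3
    (fun t ht => eq_face3_of_mem_dTri 3 ht rfl rfl rfl) y h₃
    (fun k hk => match k with
      | 0 => h₀
      | 1 => (hk rfl).elim
      | 2 => h₂
      | 3 => hM.thin_subset h₃) hT

theorem δ_two_mem_lean (hM : IsClosed mbAnodyne T M) (hMT : M ≤ T) (y : Z _⦋3⦌) (h₀ : Z.δ 0 y ∈ M .thin)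
    (h₁ : Z.δ 1 y ∈ M .lean) (h₃ : Z.δ 3 y ∈ M .lean) (hT : Z.δ 2 y ∈ T .lean) :
    Z.δ 2 y ∈ M .lean :=
  hM.δ_mem_lean_of_inner hMT 2 (by decide) (by decide) 0
    (fun t ht => eq_face3_of_mem_dTri 0 ht rfl rfl rfl) y h₀
    (fun k hk => match k with
      | 0 => hM.thin_subset h₀
      | 1 => h₁
      | 2 => (hk rfl).elim
      | 3 => h₃) hT

/-- From (S5). The edge `Z.δ 0 (Z.δ 0 y)` joins the vertices 2 and 3. -/
theorem δ_three_mem_lean (hM : IsClosed mbAnodyne T M) (hMT : M ≤ T) (y : Z _⦋3⦌) (h₀ : Z.δ 0 y ∈ M .lean)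
    (h₁ : Z.δ 1 y ∈ M .lean) (h₂ : Z.δ 2 y ∈ M .lean) (he : Z.δ 0 (Z.δ 0 y) ∈ M .marked)
    (hT : Z.δ 3 y ∈ T .lean) : Z.δ 3 y ∈ M .lean := by
  have hy (t : (Δ[3] : SSet.{u}) _⦋2⦌) (ht : t ∈ ({face3 3}ᶜ : Set _)) :
      (SSet.yonedaEquiv.symm y).app _ t ∈ M .lean :=
    yonedaEquiv_symm_app_mem_of_δ y (hM.degenerate_subset .lean) t
      fun k hk => match k with
        | 0 => h₀
        | 1 => h₁
        | 2 => h₂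
        | 3 => (ht hk).elim
  have he' (e : (Δ[3] : SSet.{u}) _⦋1⦌) (h : e ∈ dEdge 3 2 3) :
      (SSet.yonedaEquiv.symm y).app _ e ∈ M .marked := by
    have : e = SSet.stdSimplex.objEquiv.symm (SimplexCategory.δ 0 ≫ SimplexCategory.δ 0) := by
      apply SSet.stdSimplex.ext
      intro j
      fin_cases j
      · exact Fin.ext h.1
      · exact Fin.ext h.2
    rw [this]
    refine Set.mem_of_eq_of_mem (s := M .marked) ?_ he
    exact Functor.map_comp_apply Z _ _ y
  exact (hM.rule _ _ _ (mbGen_le_mbAnodyne _ .outerSaturation) (SSet.yonedaEquiv.symm y)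
    he' (fun _ h => h.elim) hy (fun e h => hMT .marked (he' e h)) (fun _ h => h.elim)
    (fun t _ => by
      by_cases ht : t = face3 3
      · rw [ht]; exact hT
      · exact hMT .lean (hy t ht))).2.2 (face3 3) (Set.mem_univ _)

theorem δ_one_mem_marked (hM : IsClosed mbAnodyne T M) (hMT : M ≤ T) (t : Z _⦋2⦌)
    (ht : t ∈ M .thin) (h₀ : Z.δ 0 t ∈ M .marked) (h₂ : Z.δ 2 t ∈ M .marked)
    (hT : Z.δ 1 t ∈ T .marked) : Z.δ 1 t ∈ M .marked := by
  have hthin (s : (Δ[2] : SSet.{u}) _⦋2⦌) : (SSet.yonedaEquiv.symm t).app _ s ∈ M .thin :=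
    yonedaEquiv_symm_app_mem t (hM.degenerate_subset .thin) ht s
  have he (e : (Δ[2] : SSet.{u}) _⦋1⦌) : (SSet.yonedaEquiv.symm t).app _ e ∈ T .marked :=
    yonedaEquiv_symm_app_mem_of_δ t ((hM.degenerate_subset .marked).trans (hMT .marked)) e
      fun k _ => match k with
        | 0 => hMT .marked h₀
        | 1 => hT
        | 2 => hMT .marked h₂
  refine (hM.rule _ _ _ (mbGen_le_mbAnodyne _ .compose) (SSet.yonedaEquiv.symm t) ?_
    (fun s _ => hthin s) (fun s _ => hM.thin_subset (hthin s)) (fun e _ => he e)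
    (fun s _ => hMT .thin (hthin s)) (fun s _ => hMT .lean (hM.thin_subset (hthin s)))).1
    (SSet.stdSimplex.objEquiv.symm (SimplexCategory.δ 1)) (Set.mem_univ _)
  rintro e (h | h)
  · have : e = SSet.stdSimplex.objEquiv.symm (SimplexCategory.δ 2) := by
      apply SSet.stdSimplex.ext
      intro j
      fin_cases j
      · exact Fin.ext h.1
      · exact Fin.ext h.2
    rw [this]
    exact h₂
  · have : e = SSet.stdSimplex.objEquiv.symm (SimplexCategory.δ 0) := by
      apply SSet.stdSimplex.ext
      intro j
      fin_cases j
      · exact Fin.ext h.1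
      · exact Fin.ext h.2
    rw [this]
    exact h₀

theorem marked_of_kanComplex (hM : IsClosed mbAnodyne T M) (hMT : M ≤ T) {K : SSet.{u}}
    (hK : SSet.KanComplex K) (v : K ⟶ Z) (h : ∀ t, v.app _ t ∈ M .thin)
    (hT : ∀ e, v.app _ e ∈ T .marked) (e : K _⦋1⦌) : v.app _ e ∈ M .marked :=
  (hM.rule _ _ _ (mbGen_le_mbAnodyne _ (.equivalences K hK)) v (fun _ h => h.elim)
    (fun t _ => h t) (fun t _ => hM.thin_subset (h t)) (fun e _ => hT e)
    (fun t _ => hMT .thin (h t)) (fun t _ => hMT .lean (hM.thin_subset (h t)))).1 e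
    (Set.mem_univ _)

end IsClosed

end Rules

/-! ### Maps from a simplex with a collapsed edge -/

instance : Epi toPoint.{u} := by
  have : SSet.stdSimplex.δ (0 : Fin 2) ≫ toPoint.{u} = 𝟙 Δ[0] := by
    apply SSet.yonedaEquiv.injective
    apply SSet.stdSimplex.ext
    intro i
    exact Subsingleton.elim (α := Fin 1) _ _
  have : IsSplitEpi toPoint.{u} := ⟨⟨_, this⟩⟩
  infer_instance

theorem collapseMap_surjective (n : ℕ) (d : SimplexCategoryᵒᵖ) :
    Function.Surjective ((collapseMap.{u} n).app d) := by
  have : Epi (collapseMap.{u} n) := inferInstance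
  rw [NatTrans.epi_iff_epi_app] at this
  exact (epi_iff_surjective _).1 (this d)

/-- The map from `collapse n` given by a simplex with degenerate first edge. -/
noncomputable def collapseDesc {Z : SSet.{u}} {n : ℕ} (y : Z _⦋n + 1⦌) (v : Z _⦋0⦌)
    (h : (SSet.yonedaEquiv.symm y).app _ (SSet.stdSimplex.edge (n + 1) 0 1 (Fin.zero_le _)) =
      Z.σ 0 v) : collapse.{u} n ⟶ Z :=
  pushout.desc (SSet.yonedaEquiv.symm y) (SSet.yonedaEquiv.symm v) (by
    apply SSet.yonedaEquiv.injective
    exact h)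

theorem collapseMap_collapseDesc {Z : SSet.{u}} {n : ℕ} (y : Z _⦋n + 1⦌) (v : Z _⦋0⦌)
    (h : (SSet.yonedaEquiv.symm y).app _ (SSet.stdSimplex.edge (n + 1) 0 1 (Fin.zero_le _)) =
      Z.σ 0 v) : collapseMap n ≫ collapseDesc y v h = SSet.yonedaEquiv.symm y :=
  pushout.inl_desc _ _ _

/-- From (S4). The edge `Z.δ 2 (Z.δ 3 y)` joins the vertices 0 and 1; as it is degenerate, `y`
factors through the collapsed simplex. -/
theorem IsClosed.δ_zero_mem_lean {Z : SSet.{u}} {T M : DecoSet Z} (hM : IsClosed mbAnodyne T M)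
    (hMT : M ≤ T) (y : Z _⦋3⦌) (h₁ : Z.δ 1 y ∈ M .lean) (h₂ : Z.δ 2 y ∈ M .lean)
    (h₃ : Z.δ 3 y ∈ M .lean) (he : Z.δ 2 (Z.δ 3 y) ∈ Set.range (Z.σ (0 : Fin 1)))
    (hT : Z.δ 0 y ∈ T .lean) : Z.δ 0 y ∈ M .lean := by
  obtain ⟨v, hv⟩ := he
  have he' : (SSet.yonedaEquiv.symm y).app _ (SSet.stdSimplex.edge 3 0 1 (Fin.zero_le _)) =
      Z.σ 0 v := by
    have : SSet.stdSimplex.edge.{u} 3 0 1 (Fin.zero_le _) =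
        SSet.stdSimplex.objEquiv.symm (SimplexCategory.δ 2 ≫ SimplexCategory.δ 3) := by
      apply SSet.stdSimplex.ext
      intro j
      fin_cases j <;> rfl
    rw [hv, this]
    exact Functor.map_comp_apply Z _ _ y
  have hu (d) (t : (Δ[3] : SSet.{u}).obj d) : (collapseDesc y v he').app d
      ((collapseMap 2).app d t) = (SSet.yonedaEquiv.symm y).app d t :=
    app_app (collapseMap_collapseDesc y v he') t
  have hy (t : (collapse.{u} 2) _⦋2⦌) (ht : t ∈ ({(collapseMap 2).app _ (face3 0)}ᶜ : Set _)) :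
      (collapseDesc y v he').app _ t ∈ M .lean := by
    obtain ⟨t, rfl⟩ := collapseMap_surjective 2 _ t
    rw [hu]
    exact yonedaEquiv_symm_app_mem_of_δ y (hM.degenerate_subset .lean) t
      fun k hk => match k with
        | 0 => (ht (by rw [hk]; rfl)).elim
        | 1 => h₁
        | 2 => h₂
        | 3 => h₃
  refine Set.mem_of_eq_of_mem (s := M .lean) (hu _ (face3 0)).symm ?_
  exact (hM.rule _ _ _ (mbGen_le_mbAnodyne _ .leftSaturation) (collapseDesc y v he')
    (fun _ h => h.elim) (fun _ h => h.elim) hy (fun _ h => h.elim) (fun _ h => h.elim)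
    (fun t _ => by
      by_cases ht : t = (collapseMap 2).app _ (face3 0)
      · rw [ht, hu]; exact hT
      · exact hMT .lean (hy t ht))).2.2 ((collapseMap 2).app _ (face3 0)) (Set.mem_univ _)

end MBSSet

set_option linter.unusedSimpArgs false

namespace MBSSet

/-! ### Simplicial identities in low dimensions -/

section

variable {S : SSet.{u}}

theorem δ_zero_σ_zero {n : ℕ} (x : S _⦋n⦌) : S.δ 0 (S.σ 0 x) = x := S.δ_comp_σ_self_apply 0 x

theorem δ_one_σ_zero {n : ℕ} (x : S _⦋n⦌) : S.δ 1 (S.σ 0 x) = x := S.δ_comp_σ_succ_apply 0 x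

theorem δ_two_σ_zero_edge (x : S _⦋1⦌) : S.δ 2 (S.σ 0 x) = S.σ 0 (S.δ 1 x) :=
  S.δ_comp_σ_of_gt_apply (i := 1) (j := 0) (by decide) x

theorem δ_zero_σ_one_edge (x : S _⦋1⦌) : S.δ 0 (S.σ 1 x) = S.σ 0 (S.δ 0 x) :=
  S.δ_comp_σ_of_le_apply (i := 0) (j := 0) (by decide) x

theorem δ_one_σ_one_edge (x : S _⦋1⦌) : S.δ 1 (S.σ 1 x) = x := S.δ_comp_σ_self_apply 1 x

theorem δ_two_σ_one_edge (x : S _⦋1⦌) : S.δ 2 (S.σ 1 x) = x := S.δ_comp_σ_succ_apply 1 x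

theorem δ_two_σ_zero (x : S _⦋2⦌) : S.δ 2 (S.σ 0 x) = S.σ 0 (S.δ 1 x) :=
  S.δ_comp_σ_of_gt_apply (i := 1) (j := 0) (by decide) x

theorem δ_three_σ_zero (x : S _⦋2⦌) : S.δ 3 (S.σ 0 x) = S.σ 0 (S.δ 2 x) :=
  S.δ_comp_σ_of_gt_apply (i := 2) (j := 0) (by decide) x

theorem δ_zero_σ_one (x : S _⦋2⦌) : S.δ 0 (S.σ 1 x) = S.σ 0 (S.δ 0 x) :=
  S.δ_comp_σ_of_le_apply (i := 0) (j := 0) (by decide) x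

theorem δ_one_σ_one (x : S _⦋2⦌) : S.δ 1 (S.σ 1 x) = x := S.δ_comp_σ_self_apply 1 x

theorem δ_two_σ_one (x : S _⦋2⦌) : S.δ 2 (S.σ 1 x) = x := S.δ_comp_σ_succ_apply 1 x

theorem δ_three_σ_one (x : S _⦋2⦌) : S.δ 3 (S.σ 1 x) = S.σ 1 (S.δ 2 x) :=
  S.δ_comp_σ_of_gt_apply (i := 2) (j := 1) (by decide) x

theorem δ_zero_σ_two (x : S _⦋2⦌) : S.δ 0 (S.σ 2 x) = S.σ 1 (S.δ 0 x) :=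
  S.δ_comp_σ_of_le_apply (i := 0) (j := 1) (by decide) x

theorem δ_one_σ_two (x : S _⦋2⦌) : S.δ 1 (S.σ 2 x) = S.σ 1 (S.δ 1 x) :=
  S.δ_comp_σ_of_le_apply (i := 1) (j := 1) (by decide) x

theorem δ_two_σ_two (x : S _⦋2⦌) : S.δ 2 (S.σ 2 x) = x := S.δ_comp_σ_self_apply 2 x

theorem δ_three_σ_two (x : S _⦋2⦌) : S.δ 3 (S.σ 2 x) = x := S.δ_comp_σ_succ_apply 2 x

theorem σ_mem_deg {n : ℕ} (i : Fin (n + 1)) (x : S _⦋n⦌) : S.σ i x ∈ S.degenerate (n + 1) :=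
  S.σ_mem_degenerate i x

end

theorem app_const_one {X B : SSet.{u}} (v : B _⦋0⦌) (x : X _⦋1⦌) :
    (SSet.const v : X ⟶ B).app _ x = B.σ 0 v := by
  rw [SSet.const_app]
  exact congrArg (fun f => B.map (Quiver.Hom.op f) v) (Subsingleton.elim _ _)

theorem app_const_two {X B : SSet.{u}} (v : B _⦋0⦌) (x : X _⦋2⦌) :
    (SSet.const v : X ⟶ B).app _ x = B.σ 0 (B.σ 0 v) := by
  rw [SSet.const_app]
  refine Eq.trans ?_ (Functor.map_comp_apply B _ _ v)
  exact congrArg (fun f => B.map (Quiver.Hom.op f) v) (Subsingleton.elim _ _)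

theorem app_const_mem {X B : SSet.{u}} (v : B _⦋0⦌) (k : Kind) (x : X _⦋k.dim⦌) :
    (SSet.const v : X ⟶ B).app _ x ∈ B.degenerate k.dim := by
  cases k
  · exact Set.mem_of_eq_of_mem (s := B.degenerate 1) (app_const_one v x) (σ_mem_deg _ _)
  · exact Set.mem_of_eq_of_mem (s := B.degenerate 2) (app_const_two v x) (σ_mem_deg _ _)
  · exact Set.mem_of_eq_of_mem (s := B.degenerate 2) (app_const_two v x) (σ_mem_deg _ _)

/-! ### Pushout-products with changes of decorations -/

section

variable {Y B : MBSSet.{u}} {M : DecoSet (prod Y B).toSSet}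

/-- A pair of simplices, as a simplex of the product. -/
abbrev pair {Y B : MBSSet.{u}} {n : ℕ} (y : Y.toSSet _⦋n⦌) (b : B.toSSet _⦋n⦌) :
    (prod Y B).toSSet _⦋n⦌ := (y, b)

theorem pair_δ {n : ℕ} (y : Y.toSSet _⦋n + 1⦌) (b : B.toSSet _⦋n + 1⦌) (i : Fin (n + 2)) :
    (prod Y B).toSSet.δ i (pair y b) = pair (Y.toSSet.δ i y) (B.toSSet.δ i b) := rfl

theorem pair_mem {k : Kind} {y : Y.toSSet _⦋k.dim⦌} {b : B.toSSet _⦋k.dim⦌} (hy : y ∈ Y.deco k)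
    (hb : b ∈ B.deco k) : pair y b ∈ (prod Y B).decoSet k :=
  (mem_prod_deco (X := Y) (Y := B) k _).2 ⟨hy, hb⟩

theorem deg_deco {X : MBSSet.{u}} (k : Kind) {x : X.toSSet _⦋k.dim⦌}
    (h : x ∈ X.toSSet.degenerate k.dim) : x ∈ X.deco k := X.degenerate_subset_deco k h

/-- A closed family containing `(y, b)` when `y` is degenerate or `b` is constant contains all
decorations of the product. -/
theorem decoSet_le_of_isClosed (hM : IsClosed mbAnodyne (prod Y B).decoSet M)
    (hMT : M ≤ (prod Y B).decoSet)
    (h₁ : ∀ (k : Kind) (y : Y.toSSet _⦋k.dim⦌), y ∈ Y.toSSet.degenerate k.dim →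
      ∀ b ∈ B.deco k, pair y b ∈ M k)
    (h₂ : ∀ v, ∀ e ∈ Y.deco .marked, pair e (B.toSSet.σ 0 v) ∈ M .marked)
    (h₃ : ∀ v, ∀ t ∈ Y.deco .lean, pair t (B.toSSet.σ 0 (B.toSSet.σ 0 v)) ∈ M .lean) :
    (prod Y B).decoSet ≤ M := by
  have hdd {y : Y.toSSet _⦋1⦌} {b : B.toSSet _⦋1⦌} (i j : Fin 2) :
      pair (Y.toSSet.σ i y) (B.toSSet.σ j b) ∈ M .thin :=
    h₁ .thin _ (σ_mem_deg i y) _ (deg_deco .thin (σ_mem_deg j b))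
  have hdd' {y : Y.toSSet _⦋1⦌} {b : B.toSSet _⦋1⦌} (i j : Fin 2) :
      pair (Y.toSSet.σ i y) (B.toSSet.σ j b) ∈ M .lean := hM.thin_subset (hdd i j)
  have hT {t : Y.toSSet _⦋2⦌} (ht : t ∈ Y.deco .lean) {i : Fin 2} (b : B.toSSet _⦋1⦌) :
      pair t (B.toSSet.σ i b) ∈ (prod Y B).decoSet .lean :=
    pair_mem (k := .lean) ht (deg_deco .lean (σ_mem_deg i b))
  have hl₀ (t : Y.toSSet _⦋2⦌) (ht : t ∈ Y.deco .lean) (b : B.toSSet _⦋1⦌) :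
      pair t (B.toSSet.σ 0 b) ∈ M .lean := by
    have := hM.δ_two_mem_lean hMT (pair (Y.toSSet.σ 2 t) (B.toSSet.σ 0 (B.toSSet.σ 0 b)))
    simp only [pair_δ, δ_zero_σ_zero, δ_one_σ_zero, δ_two_σ_zero_edge, δ_zero_σ_one_edge, δ_one_σ_one_edge,
      δ_two_σ_one_edge, δ_two_σ_zero, δ_three_σ_zero, δ_zero_σ_one, δ_one_σ_one,
      δ_two_σ_one, δ_three_σ_one, δ_zero_σ_two, δ_one_σ_two, δ_two_σ_two,
      δ_three_σ_two] at this
    exact this (hdd _ _) (hdd' _ _) (h₃ _ t ht) (hT ht _)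
  -- In `(σ₀ t, σ₁ (σ₁ b))`, face 0 is constant over `B`, and faces 2 and 3 are degenerate in both
  -- factors.
  have hl₁ (t : Y.toSSet _⦋2⦌) (ht : t ∈ Y.deco .lean) (b : B.toSSet _⦋1⦌) :
      pair t (B.toSSet.σ 1 b) ∈ M .lean := by
    have := hM.δ_one_mem_lean hMT (pair (Y.toSSet.σ 0 t) (B.toSSet.σ 1 (B.toSSet.σ 1 b)))
    simp only [pair_δ, δ_zero_σ_zero, δ_one_σ_zero, δ_two_σ_zero_edge, δ_zero_σ_one_edge, δ_one_σ_one_edge,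
      δ_two_σ_one_edge, δ_two_σ_zero, δ_three_σ_zero, δ_zero_σ_one, δ_one_σ_one,
      δ_two_σ_one, δ_three_σ_one, δ_zero_σ_two, δ_one_σ_two, δ_two_σ_two,
      δ_three_σ_two] at this
    exact this (h₃ _ t ht) (hdd' _ _) (hdd _ _) (hT ht _)
  -- The pair `(t, b)` is face 2 of `(σ₂ t, σ₁ b)`. Faces 0 and 1 are degenerate over `Y`, and face
  -- 3 is `(t, σ₁ (δ₂ b))`, which has just been treated.
  have hl (t : Y.toSSet _⦋2⦌) (ht : t ∈ Y.deco .lean) (b : B.toSSet _⦋2⦌) (hb : b ∈ B.deco .lean) :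
      pair t b ∈ M .lean := by
    have := hM.δ_two_mem_lean hMT (pair (Y.toSSet.σ 2 t) (B.toSSet.σ 1 b))
    simp only [pair_δ, δ_zero_σ_zero, δ_one_σ_zero, δ_two_σ_zero_edge, δ_zero_σ_one_edge, δ_one_σ_one_edge,
      δ_two_σ_one_edge, δ_two_σ_zero, δ_three_σ_zero, δ_zero_σ_one, δ_one_σ_one,
      δ_two_σ_one, δ_three_σ_one, δ_zero_σ_two, δ_one_σ_two, δ_two_σ_two,
      δ_three_σ_two] at this
    exact this (hdd _ _) (h₁ .lean _ (σ_mem_deg _ _) _ hb) (hl₁ t ht _) (pair_mem ht hb)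
  rintro k ⟨y, b⟩ h
  have h' := (mem_prod_deco (X := Y) (Y := B) k _).1 h
  cases k
  -- The pair `(y, b)` is the long edge of `(σ₁ y, σ₀ b)`; one short edge is constant over `B` and
  -- the other is degenerate over `Y`.
  · have := hM.δ_one_mem_marked hMT (pair (Y.toSSet.σ 1 y) (B.toSSet.σ 0 b))
    simp only [pair_δ, δ_zero_σ_zero, δ_one_σ_zero, δ_two_σ_zero_edge, δ_zero_σ_one_edge, δ_one_σ_one_edge,
      δ_two_σ_one_edge, δ_two_σ_zero, δ_three_σ_zero, δ_zero_σ_one, δ_one_σ_one,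
      δ_two_σ_one, δ_three_σ_one, δ_zero_σ_two, δ_one_σ_two, δ_two_σ_two,
      δ_three_σ_two] at this
    exact this (hdd _ _) (h₁ .marked _ (σ_mem_deg _ _) _ h'.2) (h₂ _ _ h'.1) h
  · exact hM.thin_of_lean hMT (hl y (Y.thin_subset_lean h'.1) b (B.thin_subset_lean h'.2)) h
  · exact hl y h'.1 b h'.2

/-- The pushout-product of an anodyne change of decorations and a monomorphism is anodyne. -/
theorem pushoutProduct_enlarge {G : SSet.{u}} {E E' : Set (G _⦋1⦌)} {S C S' C' : Set (G _⦋2⦌)}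
    (hE : E ⊆ E') (hS : S ⊆ S') (hC : S ∪ C ⊆ S' ∪ C') (hW : mbAnodyne (enlarge G hE hS hC))
    {A B : MBSSet.{u}} (g : A ⟶ B) [Mono g.hom] :
    mbAnodyne (pushoutProduct (enlarge G hE hS hC) g) := by
  have : Mono (Hom.hom (enlarge G hE hS hC)) := inferInstanceAs (Mono (𝟙 G))
  rw [pushoutProduct_mem_iff_subExtends (W := mbAnodyne)]
  have htop : (ppSub (enlarge G hE hS hC) g).1 = ⊤ :=
    top_le_iff.1 fun n z _ => Or.inl ⟨z, rfl⟩
  have hp : ppSub (enlarge G hE hS hC) g = DecoSet.toSub (ppSub (enlarge G hE hS hC) g).2 :=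
    Prod.ext htop rfl
  rw [hp]
  refine subExtends_of_isClosed (ppSub_snd_le _ _) (degenerate_subset_deco _) (thin_subset_lean' _)
    fun M hDM hMT hM => ?_
  have h₁ {k : Kind} {y : G _⦋k.dim⦌} {b : B.toSSet _⦋k.dim⦌} (hy : y ∈ (mk' G E S C).deco k)
    (hb : b ∈ B.deco k) : pair (Y := mk' G E' S' C') y b ∈ M k :=
    hDM k (Or.inl ⟨(y, b), (mem_prod_deco (X := mk' G E S C) k _).2 ⟨hy, hb⟩, rfl⟩)
  -- The given change of decorations, applied along `G × {v}`: the constant component is degenerate,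
  -- hence decorated in `B`.
  have hc (v : B.toSSet _⦋0⦌) := hM.rule hE hS hC hW
    (lift (𝟙 G) (SSet.const v) : G ⟶ G ⊗ B.toSSet)
    (fun e he => h₁ (k := .marked) (Or.inr he) (deg_deco .marked (app_const_mem v .marked e)))
    (fun t ht => h₁ (k := .thin) (Or.inr ht) (deg_deco .thin (app_const_mem v .thin t)))
    (fun t ht => h₁ (k := .lean) (Or.inr (Or.inr ht)) (deg_deco .lean (app_const_mem v .lean t)))
    (fun e he => pair_mem (Y := mk' G E' S' C') (k := .marked) (Or.inr he)
      (deg_deco .marked (app_const_mem v .marked e)))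
    (fun t ht => pair_mem (Y := mk' G E' S' C') (k := .thin) (Or.inr ht)
      (deg_deco .thin (app_const_mem v .thin t)))
    (fun t ht => pair_mem (Y := mk' G E' S' C') (k := .lean) (Or.inr (Or.inr ht))
      (deg_deco .lean (app_const_mem v .lean t)))
  refine decoSet_le_of_isClosed hM hMT (fun k y hy b hb => h₁ (deg_deco k hy) hb) ?_ ?_
  · rintro v e (he | he)
    · exact h₁ (k := .marked) (Or.inl he) (deg_deco .marked (σ_mem_deg _ _))
    · exact (congrArg (fun b => pair (Y := mk' G E' S' C') e b ∈ M .marked)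
        (app_const_one (X := G) v e)).mp ((hc v).1 e he)
  · rintro v t (ht | ht | ht)
    · exact h₁ (k := .lean) (Or.inl ht) (deg_deco .lean (σ_mem_deg _ _))
    · exact (congrArg (fun b => pair (Y := mk' G E' S' C') t b ∈ M .lean)
        (app_const_two (X := G) v t)).mp ((fun h => hM.thin_subset h) ((hc v).2.1 t ht))
    · exact (congrArg (fun b => pair (Y := mk' G E' S' C') t b ∈ M .lean)
        (app_const_two (X := G) v t)).mp ((hc v).2.2 t ht)

end

end MBSSet

set_option linter.unusedSimpArgs false

namespace MBSSet

section

variable {S : SSet.{u}} (x : S _⦋2⦌)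

theorem δ_δ_σ_one : S.δ 0 (S.δ 0 (S.σ 1 x)) = S.δ 0 x :=
  (congrArg (S.δ 0) (δ_zero_σ_one x)).trans (δ_zero_σ_zero _)

theorem δ_δ_σ_two : S.δ 0 (S.δ 0 (S.σ 2 x)) = S.σ 0 (S.δ 0 (S.δ 0 x)) :=
  (congrArg (S.δ 0) (δ_zero_σ_two x)).trans (δ_zero_σ_one_edge _)

theorem δ_δ_σ_zero' : S.δ 2 (S.δ 3 (S.σ 0 x)) = S.σ 0 (S.δ 1 (S.δ 2 x)) :=
  (congrArg (S.δ 2) (δ_three_σ_zero x)).trans (δ_two_σ_zero_edge _)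

theorem δ_δ_σ_one' : S.δ 2 (S.δ 3 (S.σ 1 x)) = S.δ 2 x :=
  (congrArg (S.δ 2) (δ_three_σ_one x)).trans (δ_two_σ_one_edge _)

theorem δ_δ_σ_two' : S.δ 2 (S.δ 3 (S.σ 2 x)) = S.δ 2 x :=
  congrArg (S.δ 2) (δ_three_σ_two x)

end

/-! ### Decorations of products which are generated by those over a horn -/

section

variable {Y B : MBSSet.{u}} {M : DecoSet (prod Y B).toSSet}

/-- A thin pair is lean in the product, hence in `M`, and `IsClosed.thin_of_lean` makes it thin in
`M`. -/
theorem decoSet_le_of_lean (hM : IsClosed mbAnodyne (prod Y B).decoSet M)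
    (hMT : M ≤ (prod Y B).decoSet)
    (h₁ : ∀ y ∈ Y.deco .marked, ∀ b ∈ B.deco .marked, pair y b ∈ M .marked)
    (h₂ : ∀ y ∈ Y.deco .lean, ∀ b ∈ B.deco .lean, pair y b ∈ M .lean) :
    (prod Y B).decoSet ≤ M := by
  rintro k ⟨y, b⟩ h
  have h' := (mem_prod_deco (X := Y) (Y := B) k _).1 h
  cases k
  · exact h₁ y h'.1 b h'.2
  · exact hM.thin_of_lean hMT (h₂ y (Y.thin_subset_lean h'.1) b (B.thin_subset_lean h'.2)) h
  · exact h₂ y h'.1 b h'.2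

variable {X : Y.toSSet.Subcomplex}

/-- Used for horns of dimension at least three, where all decorated edges and triangles lie in the
horn and nothing is left to generate. -/
theorem decoSet_le_of_subset (hM : IsClosed mbAnodyne (prod Y B).decoSet M)
    (hMT : M ≤ (prod Y B).decoSet)
    (hX : ∀ k, ∀ y ∈ X.obj _, ∀ b, pair y b ∈ (prod Y B).decoSet k → pair y b ∈ M k)
    (h₁ : ∀ y ∈ Y.deco .marked, y ∈ X.obj _) (h₂ : ∀ y ∈ Y.deco .lean, y ∈ X.obj _) :
    (prod Y B).decoSet ≤ M :=
  decoSet_le_of_lean hM hMT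
    (fun y hy b hb => hX .marked y (h₁ y hy) b (pair_mem (k := .marked) hy hb))
    (fun y hy b hb => hX .lean y (h₂ y hy) b (pair_mem (k := .lean) hy hb))

/-- The case of the inner horn of dimension `2`. -/
theorem decoSet_le_of_innerHorn (hM : IsClosed mbAnodyne (prod Y B).decoSet M)
    (hMT : M ≤ (prod Y B).decoSet)
    (hX : ∀ k, ∀ y ∈ X.obj _, ∀ b, pair y b ∈ (prod Y B).decoSet k → pair y b ∈ M k)
    (t : Y.toSSet _⦋2⦌) (ht : t ∈ Y.deco .thin) (h0 : Y.toSSet.δ 0 t ∈ X.obj _)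
    (h2 : Y.toSSet.δ 2 t ∈ X.obj _) (h₁ : ∀ y ∈ Y.deco .marked, y ∈ X.obj _)
    (h₂ : ∀ y ∈ Y.deco .lean, y ∈ X.obj _ ∨ y = t ∨ ∃ i, y = Y.toSSet.σ i (Y.toSSet.δ 1 t))
    (h : ∀ b, pair t (B.toSSet.σ 1 b) ∈ M .thin) : (prod Y B).decoSet ≤ M := by
  have hσ {n : ℕ} (i : Fin (n + 1)) {y : Y.toSSet _⦋n⦌} (hy : y ∈ X.obj _) :
      Y.toSSet.σ i y ∈ X.obj _ := X.map _ hy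
  have hdd (i j) {y : Y.toSSet _⦋1⦌} (hy : y ∈ X.obj _) (b : B.toSSet _⦋1⦌) :
      pair (Y.toSSet.σ i y) (B.toSSet.σ j b) ∈ M .thin :=
    hX .thin _ (hσ i hy) _ (pair_mem (k := .thin) (deg_deco .thin (σ_mem_deg i y))
      (deg_deco .thin (σ_mem_deg j b)))
  have hd (i) {y : Y.toSSet _⦋1⦌} (hy : y ∈ X.obj _) {b : B.toSSet _⦋2⦌} (hb : b ∈ B.deco .lean) :
      pair (Y.toSSet.σ i y) b ∈ M .lean :=
    hX .lean _ (hσ i hy) _ (pair_mem (k := .lean) (deg_deco .lean (σ_mem_deg i y)) hb)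
  have hT (i) (y : Y.toSSet _⦋1⦌) {b : B.toSSet _⦋2⦌} (hb : b ∈ B.deco .lean) :
      pair (Y.toSSet.σ i y) b ∈ (prod Y B).decoSet .lean :=
    pair_mem (k := .lean) (deg_deco .lean (σ_mem_deg i y)) hb
  have ht' {b : B.toSSet _⦋2⦌} (hb : b ∈ B.deco .lean) :
      pair t b ∈ (prod Y B).decoSet .lean := pair_mem (k := .lean) (Y.thin_subset_lean ht) hb
  -- Face 2 of `(σ₁ t, σ₂ b)`: faces 0 and 3 lie over `X`, and face 1 is `(t, σ₁ (δ₁ b))`, provided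
  -- by `h`.
  have e₁ {b : B.toSSet _⦋2⦌} (hb : b ∈ B.deco .lean) : pair t b ∈ M .lean := by
    have := hM.δ_two_mem_lean hMT (pair (Y.toSSet.σ 1 t) (B.toSSet.σ 2 b))
    simp only [pair_δ, δ_zero_σ_zero, δ_one_σ_zero, δ_two_σ_zero_edge, δ_zero_σ_one_edge,
      δ_one_σ_one_edge, δ_two_σ_one_edge, δ_two_σ_zero, δ_three_σ_zero, δ_zero_σ_one,
      δ_one_σ_one, δ_two_σ_one, δ_three_σ_one, δ_zero_σ_two, δ_one_σ_two,
      δ_two_σ_two, δ_three_σ_two] at this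
    exact this (hdd _ _ h0 _) (hM.thin_subset (h _)) (hd _ h2 hb) (ht' hb)
  have e₂ (i) (b : B.toSSet _⦋1⦌) : pair t (B.toSSet.σ i b) ∈ M .thin :=
    hM.thin_of_lean hMT (e₁ (deg_deco .lean (σ_mem_deg i b)))
      (pair_mem (k := .thin) ht (deg_deco .thin (σ_mem_deg i b)))
  refine decoSet_le_of_lean hM hMT
    (fun y hy b hb => hX .marked y (h₁ y hy) b (pair_mem (k := .marked) hy hb)) ?_
  intro y hy b hb
  rcases h₂ y hy with h' | rfl | ⟨i, rfl⟩
  · exact hX .lean y h' b (pair_mem (k := .lean) hy hb)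
  · exact e₁ hb
  -- The degeneracies of the missing edge `δ 1 t`, paired with `b`, are faces of `(σ₀ t, σ₁ b)` and
  -- `(σ₂ t, σ₁ b)`, whose other faces lie over `t` or over `X`.
  · match i with
    | 0 =>
      have := hM.δ_two_mem_lean hMT (pair (Y.toSSet.σ 0 t) (B.toSSet.σ 1 b))
      simp only [pair_δ, δ_zero_σ_zero, δ_one_σ_zero, δ_two_σ_zero_edge, δ_zero_σ_one_edge,
      δ_one_σ_one_edge, δ_two_σ_one_edge, δ_two_σ_zero, δ_three_σ_zero, δ_zero_σ_one,
      δ_one_σ_one, δ_two_σ_one, δ_three_σ_one, δ_zero_σ_two, δ_one_σ_two,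
      δ_two_σ_two, δ_three_σ_two] at this
      exact this (e₂ _ _) (e₁ hb) (hM.thin_subset (hdd _ _ h2 _)) (hT _ _ hb)
    | 1 =>
      have := hM.δ_one_mem_lean hMT (pair (Y.toSSet.σ 2 t) (B.toSSet.σ 1 b))
      simp only [pair_δ, δ_zero_σ_zero, δ_one_σ_zero, δ_two_σ_zero_edge, δ_zero_σ_one_edge,
      δ_one_σ_one_edge, δ_two_σ_one_edge, δ_two_σ_zero, δ_three_σ_zero, δ_zero_σ_one,
      δ_one_σ_one, δ_two_σ_one, δ_three_σ_one, δ_zero_σ_two, δ_one_σ_two,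
      δ_two_σ_two, δ_three_σ_two] at this
      exact this (hM.thin_subset (hdd _ _ h0 _)) (e₁ hb) (h _) (hT _ _ hb)

/-- The case of the outer horn of dimension `2`. -/
theorem decoSet_le_of_outerHorn (hM : IsClosed mbAnodyne (prod Y B).decoSet M)
    (hMT : M ≤ (prod Y B).decoSet)
    (hX : ∀ k, ∀ y ∈ X.obj _, ∀ b, pair y b ∈ (prod Y B).decoSet k → pair y b ∈ M k)
    (t : Y.toSSet _⦋2⦌) (ht : t ∈ Y.deco .lean) (h0 : Y.toSSet.δ 0 t ∈ X.obj _)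
    (h0' : Y.toSSet.δ 0 t ∈ Y.deco .marked)
    (h1 : Y.toSSet.δ 1 t ∈ X.obj _) (h₁ : ∀ y ∈ Y.deco .marked, y ∈ X.obj _)
    (h₂ : ∀ y ∈ Y.deco .lean, y ∈ X.obj _ ∨ y = t ∨ ∃ i, y = Y.toSSet.σ i (Y.toSSet.δ 2 t))
    (h : ∀ b, pair t (B.toSSet.σ 1 b) ∈ M .lean) : (prod Y B).decoSet ≤ M := by
  have hσ {n : ℕ} (i : Fin (n + 1)) {y : Y.toSSet _⦋n⦌} (hy : y ∈ X.obj _) :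
      Y.toSSet.σ i y ∈ X.obj _ := X.map _ hy
  have hdd (i j) {y : Y.toSSet _⦋1⦌} (hy : y ∈ X.obj _) (b : B.toSSet _⦋1⦌) :
      pair (Y.toSSet.σ i y) (B.toSSet.σ j b) ∈ M .thin :=
    hX .thin _ (hσ i hy) _ (pair_mem (k := .thin) (deg_deco .thin (σ_mem_deg i y))
      (deg_deco .thin (σ_mem_deg j b)))
  have hd (i) {y : Y.toSSet _⦋1⦌} (hy : y ∈ X.obj _) {b : B.toSSet _⦋2⦌} (hb : b ∈ B.deco .lean) :
      pair (Y.toSSet.σ i y) b ∈ M .lean :=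
    hX .lean _ (hσ i hy) _ (pair_mem (k := .lean) (deg_deco .lean (σ_mem_deg i y)) hb)
  have hT (i) (y : Y.toSSet _⦋1⦌) {b : B.toSSet _⦋2⦌} (hb : b ∈ B.deco .lean) :
      pair (Y.toSSet.σ i y) b ∈ (prod Y B).decoSet .lean :=
    pair_mem (k := .lean) (deg_deco .lean (σ_mem_deg i y)) hb
  -- Face 2 of `(σ₂ t, σ₁ b)`: faces 0 and 1 lie over `X`, and face 3 is provided by `h`.
  have e₁ {b : B.toSSet _⦋2⦌} (hb : b ∈ B.deco .lean) : pair t b ∈ M .lean := by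
    have := hM.δ_two_mem_lean hMT (pair (Y.toSSet.σ 2 t) (B.toSSet.σ 1 b))
    simp only [pair_δ, δ_zero_σ_zero, δ_one_σ_zero, δ_two_σ_zero_edge, δ_zero_σ_one_edge,
      δ_one_σ_one_edge, δ_two_σ_one_edge, δ_two_σ_zero, δ_three_σ_zero, δ_zero_σ_one,
      δ_one_σ_one, δ_two_σ_one, δ_three_σ_one, δ_zero_σ_two, δ_one_σ_two,
      δ_two_σ_two, δ_three_σ_two] at this
    exact this (hdd _ _ h0 _) (hd _ h1 hb) (h _) (pair_mem (k := .lean) ht hb)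
  have he (v) : pair (Y.toSSet.δ 0 t) (B.toSSet.σ 0 v) ∈ M .marked :=
    hX .marked _ h0 _ (pair_mem (k := .marked) h0' (deg_deco .marked (σ_mem_deg 0 v)))
  refine decoSet_le_of_lean hM hMT
    (fun y hy b hb => hX .marked y (h₁ y hy) b (pair_mem (k := .marked) hy hb)) ?_
  intro y hy b hb
  rcases h₂ y hy with h' | rfl | ⟨i, rfl⟩
  · exact hX .lean y h' b (pair_mem (k := .lean) hy hb)
  · exact e₁ hb
  -- The degeneracies of the missing edge `δ 2 t` occur as third faces, so (S5) applies. Its marked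
  -- edge is `δ 0 t` paired with a degenerate edge of `B`.
  · match i with
    | 0 =>
      have := hM.δ_three_mem_lean hMT (pair (Y.toSSet.σ 0 t) (B.toSSet.σ 2 b))
      simp only [pair_δ, δ_zero_σ_zero, δ_one_σ_zero, δ_two_σ_zero_edge, δ_zero_σ_one_edge,
      δ_one_σ_one_edge, δ_two_σ_one_edge, δ_two_σ_zero, δ_three_σ_zero, δ_zero_σ_one,
      δ_one_σ_one, δ_two_σ_one, δ_three_σ_one, δ_zero_σ_two, δ_one_σ_two,
      δ_two_σ_two, δ_three_σ_two] at this
      exact this (h _) (h _) (hd _ h1 hb)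
        (Set.mem_of_eq_of_mem (s := M .marked) (congrArg (pair _) (δ_δ_σ_two b)) (he _)) (hT _ _ hb)
    | 1 =>
      have := hM.δ_three_mem_lean hMT (pair (Y.toSSet.σ 1 t) (B.toSSet.σ 2 b))
      simp only [pair_δ, δ_zero_σ_zero, δ_one_σ_zero, δ_two_σ_zero_edge, δ_zero_σ_one_edge,
      δ_one_σ_one_edge, δ_two_σ_one_edge, δ_two_σ_zero, δ_three_σ_zero, δ_zero_σ_one,
      δ_one_σ_one, δ_two_σ_one, δ_three_σ_one, δ_zero_σ_two, δ_one_σ_two,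
      δ_two_σ_two, δ_three_σ_two] at this
      exact this (hM.thin_subset (hdd _ _ h0 _)) (h _) (e₁ hb)
        (Set.mem_of_eq_of_mem (s := M .marked)
          (congrArg₂ pair (δ_δ_σ_one t) (δ_δ_σ_two b)) (he _)) (hT _ _ hb)

/-- The case of the left horn of dimension `2` with degenerate first edge. -/
theorem decoSet_le_of_leftHorn (hM : IsClosed mbAnodyne (prod Y B).decoSet M)
    (hMT : M ≤ (prod Y B).decoSet)
    (hX : ∀ k, ∀ y ∈ X.obj _, ∀ b, pair y b ∈ (prod Y B).decoSet k → pair y b ∈ M k)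
    (t : Y.toSSet _⦋2⦌) (ht : t ∈ Y.deco .lean) (h2 : Y.toSSet.δ 2 t ∈ X.obj _)
    (h2' : Y.toSSet.δ 2 t ∈ Set.range (Y.toSSet.σ (0 : Fin 1)))
    (h1 : Y.toSSet.δ 1 t ∈ X.obj _) (h₁ : ∀ y ∈ Y.deco .marked, y ∈ X.obj _)
    (h₂ : ∀ y ∈ Y.deco .lean, y ∈ X.obj _ ∨ y = t ∨ ∃ i, y = Y.toSSet.σ i (Y.toSSet.δ 0 t))
    (h : ∀ b, pair t (B.toSSet.σ 0 b) ∈ M .lean) : (prod Y B).decoSet ≤ M := by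
  have hσ {n : ℕ} (i : Fin (n + 1)) {y : Y.toSSet _⦋n⦌} (hy : y ∈ X.obj _) :
      Y.toSSet.σ i y ∈ X.obj _ := X.map _ hy
  have hdd (i j) {y : Y.toSSet _⦋1⦌} (hy : y ∈ X.obj _) (b : B.toSSet _⦋1⦌) :
      pair (Y.toSSet.σ i y) (B.toSSet.σ j b) ∈ M .thin :=
    hX .thin _ (hσ i hy) _ (pair_mem (k := .thin) (deg_deco .thin (σ_mem_deg i y))
      (deg_deco .thin (σ_mem_deg j b)))
  have hd (i) {y : Y.toSSet _⦋1⦌} (hy : y ∈ X.obj _) {b : B.toSSet _⦋2⦌} (hb : b ∈ B.deco .lean) :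
      pair (Y.toSSet.σ i y) b ∈ M .lean :=
    hX .lean _ (hσ i hy) _ (pair_mem (k := .lean) (deg_deco .lean (σ_mem_deg i y)) hb)
  have hT (i) (y : Y.toSSet _⦋1⦌) {b : B.toSSet _⦋2⦌} (hb : b ∈ B.deco .lean) :
      pair (Y.toSSet.σ i y) b ∈ (prod Y B).decoSet .lean :=
    pair_mem (k := .lean) (deg_deco .lean (σ_mem_deg i y)) hb
  have e₁ {b : B.toSSet _⦋2⦌} (hb : b ∈ B.deco .lean) : pair t b ∈ M .lean := by
    have := hM.δ_one_mem_lean hMT (pair (Y.toSSet.σ 0 t) (B.toSSet.σ 1 b))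
    simp only [pair_δ, δ_zero_σ_zero, δ_one_σ_zero, δ_two_σ_zero_edge, δ_zero_σ_one_edge,
      δ_one_σ_one_edge, δ_two_σ_one_edge, δ_two_σ_zero, δ_three_σ_zero, δ_zero_σ_one,
      δ_one_σ_one, δ_two_σ_one, δ_three_σ_one, δ_zero_σ_two, δ_one_σ_two,
      δ_two_σ_two, δ_three_σ_two] at this
    exact this (h _) (hd _ h1 hb) (hdd _ _ h2 _) (pair_mem (k := .lean) ht hb)
  have he (v) : pair (Y.toSSet.δ 2 t) (B.toSSet.σ 0 v) ∈
      Set.range ((prod Y B).toSSet.σ (0 : Fin 1)) := by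
    obtain ⟨w, hw⟩ := h2'
    rw [← hw]
    exact ⟨pair w v, rfl⟩
  refine decoSet_le_of_lean hM hMT
    (fun y hy b hb => hX .marked y (h₁ y hy) b (pair_mem (k := .marked) hy hb)) ?_
  intro y hy b hb
  rcases h₂ y hy with h' | rfl | ⟨i, rfl⟩
  · exact hX .lean y h' b (pair_mem (k := .lean) hy hb)
  · exact e₁ hb
  -- The degeneracies of the missing edge `δ 0 t` occur as zeroth faces, so (S4) applies. Its
  -- degenerate edge is `δ 2 t` paired with a degenerate edge of `B`.
  · match i with
    | 0 =>
      have := hM.δ_zero_mem_lean hMT (pair (Y.toSSet.σ 1 t) (B.toSSet.σ 0 b))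
      simp only [pair_δ, δ_zero_σ_zero, δ_one_σ_zero, δ_two_σ_zero_edge, δ_zero_σ_one_edge,
      δ_one_σ_one_edge, δ_two_σ_one_edge, δ_two_σ_zero, δ_three_σ_zero, δ_zero_σ_one,
      δ_one_σ_one, δ_two_σ_one, δ_three_σ_one, δ_zero_σ_two, δ_one_σ_two,
      δ_two_σ_two, δ_three_σ_two] at this
      exact this (e₁ hb) (h _) (hM.thin_subset (hdd _ _ h2 _))
        (Set.mem_of_eq_of_mem (congrArg₂ pair (δ_δ_σ_one' t) (δ_δ_σ_zero' b)) (he _)) (hT _ _ hb)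
    | 1 =>
      have := hM.δ_zero_mem_lean hMT (pair (Y.toSSet.σ 2 t) (B.toSSet.σ 0 b))
      simp only [pair_δ, δ_zero_σ_zero, δ_one_σ_zero, δ_two_σ_zero_edge, δ_zero_σ_one_edge,
      δ_one_σ_one_edge, δ_two_σ_one_edge, δ_two_σ_zero, δ_three_σ_zero, δ_zero_σ_one,
      δ_one_σ_one, δ_two_σ_one, δ_three_σ_one, δ_zero_σ_two, δ_one_σ_two,
      δ_two_σ_two, δ_three_σ_two] at this
      exact this (hd _ h1 hb) (h _) (h _)
        (Set.mem_of_eq_of_mem (congrArg₂ pair (δ_δ_σ_two' t) (δ_δ_σ_zero' b)) (he _)) (hT _ _ hb)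

/-- The case of the inclusion of the terminal vertex of the edge. -/
theorem decoSet_le_of_terminalVertex (hM : IsClosed mbAnodyne (prod Y B).decoSet M)
    (hMT : M ≤ (prod Y B).decoSet)
    (hX : ∀ k, ∀ y ∈ X.obj _, ∀ b, pair y b ∈ (prod Y B).decoSet k → pair y b ∈ M k)
    (e : Y.toSSet _⦋1⦌) (he : e ∈ Y.deco .marked) (ht : ∀ i, Y.toSSet.σ i e ∈ Y.deco .thin)
    (h0 : Y.toSSet.δ 0 e ∈ X.obj _)
    (h₁ : ∀ y : Y.toSSet _⦋1⦌, y ∈ X.obj _ ∨ y = e ∨ y = Y.toSSet.σ 0 (Y.toSSet.δ 1 e))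
    (h₂ : ∀ y : Y.toSSet _⦋2⦌, y ∈ X.obj _ ∨ y = Y.toSSet.σ 0 e ∨ y = Y.toSSet.σ 1 e ∨
      y = Y.toSSet.σ 0 (Y.toSSet.σ 0 (Y.toSSet.δ 1 e)))
    (h : ∀ v, pair e (B.toSSet.σ 0 v) ∈ M .marked)
    (h' : ∀ b, pair (Y.toSSet.σ 1 e) (B.toSSet.σ 0 b) ∈ M .thin)
    (h'' : ∀ b, pair (Y.toSSet.σ 0 e) (B.toSSet.σ 1 b) ∈ M .lean)
    (hS : B.deco .marked ⊆ B.toSSet.degenerate 1 ∨ ∀ s ∈ M .thin,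
      (prod Y B).toSSet.δ 0 s ∈ M .marked → (prod Y B).toSSet.δ 1 s ∈ M .marked →
      (prod Y B).toSSet.δ 2 s ∈ (prod Y B).decoSet .marked →
      (prod Y B).toSSet.δ 2 s ∈ M .marked) :
    (prod Y B).decoSet ≤ M := by
  have hσ {n : ℕ} (i : Fin (n + 1)) {y : Y.toSSet _⦋n⦌} (hy : y ∈ X.obj _) :
      Y.toSSet.σ i y ∈ X.obj _ := X.map _ hy
  have hd (i) {y : Y.toSSet _⦋1⦌} (hy : y ∈ X.obj _) {b : B.toSSet _⦋2⦌} (hb : b ∈ B.deco .lean) :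
      pair (Y.toSSet.σ i y) b ∈ M .lean :=
    hX .lean _ (hσ i hy) _ (pair_mem (k := .lean) (deg_deco .lean (σ_mem_deg i y)) hb)
  have hT (i) (y : Y.toSSet _⦋1⦌) {b : B.toSSet _⦋2⦌} (hb : b ∈ B.deco .lean) :
      pair (Y.toSSet.σ i y) b ∈ (prod Y B).decoSet .lean :=
    pair_mem (k := .lean) (deg_deco .lean (σ_mem_deg i y)) hb
  have e₁ {b : B.toSSet _⦋2⦌} (hb : b ∈ B.deco .lean) : pair (Y.toSSet.σ 1 e) b ∈ M .lean := by
    have := hM.δ_one_mem_lean hMT (pair (Y.toSSet.σ 2 (Y.toSSet.σ 1 e)) (B.toSSet.σ 0 b))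
    simp only [pair_δ, δ_zero_σ_zero, δ_one_σ_zero, δ_two_σ_zero_edge, δ_zero_σ_one_edge,
      δ_one_σ_one_edge, δ_two_σ_one_edge, δ_two_σ_zero, δ_three_σ_zero, δ_zero_σ_one,
      δ_one_σ_one, δ_two_σ_one, δ_three_σ_one, δ_zero_σ_two, δ_one_σ_two,
      δ_two_σ_two, δ_three_σ_two] at this
    exact this (hd _ (hσ _ h0) hb) (hM.thin_subset (h' _)) (h' _) (hT _ _ hb)
  have e₀ {b : B.toSSet _⦋2⦌} (hb : b ∈ B.deco .lean) : pair (Y.toSSet.σ 0 e) b ∈ M .lean := by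
    have := hM.δ_two_mem_lean hMT (pair (Y.toSSet.σ 2 (Y.toSSet.σ 0 e)) (B.toSSet.σ 1 b))
    simp only [pair_δ, δ_zero_σ_zero, δ_one_σ_zero, δ_two_σ_zero_edge, δ_zero_σ_one_edge,
      δ_one_σ_one_edge, δ_two_σ_one_edge, δ_two_σ_zero, δ_three_σ_zero, δ_zero_σ_one,
      δ_one_σ_one, δ_two_σ_one, δ_three_σ_one, δ_zero_σ_two, δ_one_σ_two,
      δ_two_σ_two, δ_three_σ_two] at this
    exact this (h' _) (e₁ hb) (h'' _) (hT _ _ hb)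
  have em {b : B.toSSet _⦋1⦌} (hb : b ∈ B.deco .marked) : pair e b ∈ M .marked := by
    have := hM.δ_one_mem_marked hMT (pair (Y.toSSet.σ 1 e) (B.toSSet.σ 0 b))
    simp only [pair_δ, δ_zero_σ_zero, δ_one_σ_zero, δ_two_σ_zero_edge, δ_zero_σ_one_edge,
      δ_one_σ_one_edge, δ_two_σ_one_edge, δ_two_σ_zero, δ_three_σ_zero, δ_zero_σ_one,
      δ_one_σ_one, δ_two_σ_one, δ_three_σ_one, δ_zero_σ_two, δ_one_σ_two,
      δ_two_σ_two, δ_three_σ_two] at this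
    exact this (h' _) (hX .marked _ (hσ _ h0) _ (pair_mem (k := .marked)
      (deg_deco .marked (σ_mem_deg 0 _)) hb)) (h _) (pair_mem (k := .marked) he hb)
  refine decoSet_le_of_lean hM hMT ?_ ?_
  · intro y hy b hb
    rcases h₁ y with h₁ | rfl | rfl
    · exact hX .marked y h₁ b (pair_mem (k := .marked) hy hb)
    · exact em hb
    -- Over the initial vertex, `b` gives the first edge of `(σ₀ e, σ₁ b)`, whose other two edges
    -- lie over `e` and are already marked. Passing to the first edge is the cancellation rule,
    -- which is not a generator; it is avoided if `B` has only degenerate marked edges.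
    · rcases hS with hS | hS
      · have hb' := hS hb
        rw [SSet.degenerate_eq_iUnion_range_σ, Set.mem_iUnion] at hb'
        obtain ⟨i, v, rfl⟩ := hb'
        obtain rfl : i = 0 := Subsingleton.elim (α := Fin 1) _ _
        exact hM.degenerate_subset .marked (σ_mem_deg (S := (prod Y B).toSSet) 0 (pair _ v))
      · have := hS (pair (Y.toSSet.σ 0 e) (B.toSSet.σ 1 b))
        simp only [pair_δ, δ_zero_σ_zero, δ_one_σ_zero, δ_two_σ_zero_edge, δ_zero_σ_one_edge,
      δ_one_σ_one_edge, δ_two_σ_one_edge, δ_two_σ_zero, δ_three_σ_zero, δ_zero_σ_one,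
      δ_one_σ_one, δ_two_σ_one, δ_three_σ_one, δ_zero_σ_two, δ_one_σ_two,
      δ_two_σ_two, δ_three_σ_two] at this
        exact this (hM.thin_of_lean hMT (h'' b) (pair_mem (k := .thin) (ht 0)
          (deg_deco .thin (σ_mem_deg 1 b)))) (h _) (em hb) (pair_mem (k := .marked) hy hb)
  · intro y hy b hb
    rcases h₂ y with h₂ | rfl | rfl | rfl
    · exact hX .lean y h₂ b (pair_mem (k := .lean) hy hb)
    · exact e₀ hb
    · exact e₁ hb
    -- Triangles over the initial vertex are third faces of `(σ₀ (σ₀ e), σ₂ b)`. The other faces lie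
    -- over `σ₀ e`, and the last edge lies over `e` and is marked, so (S5) applies.
    · have := hM.δ_three_mem_lean hMT (pair (Y.toSSet.σ 0 (Y.toSSet.σ 0 e)) (B.toSSet.σ 2 b))
      simp only [pair_δ, δ_zero_σ_zero, δ_one_σ_zero, δ_two_σ_zero_edge, δ_zero_σ_one_edge,
      δ_one_σ_one_edge, δ_two_σ_one_edge, δ_two_σ_zero, δ_three_σ_zero, δ_zero_σ_one,
      δ_one_σ_one, δ_two_σ_one, δ_three_σ_one, δ_zero_σ_two, δ_one_σ_two,
      δ_two_σ_two, δ_three_σ_two] at this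
      exact this (h'' _) (h'' _) (e₀ hb)
        (Set.mem_of_eq_of_mem (s := M .marked) (congrArg (pair _) (δ_δ_σ_two b)) (h _))
        (hT _ _ hb)

end

end MBSSet

namespace MBSSet

/-! ### Attaching a simplex along a horn -/

/-- The horn contains everything of dimension less than `d`, and nothing nondegenerate lives above
`d + 1`; only the top simplex and the omitted face remain. -/
theorem nonDegenerate_notMem_horn {d n : ℕ} (i : Fin (d + 2)) (g : (Δ[d + 1] : SSet.{u}) _⦋n⦌)
    (hg : g ∈ (Δ[d + 1] : SSet.{u}).nonDegenerate n) (hg' : g ∉ (SSet.horn (d + 1) i).obj _) :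
    (∃ h : n = d + 1, h ▸ g = SSet.stdSimplex.objEquiv.symm (𝟙 ⦋d + 1⦌)) ∨
      ∃ h : n = d, h ▸ g = SSet.stdSimplex.objEquiv.symm (SimplexCategory.δ i) := by
  have h₁ : d ≤ n := by
    by_contra! h
    exact hg' (by rw [SSet.horn_obj_eq_univ i n (by lia)]; trivial)
  have h₂ : n ≤ d + 1 := by
    by_contra! h
    exact hg (by rw [SSet.degenerate_eq_univ_of_hasDimensionLT Δ[d + 1] (d + 2) n h]; trivial)
  rcases h₂.eq_or_lt with rfl | h₂
  · exact Or.inl ⟨rfl, (degenerate_or_eq_id g).resolve_left hg⟩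
  · obtain rfl : n = d := by lia
    obtain ⟨j, hj⟩ := (degenerate_or_eq_δ g).resolve_left hg
    refine Or.inr ⟨rfl, ?_⟩
    rw [hj] at hg' ⊢
    rw [SSet.objEquiv_symm_δ_notMem_horn_iff] at hg'
    rw [hg']

theorem map_horn_mem {Z : SSet.{u}} {d : ℕ} (i : Fin (d + 2)) (y : Z _⦋d + 1⦌) (S : Z.Subcomplex)
    (h : ∀ j ≠ i, Z.δ j y ∈ S.obj _) :
    SSet.horn (d + 1) i ≤ S.preimage (SSet.yonedaEquiv.symm y) := by
  rw [SSet.horn_eq_iSup, iSup_le_iff]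
  rintro ⟨j, hj⟩
  rw [← SSet.stdSimplex.ofSimplex_yonedaEquiv_δ, SSet.Subcomplex.ofSimplex_le_iff]
  exact h j hj

section

variable {Z : SSet.{u}} {W : MorphismProperty MBSSet.{u}} [W.IsStableUnderCobaseChange]

/-- Attaching a simplex, or a quotient of a simplex, along a horn. -/
theorem subExtends_of_horn {K G : MBSSet.{u}} (φ : K ⟶ G) [Mono φ.hom] (hφ : W φ) {d : ℕ}
    (i : Fin (d + 2)) (π : (Δ[d + 1] : SSet.{u}) ⟶ G.toSSet)
    (hπ : ∀ n, Function.Surjective (π.app n))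
    (hr : SSet.Subcomplex.range φ.hom = (SSet.horn (d + 1) i).image π)
    (S : Z.Subcomplex) (D : DecoSet Z) (y : Z _⦋d + 1⦌) (x : G.toSSet ⟶ Z)
    (hx : π ≫ x = SSet.yonedaEquiv.symm y)
    (hy : y ∈ Z.nonDegenerate _) (hy' : y ∉ S.obj _)
    (hδ : Z.δ i y ∈ Z.nonDegenerate _) (hδ' : Z.δ i y ∉ S.obj _)
    (hS : ∀ j ≠ i, Z.δ j y ∈ S.obj _)
    (hG : ∀ k, ∀ e ∈ G.deco k, x.app _ e ∈ D.sat k)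
    (hD : ∀ (k : Kind) (z : Z _⦋k.dim⦌), z ∈ D.sat k → z ∈ Z.degenerate k.dim ∨
      SSet.S.mk z ≠ SSet.S.mk (Z.δ i y) ∧ (SSet.S.mk z = SSet.S.mk y →
        ∀ g : (Δ[d + 1] : SSet.{u}) _⦋k.dim⦌, π.app _ g ∈ G.deco k)) :
    SubExtends W (Sub.mk S D) (Sub.mk (S ⊔ SSet.Subcomplex.ofSimplex y) D) := by
  have hx' (n) (g : (Δ[d + 1] : SSet.{u}).obj n) : x.app n (π.app n g) =
      (SSet.yonedaEquiv.symm y).app n g := app_app hx g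
  have hrange : SSet.Subcomplex.range x = SSet.Subcomplex.ofSimplex y := by
    rw [← Equiv.apply_symm_apply SSet.yonedaEquiv y, ← SSet.Subcomplex.range_eq_ofSimplex, ← hx]
    apply le_antisymm
    · rintro n _ ⟨g, rfl⟩
      obtain ⟨g, rfl⟩ := hπ n g
      exact ⟨g, rfl⟩
    · rintro n _ ⟨g, rfl⟩
      exact ⟨_, rfl⟩
  have hlift {n : ℕ} (g : G.toSSet _⦋n⦌) (hg : g ∈ G.toSSet.nonDegenerate n)
      (hg' : g ∉ (SSet.Subcomplex.range φ.hom).obj _) : ∃ g' : (Δ[d + 1] : SSet.{u}) _⦋n⦌,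
        π.app _ g' = g ∧ ((∃ h : n = d + 1, h ▸ g' = SSet.stdSimplex.objEquiv.symm (𝟙 ⦋d + 1⦌)) ∨
          ∃ h : n = d, h ▸ g' = SSet.stdSimplex.objEquiv.symm (SimplexCategory.δ i)) := by
    obtain ⟨g', rfl⟩ := hπ _ g
    refine ⟨g', rfl, nonDegenerate_notMem_horn i g' (fun h => hg (SSet.app_mem_degenerate π h))
      fun h => hg' ?_⟩
    rw [hr]
    exact ⟨g', h, rfl⟩
  have hid : (SSet.yonedaEquiv.symm y).app _ (SSet.stdSimplex.objEquiv.symm (𝟙 ⦋d + 1⦌)) = y :=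
    Functor.map_id_apply Z _ y
  rw [← hrange]
  refine subExtends_of_nonDegenerate φ hφ S D x ?_ ?_ ?_
    (fun k e he => hG k _ (φ.map_deco k he)) hG ?_
  · rw [hr]
    rintro n _ ⟨g, hg, rfl⟩
    exact Set.mem_of_eq_of_mem (s := S.obj n) (hx' n g) (map_horn_mem i y S hS n hg)
  · intro n g hg hg'
    obtain ⟨g, rfl, ⟨rfl, rfl⟩ | ⟨rfl, rfl⟩⟩ := hlift g hg hg'
    · rw [hx', hid]
      exact ⟨hy', hy⟩
    · rw [hx']
      exact ⟨hδ', hδ⟩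
  · intro n g hg hg' g₂ hg₂ hg₂' _
    obtain ⟨g, rfl, ⟨h, h₁⟩ | ⟨h, h₁⟩⟩ := hlift g hg hg' <;>
    obtain ⟨g₂, rfl, ⟨h', h₂⟩ | ⟨h', h₂⟩⟩ := hlift g₂ hg₂ hg₂'
    · subst h
      exact congrArg _ (h₁.trans h₂.symm)
    · lia
    · lia
    · subst h
      exact congrArg _ (h₁.trans h₂.symm)
  · intro k g hg hg' hgD
    obtain ⟨g, rfl, h⟩ := hlift g hg hg'
    rw [hx'] at hgD
    have key : SSet.S.mk ((SSet.yonedaEquiv.symm y).app _ g) = SSet.S.mk y ∨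
        SSet.S.mk ((SSet.yonedaEquiv.symm y).app _ g) = SSet.S.mk (Z.δ i y) := by
      clear hgD hg hg'
      generalize k.dim = n at g h
      rcases h with ⟨rfl, rfl⟩ | ⟨rfl, rfl⟩
      · left
        rw [hid]
      · exact Or.inr rfl
    have hnd : (SSet.yonedaEquiv.symm y).app _ g ∉ Z.degenerate k.dim := by
      clear hgD hg hg' key
      generalize k.dim = n at g h
      rcases h with ⟨rfl, rfl⟩ | ⟨rfl, rfl⟩
      · rw [hid]
        exact hy
      · exact hδ
    obtain ⟨h₁, h₂⟩ := (hD k _ hgD).resolve_left hnd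
    exact h₂ (key.resolve_right h₁) g

end

end MBSSet

/-! ### Attaching a simplex along each kind of generating horn. -/

namespace MBSSet

section

variable {Z : SSet.{u}}

theorem dim_eq_of_mk_eq {n m : ℕ} {z : Z _⦋n⦌} {y : Z _⦋m⦌} (h : SSet.S.mk z = SSet.S.mk y) :
    n = m := congrArg SSet.S.dim h

theorem image_id {X : SSet.{u}} (A : X.Subcomplex) : A.image (𝟙 X) = A := by
  ext n x
  exact ⟨fun ⟨y, hy, e⟩ => Set.mem_of_eq_of_mem (s := A.obj n) e.symm hy, fun h => ⟨x, h, rfl⟩⟩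

theorem range_ι_eq {X : SSet.{u}} (A : X.Subcomplex) :
    SSet.Subcomplex.range A.ι = A.image (𝟙 X) :=
  (Subfunctor.range_ι A).trans (image_id A).symm

/-- The data needed in order to attach a simplex `y` along its `i`th horn, except for the
decorations of the simplex. -/
structure HornData (S : Z.Subcomplex) (D : DecoSet Z) {d : ℕ} (y : Z _⦋d + 1⦌)
    (i : Fin (d + 2)) : Prop where
  nonDegenerate : y ∈ Z.nonDegenerate _
  notMem : y ∉ S.obj _
  nonDegenerate_δ : Z.δ i y ∈ Z.nonDegenerate _
  notMem_δ : Z.δ i y ∉ S.obj _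
  δ_mem : ∀ j ≠ i, Z.δ j y ∈ S.obj _
  deco : ∀ (k : Kind) (z : Z _⦋k.dim⦌), z ∈ D.sat k → z ∈ Z.degenerate k.dim ∨
    SSet.S.mk z ≠ SSet.S.mk (Z.δ i y) ∧ (k = .thin → SSet.S.mk z = SSet.S.mk y → (i : ℕ) = 1)

variable {S : Z.Subcomplex} {D : DecoSet Z}

theorem mem_mk'_deco {n : ℕ} {E : Set ((Δ[n] : SSet.{u}) _⦋1⦌)}
    {T C : Set ((Δ[n] : SSet.{u}) _⦋2⦌)} (k : Kind) (hk : k.dim = n)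
    (h : ∀ g : (Δ[n] : SSet.{u}) _⦋k.dim⦌, (∀ i : Fin (k.dim + 1), (g i : ℕ) = i) →
      g ∈ k.select E T C) (g : (Δ[n] : SSet.{u}) _⦋k.dim⦌) : g ∈ (mk' Δ[n] E T C).deco k := by
  subst hk
  rw [mk'_deco]
  rcases degenerate_or_eq_id g with hg | rfl
  · exact Or.inl hg
  · exact Or.inr (h _ fun i => rfl)

/-- The attached simplex can itself be decorated only for `d = 1`, when it is `Δ^{0,1,2}` and (A1)
makes it thin. The outer generators of dimension two make it only lean, which is why the field
`deco` of `HornData` allows a new thin triangle only for the index 1. -/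
theorem subExtends_innerHorn {d : ℕ} {y : Z _⦋d + 1⦌} {i : Fin (d + 2)} (h : HornData S D y i)
    (h0 : 0 < i) (hn : i < Fin.last (d + 1))
    (ht : ∀ t ∈ dTri (d + 1) (i - 1) i (i + 1), (SSet.yonedaEquiv.symm y).app _ t ∈ D.sat .thin) :
    SubExtends mbAnodyne (Sub.mk S D) (Sub.mk (S ⊔ SSet.Subcomplex.ofSimplex y) D) := by
  let φ := inducedHom (mk' Δ[d + 1] ∅ (dTri (d + 1) (i - 1) i (i + 1)) ∅)
    (SSet.horn.{u} (d + 1) i).ι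
  have : Mono (Hom.hom φ) := inferInstanceAs (Mono (SSet.horn (d + 1) i).ι)
  refine subExtends_of_horn φ (mbGen_le_mbAnodyne _ (.innerHorn (d + 1) i h0 hn)) i (𝟙 Δ[d + 1])
    (fun _ x => ⟨x, rfl⟩) (range_ι_eq _) S D y (SSet.yonedaEquiv.symm y) rfl h.nonDegenerate
    h.notMem h.nonDegenerate_δ h.notMem_δ h.δ_mem ?_ ?_
  · intro k e he
    rw [mk'_deco] at he
    rcases he with he | he
    · exact D.degenerate_subset_sat k (SSet.app_mem_degenerate _ he)
    · cases k
      · exact he.elim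
      · exact ht e he
      · exact D.thin_sat_subset (ht e (he.resolve_right fun h => h))
  · intro k z hz
    refine (h.deco k z hz).imp_right fun h => ⟨h.1, fun hzy g => ?_⟩
    have hk : k.dim = d + 1 := dim_eq_of_mk_eq hzy
    refine mem_mk'_deco k hk (fun g hg => ?_) g
    rw [Fin.lt_def] at h0 hn
    rw [Fin.val_last] at hn
    rw [Fin.val_zero] at h0
    cases k
    · change 1 = d + 1 at hk
      lia
    · change 2 = d + 1 at hk
      exact ⟨(hg 0).trans (by change 0 = _; lia), (hg 1).trans (by change 1 = _; lia),
        (hg 2).trans (by change 2 = _; lia)⟩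
    · change 2 = d + 1 at hk
      exact Or.inl ⟨(hg 0).trans (by change 0 = _; lia), (hg 1).trans (by change 1 = _; lia),
        (hg 2).trans (by change 2 = _; lia)⟩

theorem subExtends_outerHorn {n : ℕ} {y : Z _⦋n + 2⦌}
    (h : HornData S D y (Fin.last (n + 2)))
    (he : ∀ e ∈ dEdge (n + 2) (n + 1) (n + 2), (SSet.yonedaEquiv.symm y).app _ e ∈ D.sat .marked)
    (ht : ∀ t ∈ dTri (n + 2) 0 (n + 1) (n + 2), (SSet.yonedaEquiv.symm y).app _ t ∈ D.sat .lean) :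
    SubExtends mbAnodyne (Sub.mk S D) (Sub.mk (S ⊔ SSet.Subcomplex.ofSimplex y) D) := by
  let φ := inducedHom (mk' Δ[n + 2] (dEdge (n + 2) (n + 1) (n + 2)) ∅
    (dTri (n + 2) 0 (n + 1) (n + 2))) (SSet.horn.{u} (n + 2) (Fin.last (n + 2))).ι
  have : Mono (Hom.hom φ) := inferInstanceAs (Mono (SSet.horn (n + 2) (Fin.last (n + 2))).ι)
  refine subExtends_of_horn φ (mbGen_le_mbAnodyne _ (.outerHorn n)) _ (𝟙 Δ[n + 2])
    (fun _ x => ⟨x, rfl⟩) (range_ι_eq _) S D y (SSet.yonedaEquiv.symm y) rfl h.nonDegenerate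
    h.notMem h.nonDegenerate_δ h.notMem_δ h.δ_mem ?_ ?_
  · intro k e hd
    rw [mk'_deco] at hd
    rcases hd with hd | hd
    · exact D.degenerate_subset_sat k (SSet.app_mem_degenerate _ hd)
    · cases k
      · exact he e hd
      · exact hd.elim
      · exact ht e (hd.resolve_left fun h => h)
  · intro k z hz
    refine (h.deco k z hz).imp_right fun h => ⟨h.1, fun hzy g => ?_⟩
    have hk : k.dim = n + 2 := dim_eq_of_mk_eq hzy
    refine mem_mk'_deco k hk (fun g hg => ?_) g
    cases k
    · change 1 = n + 2 at hk
      lia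
    · have := h.2 rfl hzy
      rw [Fin.val_last] at this
      lia
    · change 2 = n + 2 at hk
      exact Or.inr ⟨(hg 0).trans (by change 0 = _; lia), (hg 1).trans (by change 1 = _; lia),
        (hg 2).trans (by change 2 = _; lia)⟩

/-- (A5) plays the role of an outer horn of dimension one: the omitted face `Z.δ 1 y` is the initial
vertex of the edge. -/
theorem subExtends_terminalVertex {y : Z _⦋1⦌} (h : HornData S D y 1) (he : y ∈ D.sat .marked) :
    SubExtends mbAnodyne (Sub.mk S D) (Sub.mk (S ⊔ SSet.Subcomplex.ofSimplex y) D) := by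
  let φ := inducedHom (mk' Δ[1] Set.univ Set.univ Set.univ)
    (SSet.stdSimplex.δ (0 : Fin 2) : (Δ[0] : SSet.{u}) ⟶ Δ[1])
  have : Mono (Hom.hom φ) :=
    inferInstanceAs (Mono (SSet.stdSimplex.δ (0 : Fin 2) : (Δ[0] : SSet.{u}) ⟶ Δ[1]))
  refine subExtends_of_horn φ (mbGen_le_mbAnodyne _ .terminalVertex) 1 (𝟙 Δ[1])
    (fun _ x => ⟨x, rfl⟩) ?_ S D y (SSet.yonedaEquiv.symm y) rfl h.nonDegenerate
    h.notMem h.nonDegenerate_δ h.notMem_δ h.δ_mem ?_ ?_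
  · refine Eq.trans ?_ (image_id _).symm
    change SSet.Subcomplex.range (SSet.stdSimplex.δ (0 : Fin 2) : (Δ[0] : SSet.{u}) ⟶ Δ[1]) = _
    rw [SSet.Subcomplex.range_eq_ofSimplex, SSet.stdSimplex.ofSimplex_yonedaEquiv_δ]
    refine le_antisymm (SSet.face_le_horn 0 1 (by decide)) ?_
    rw [SSet.horn_eq_iSup, iSup_le_iff]
    rintro ⟨j, hj⟩
    have : j = 0 := by
      have : j ≠ 1 := hj
      lia
    subst this
    exact le_rfl
  · intro k e _
    cases k
    · exact yonedaEquiv_symm_app_mem y (D.degenerate_subset_sat .marked) he e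
    · refine D.degenerate_subset_sat .thin (SSet.app_mem_degenerate _ ?_)
      exact (SSet.degenerate_eq_univ_of_hasDimensionLT (Δ[1] : SSet.{u}) 2 2 le_rfl).symm ▸
        Set.mem_univ (α := (Δ[1] : SSet.{u}) _⦋2⦌) e
    · refine D.degenerate_subset_sat .lean (SSet.app_mem_degenerate _ ?_)
      exact (SSet.degenerate_eq_univ_of_hasDimensionLT (Δ[1] : SSet.{u}) 2 2 le_rfl).symm ▸
        Set.mem_univ (α := (Δ[1] : SSet.{u}) _⦋2⦌) e
  · intro k z hz
    refine (h.deco k z hz).imp_right fun h => ⟨h.1, fun _ g => ?_⟩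
    cases k
    exacts [Or.inr trivial, Or.inr trivial, Or.inr (Or.inl trivial)]

/-- Both collapses are pushouts along the same edge; cancelling that of the horn from that of the
simplex leaves a pushout. Hence `collapseHorn` is a monomorphism, and the quotient map is injective
outside the horn. -/
theorem isPushout_collapseHorn (n : ℕ) : IsPushout (SSet.horn.{u} (n + 2) 0).ι
    (pushout.inl (hornEdge01.{u} n) toPoint) (collapseMap (n + 1)) (collapseHorn n) := by
  have h₁ := IsPushout.of_hasPushout (hornEdge01.{u} n) toPoint
  have h₂ := IsPushout.of_hasPushout (edge01.{u} (n + 1)) toPoint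
  have e₁ : pushout.inl (hornEdge01.{u} n) toPoint ≫ collapseHorn n =
      (SSet.horn.{u} (n + 2) 0).ι ≫ collapseMap (n + 1) := pushout.inl_desc _ _ _
  have e₂ : pushout.inr (hornEdge01.{u} n) toPoint ≫ collapseHorn n =
      pushout.inr (edge01.{u} (n + 1)) toPoint :=
    (pushout.inr_desc _ _ _).trans (Category.id_comp _)
  refine IsPushout.of_left (h₁₁ := hornEdge01.{u} n) (v₁₁ := toPoint)
    (h₂₁ := pushout.inr (hornEdge01.{u} n) toPoint) ?_ e₁.symm h₁.flip.flip
  rw [hornEdge01_ι, e₂]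
  exact h₂

instance (n : ℕ) : Mono (collapseHorn.{u} n) :=
  (MorphismProperty.monomorphisms SSet.{u}).of_isPushout (isPushout_collapseHorn n).flip
    (inferInstanceAs (Mono (SSet.horn.{u} (n + 2) 0).ι))

theorem range_collapseHorn (n : ℕ) : SSet.Subcomplex.range (collapseHorn.{u} n) =
    (SSet.horn (n + 2) 0).image (collapseMap (n + 1)) := by
  have hs (d) : Function.Surjective ((pushout.inl (hornEdge01.{u} n) toPoint).app d) := by
    have : Epi (pushout.inl (hornEdge01.{u} n) toPoint) := inferInstance
    rw [NatTrans.epi_iff_epi_app] at this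
    exact (epi_iff_surjective _).1 (this d)
  have hw (d) (g) : (collapseHorn.{u} n).app d ((pushout.inl (hornEdge01.{u} n) toPoint).app d g) =
      (collapseMap (n + 1)).app d ((SSet.horn.{u} (n + 2) 0).ι.app d g) :=
    congrArg (fun f => f.app d g) (isPushout_collapseHorn n).w.symm
  apply le_antisymm
  · rintro d _ ⟨g, rfl⟩
    obtain ⟨g, rfl⟩ := hs d g
    exact ⟨_, g.2, (hw d g).symm⟩
  · rintro d _ ⟨g, hg, rfl⟩
    exact ⟨_, hw d ⟨g, hg⟩⟩

theorem subExtends_leftHorn {n : ℕ} {y : Z _⦋n + 2⦌} (h : HornData S D y 0) (v : Z _⦋0⦌)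
    (hv : (SSet.yonedaEquiv.symm y).app _ (SSet.stdSimplex.edge (n + 2) 0 1 (Fin.zero_le _)) =
      Z.σ 0 v)
    (ht : ∀ t ∈ dTri (n + 2) 0 1 (n + 2), (SSet.yonedaEquiv.symm y).app _ t ∈ D.sat .lean) :
    SubExtends mbAnodyne (Sub.mk S D) (Sub.mk (S ⊔ SSet.Subcomplex.ofSimplex y) D) := by
  let φ := inducedHom
    (mk' (collapse (n + 1)) ∅ ∅ ((collapseMap (n + 1)).app _ '' dTri (n + 2) 0 1 (n + 2)))
    (collapseHorn.{u} n)
  have : Mono (Hom.hom φ) := inferInstanceAs (Mono (collapseHorn n))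
  have hu (d) (t : (Δ[n + 2] : SSet.{u}).obj d) : (collapseDesc y v hv).app d
      ((collapseMap (n + 1)).app d t) = (SSet.yonedaEquiv.symm y).app d t :=
    app_app (collapseMap_collapseDesc y v hv) t
  refine subExtends_of_horn φ (mbGen_le_mbAnodyne _ (.leftDegenerate n)) 0 (collapseMap (n + 1))
    (fun d => collapseMap_surjective _ _) (range_collapseHorn n) S D y (collapseDesc y v hv)
    (collapseMap_collapseDesc y v hv) h.nonDegenerate
    h.notMem h.nonDegenerate_δ h.notMem_δ h.δ_mem ?_ ?_
  · intro k e hd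
    rw [mk'_deco] at hd
    rcases hd with hd | hd
    · exact D.degenerate_subset_sat k (SSet.app_mem_degenerate _ hd)
    · cases k
      · exact hd.elim
      · exact hd.elim
      · obtain ⟨t, ht', rfl⟩ := hd.resolve_left fun h => h
        exact Set.mem_of_eq_of_mem (s := D.sat .lean) (hu _ t) (ht t ht')
  · intro k z hz
    refine (h.deco k z hz).imp_right fun h => ⟨h.1, fun hzy g => ?_⟩
    have hk : k.dim = n + 2 := dim_eq_of_mk_eq hzy
    cases k
    · change 1 = n + 2 at hk
      lia
    · have := h.2 rfl hzy
      rw [Fin.val_zero] at this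
      lia
    · obtain rfl : n = 0 := by
        change 2 = n + 2 at hk
        lia
      rcases degenerate_or_eq_id g with hg | rfl
      · exact Or.inl (SSet.app_mem_degenerate _ hg)
      · exact Or.inr (Or.inr ⟨_, ⟨rfl, rfl, rfl⟩, rfl⟩)

end

end MBSSet

namespace MBSSet

/-! ### Attaching all simplices of a pairing -/

section

variable {Z' Z : SSet.{u}}

theorem mem_of_mk_eq (S : Z.Subcomplex) {n m : ℕ} {z : Z _⦋n⦌} {y : Z _⦋m⦌}
    (h : SSet.S.mk z = SSet.S.mk y) (hz : z ∈ S.obj _) : y ∈ S.obj _ := by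
  obtain rfl := dim_eq_of_mk_eq h
  rw [SSet.S.ext_iff'] at h
  obtain ⟨_, h⟩ := h
  exact Set.mem_of_eq_of_mem (s := S.obj _) h.symm hz

theorem mk_eq_of_mk_app_eq {U : Z'.Subcomplex} {q : Z' ⟶ Z}
    (hinj : ∀ n (z z' : Z' _⦋n⦌), z ∉ U.obj _ → q.app _ z = q.app _ z' → z = z')
    {n m : ℕ} {z : Z' _⦋n⦌} {y : Z' _⦋m⦌} (hz : z ∉ U.obj _)
    (h : SSet.S.mk (q.app _ z) = SSet.S.mk (q.app _ y)) : SSet.S.mk z = SSet.S.mk y := by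
  obtain rfl := dim_eq_of_mk_eq h
  rw [SSet.S.ext_iff'] at h
  obtain ⟨_, h⟩ := h
  rw [hinj _ z y hz h]

variable {U : Z'.Subcomplex} (q : Z' ⟶ Z)

theorem nonDegenerate_app (hq : ∀ n, Function.Surjective (q.app n))
    (hinj : ∀ n (z z' : Z' _⦋n⦌), z ∉ U.obj _ → q.app _ z = q.app _ z' → z = z') {n : ℕ}
    {z : Z' _⦋n⦌} (hz : z ∈ Z'.nonDegenerate n) (hz' : z ∉ U.obj _) :
    q.app _ z ∈ Z.nonDegenerate n := by
  rintro ⟨m, hm, p, w, hw⟩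
  obtain ⟨w, rfl⟩ := hq _ w
  refine hz ⟨m, hm, p, w, (hinj n z _ hz' ?_).symm⟩
  exact hw.symm.trans (NatTrans.naturality_apply q p.op w).symm

theorem app_notMem_image
    (hinj : ∀ n (z z' : Z' _⦋n⦌), z ∉ U.obj _ → q.app _ z = q.app _ z' → z = z') {n : ℕ}
    {z : Z' _⦋n⦌} (hz : z ∉ U.obj _) : q.app _ z ∉ (U.image q).obj _ := by
  rintro ⟨w, hw, e⟩
  exact hz (Set.mem_of_eq_of_mem (s := U.obj _) (hinj n z w hz e.symm) hw)

theorem exists_map_of_app_mem_ofSimplex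
    (hinj : ∀ n (z z' : Z' _⦋n⦌), z ∉ U.obj _ → q.app _ z = q.app _ z' → z = z') {n m : ℕ}
    {z : Z' _⦋n⦌} {y : Z' _⦋m⦌} (hz : z ∉ U.obj _)
    (h : q.app _ z ∈ (SSet.Subcomplex.ofSimplex (q.app _ y)).obj _) :
    z ∈ (SSet.Subcomplex.ofSimplex y).obj _ := by
  rw [SSet.Subcomplex.mem_ofSimplex_obj_iff] at h ⊢
  obtain ⟨f, hf⟩ := h
  exact ⟨f, (hinj n z _ hz (hf.symm.trans (NatTrans.naturality_apply q f.op y).symm)).symm⟩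

/-- If all simplices of a regular pairing may be attached along the corresponding horns,
then the whole simplicial set may be obtained. -/
theorem subExtends_of_pairingCore [Z'.Nonsingular] (h : SSet.Subcomplex.PairingCore.{u} U) [h.IsRegular]
    (hq : ∀ n, Function.Surjective (q.app n))
    (hinj : ∀ n (z z' : Z' _⦋n⦌), z ∉ U.obj _ → q.app _ z = q.app _ z' → z = z')
    (D : DecoSet Z) (hD : ∀ (k : Kind) (z : Z _⦋k.dim⦌), z ∈ D.sat k → z ∈ Z.degenerate k.dim ∨
      z ∈ (U.image q).obj _ ∨ ∃ s : h.ι, SSet.S.mk z = SSet.S.mk (q.app _ (h.simplex s)) ∧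
        (k = .thin → (h.index s : ℕ) = 1))
    (hA : ∀ (s : h.ι) (S : Z.Subcomplex), U.image q ≤ S →
      HornData S D (q.app _ (h.simplex s)) (h.index s) →
      SubExtends mbAnodyne (Sub.mk S D)
        (Sub.mk (S ⊔ SSet.Subcomplex.ofSimplex (q.app _ (h.simplex s))) D)) :
    SubExtends mbAnodyne (Sub.mk (U.image q) D) (Sub.mk ⊤ D) := by
  obtain ⟨r⟩ := h.isRegular_iff_nonempty_rankFunction.1 inferInstance
  let C (s : h.ι) : Z.Subcomplex := SSet.Subcomplex.ofSimplex (q.app _ (h.simplex s))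
  have e (T : Set h.ι) : Sub.mk (U.image q) D ⊔ ⨆ s ∈ T, Sub.mk (C s) D =
      Sub.mk (U.image q ⊔ ⨆ s ∈ T, C s) D := by
    simp only [Sub.iSup_mk]
    exact congrArg (Sub.mk _) (sup_eq_left.2 (iSup₂_le fun _ _ => le_rfl))
  have key : SubExtends mbAnodyne (Sub.mk (U.image q) D)
      (Sub.mk (U.image q) D ⊔ ⨆ s, Sub.mk (C s) D) := by
    refine subExtends_of_rank (W := mbAnodyne) r.rank _ _ fun s T hT hT' hs => ?_
    rw [e, Sub.mk_sup, sup_idem]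
    have hne (n : ℕ) (z : Z' _⦋n⦌) (hz : z ∉ U.obj _)
        (hz' : ∀ t ∈ T, z ∉ (SSet.Subcomplex.ofSimplex (h.simplex t)).obj _) :
        q.app _ z ∉ (U.image q ⊔ ⨆ s ∈ T, C s).obj _ := by
      rintro (hn | hn)
      · exact app_notMem_image q hinj hz hn
      · simp only [Subfunctor.iSup_obj, Set.mem_iUnion] at hn
        obtain ⟨t, ht, hn⟩ := hn
        exact hz' t ht (exists_map_of_app_mem_ofSimplex q hinj hz hn)
    -- A simplex attached earlier cannot contain the omitted face of `s`: otherwise `s` would be an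
    -- ancestor of `t` and have smaller rank.
    have hts (t : h.ι) (ht : t ∈ T) (hle : h.type₂ s ≤ h.type₁ t) : False := by
      rcases hle.eq_or_lt with hst | hlt
      · exact h.type₁_ne_type₂ _ _ hst.symm
      · have hst : s ≠ t := fun hst => hs (hst ▸ ht)
        exact (r.lt ⟨hst, hlt⟩).not_ge (hT' t ht)
    refine hA s _ le_sup_left ⟨nonDegenerate_app q hq hinj (h.nonDegenerate₁ s) (h.notMem₁ s), ?_, ?_, ?_, ?_, ?_⟩
    · refine hne _ _ (h.notMem₁ s) fun t ht hst => hts t ht ?_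
      refine le_trans ?_ (SSet.Subcomplex.ofSimplex_le_iff _ _ |>.2 hst : h.type₁ s ≤ h.type₁ t)
      exact (SSet.Subcomplex.ofSimplex_le_iff _ _).2
        ((SSet.Subcomplex.ofSimplex _).map _ (SSet.Subcomplex.mem_ofSimplex_obj _))
    · rw [← SSet.δ_naturality_apply]
      exact nonDegenerate_app q hq hinj (h.nonDegenerate₂ s) (h.notMem₂ s)
    · rw [← SSet.δ_naturality_apply]
      exact hne _ _ (h.notMem₂ s) fun t ht hst => hts t ht
        ((SSet.Subcomplex.ofSimplex_le_iff _ _).2 hst)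
    · intro j hj
      rw [← SSet.δ_naturality_apply]
      -- Another face outside `U` belongs to a pair `t` different from `s`, since the faces of a
      -- nondegenerate simplex are distinct. Then `t` is an ancestor of `s`, so it has smaller rank
      -- and is already attached.
      by_cases hU : Z'.δ j (h.simplex s) ∈ U.obj _
      · exact Or.inl ⟨_, hU, rfl⟩
      right
      have hnd := SSet.nonDegenerate_δ (h.nonDegenerate₁ s) j
      let w := SSet.Subcomplex.N.mk (A := U) _ hnd hU
      obtain ⟨t, ht⟩ := h.surjective w
      have hts' : t ≠ s := by
        rintro rfl
        rcases ht with ht | ht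
        · have : h.dim t = h.dim t + 1 := congrArg (fun w => w.dim) ht
          lia
        · have ht' : SSet.S.mk (Z'.δ j (h.simplex t)) = SSet.S.mk (Z'.δ (h.index t) (h.simplex t)) :=
            congrArg (fun w => w.toS) ht
          rw [SSet.S.ext_iff'] at ht'
          exact hj (SSet.Nonsingular.δ_injective _ (h.nonDegenerate₁ t) _ _ ht'.2)
      have hws : w < h.type₁ s := by
        refine lt_of_le_of_ne ((SSet.Subcomplex.ofSimplex_le_iff _ _).2
          ((SSet.Subcomplex.ofSimplex _).map _ (SSet.Subcomplex.mem_ofSimplex_obj _))) fun hw => ?_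
        have : h.dim s = h.dim s + 1 := congrArg (fun w => w.dim) hw
        lia
      have htt : h.type₂ t ≤ h.type₁ t := (SSet.Subcomplex.ofSimplex_le_iff _ _).2
          ((SSet.Subcomplex.ofSimplex _).map _ (SSet.Subcomplex.mem_ofSimplex_obj _))
      have hrank : r.rank t < r.rank s := r.lt ⟨hts', by
        rcases ht with ht | ht
        · exact (htt.trans ht.ge).trans_lt hws
        · exact ht ▸ hws⟩
      have hwt : w ≤ h.type₁ t := by
        rcases ht with ht | ht
        · exact ht.le
        · exact ht.le.trans htt
      have hmem : Z'.δ j (h.simplex s) ∈ (SSet.Subcomplex.ofSimplex (h.simplex t)).obj _ :=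
        (SSet.Subcomplex.ofSimplex_le_iff _ _).1 hwt
      rw [SSet.Subcomplex.mem_ofSimplex_obj_iff] at hmem
      obtain ⟨f, hf⟩ := hmem
      simp only [Subfunctor.iSup_obj, Set.mem_iUnion]
      refine ⟨t, hT t hrank, ?_⟩
      rw [SSet.Subcomplex.mem_ofSimplex_obj_iff]
      exact ⟨f, by rw [← hf]; exact (NatTrans.naturality_apply q f.op _).symm⟩
    -- A nondegenerate decorated simplex outside the image of `U` is the larger simplex of a pair,
    -- so it is never an omitted face.
    · intro k z hz
      refine (hD k z hz).imp_right fun hz => ?_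
      rw [← SSet.δ_naturality_apply]
      rcases hz with hz | ⟨t, ht, hkt⟩
      · exact ⟨fun e => app_notMem_image q hinj (h.notMem₂ s) (mem_of_mk_eq _ e hz),
          fun _ e => (app_notMem_image q hinj (h.notMem₁ s) (mem_of_mk_eq _ e hz)).elim⟩
      · rw [ht]
        refine ⟨fun e => h.type₁_ne_type₂' t s (mk_eq_of_mk_app_eq hinj (h.notMem₁ t) e),
          fun hk e => ?_⟩
        rw [← h.injective_type₁' (mk_eq_of_mk_app_eq hinj (h.notMem₁ t) e)]
        exact hkt hk
  have e' := e Set.univ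
  simp only [Set.mem_univ, iSup_pos] at e'
  rw [e'] at key
  have htop : U.image q ⊔ ⨆ s, C s = ⊤ := by
    rw [eq_top_iff, SSet.Subcomplex.le_iff_contains_nonDegenerate]
    rintro n ⟨z, hz⟩ _
    obtain ⟨z, rfl⟩ := hq _ z
    by_cases hU : z ∈ U.obj _
    · exact Or.inl ⟨z, hU, rfl⟩
    right
    have hz' : z ∈ Z'.nonDegenerate n := fun hz' => hz (SSet.app_mem_degenerate q hz')
    obtain ⟨t, ht⟩ := h.surjective (SSet.Subcomplex.N.mk (A := U) z hz' hU)
    have htt : h.type₂ t ≤ h.type₁ t := (SSet.Subcomplex.ofSimplex_le_iff _ _).2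
          ((SSet.Subcomplex.ofSimplex _).map _ (SSet.Subcomplex.mem_ofSimplex_obj _))
    have hle : SSet.Subcomplex.N.mk (A := U) z hz' hU ≤ h.type₁ t := by
      rcases ht with ht | ht
      · exact ht.le
      · exact ht.le.trans htt
    have hmem : z ∈ (SSet.Subcomplex.ofSimplex (h.simplex t)).obj _ :=
      (SSet.Subcomplex.ofSimplex_le_iff _ _).1 hle
    rw [SSet.Subcomplex.mem_ofSimplex_obj_iff] at hmem
    obtain ⟨f, hf⟩ := hmem
    simp only [Subfunctor.iSup_obj, Set.mem_iUnion]
    refine ⟨t, ?_⟩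
    rw [SSet.Subcomplex.mem_ofSimplex_obj_iff]
    exact ⟨f, by rw [← hf]; exact (NatTrans.naturality_apply q f.op _).symm⟩
  rwa [htop] at key

end

end MBSSet

namespace MBSSet

/-! ### Reversing the order of vertices -/

section Reverse

variable {X : SSet.{u}} (R : ∀ {d : ℕ}, X _⦋d⦌ → X _⦋d⦌)
  (hR : ∀ {d} (x : X _⦋d⦌), R (R x) = x)
  (hmap : ∀ {d e : ℕ} (f : ⦋d⦌ ⟶ ⦋e⦌) (x : X _⦋e⦌),
    R (X.map f.op x) = X.map (SimplexCategory.rev.map f).op (R x))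

include hR hmap

theorem reverse_mem_nonDegenerate {d : ℕ} {x : X _⦋d⦌} (hx : x ∈ X.nonDegenerate d) :
    R x ∈ X.nonDegenerate d := by
  rintro ⟨m, hm, p, y, hy⟩
  refine hx ⟨m, hm, SimplexCategory.rev.map p, R y, ?_⟩
  exact (hmap p y).symm.trans ((congrArg R hy).trans (hR x))

theorem mk_eq_of_reverse {d e : ℕ} {x : X _⦋d⦌} {y : X _⦋e⦌}
    (h : SSet.S.mk (R x) = SSet.S.mk (R y)) : SSet.S.mk x = SSet.S.mk y := by
  obtain rfl := dim_eq_of_mk_eq h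
  rw [SSet.S.ext_iff'] at h
  obtain ⟨_, h⟩ := h
  rw [← hR x, ← hR y]
  exact congrArg (fun z => SSet.S.mk (R z)) h

theorem reverse_δ {d : ℕ} (i : Fin (d + 2)) (x : X _⦋d + 1⦌) :
    R (X.δ i x) = X.δ i.rev (R x) := by
  refine (hmap (SimplexCategory.δ i) x).trans ?_
  rw [SimplexCategory.rev_map_δ]
  rfl

theorem reverse_mem_ofSimplex {d e : ℕ} {x : X _⦋d⦌} {y : X _⦋e⦌}
    (h : x ∈ (SSet.Subcomplex.ofSimplex y).obj _) :
    R x ∈ (SSet.Subcomplex.ofSimplex (R y)).obj _ := by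
  rw [SSet.Subcomplex.mem_ofSimplex_obj_iff] at h ⊢
  obtain ⟨f, rfl⟩ := h
  exact ⟨_, (hmap f y).symm⟩

variable {A B : X.Subcomplex} (hAB : ∀ {d} (x : X _⦋d⦌), R x ∈ B.obj _ ↔ x ∈ A.obj _)

/-- The pairing obtained by reversing the order of vertices. -/
@[simps]
def reversePairingCore (h : SSet.Subcomplex.PairingCore.{u} A) :
    SSet.Subcomplex.PairingCore.{u} B where
  ι := h.ι
  dim := h.dim
  simplex s := R (h.simplex s)
  index s := (h.index s).rev
  nonDegenerate₁ s := reverse_mem_nonDegenerate R hR hmap (h.nonDegenerate₁ s)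
  nonDegenerate₂ s := by
    rw [← reverse_δ R hR hmap]
    exact reverse_mem_nonDegenerate R hR hmap (h.nonDegenerate₂ s)
  notMem₁ s := by
    rw [hAB]
    exact h.notMem₁ s
  notMem₂ s := by
    rw [← reverse_δ R hR hmap, hAB]
    exact h.notMem₂ s
  injective_type₁' e := h.injective_type₁' (mk_eq_of_reverse R hR hmap e)
  injective_type₂' e := by
    rw [← reverse_δ R hR hmap, ← reverse_δ R hR hmap] at e
    exact h.injective_type₂' (mk_eq_of_reverse R hR hmap e)
  type₁_ne_type₂' s t e := by
    rw [← reverse_δ R hR hmap] at e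
    exact h.type₁_ne_type₂' s t (mk_eq_of_reverse R hR hmap e)
  surjective' w := by
    obtain ⟨n, z, hz, hz', rfl⟩ := SSet.Subcomplex.N.mk_surjective w
    obtain ⟨s, hs⟩ := h.surjective' (SSet.Subcomplex.N.mk (A := A) (R z)
      (reverse_mem_nonDegenerate R hR hmap hz) (by rwa [← hAB, hR]))
    refine ⟨s, hs.imp (fun e => ?_) fun e => ?_⟩
    · refine mk_eq_of_reverse R hR hmap ?_
      rw [hR]
      exact e
    · rw [← reverse_δ R hR hmap]
      refine mk_eq_of_reverse R hR hmap ?_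
      rw [hR]
      exact e

/-- Reversal respects the face relation, so the same rank function works. -/
theorem isRegular_reversePairingCore [X.Nonsingular] (h : SSet.Subcomplex.PairingCore.{u} A)
    [h.IsRegular] : (reversePairingCore R hR hmap hAB h).IsRegular := by
  obtain ⟨r⟩ := h.isRegular_iff_nonempty_rankFunction.1 inferInstance
  have key : ∀ {s t : h.ι}, (reversePairingCore R hR hmap hAB h).AncestralRel s t →
      r.rank s < r.rank t := ?_
  · exact SSet.Subcomplex.PairingCore.RankFunction.isRegular (α := ℕ) ⟨r.rank, key⟩
  intro s t hst
  refine r.lt ⟨hst.1, ?_⟩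
  refine lt_of_le_of_ne ?_ (h.type₁_ne_type₂ _ _).symm
  have h₁ := reverse_mem_ofSimplex R hR hmap ((SSet.Subcomplex.ofSimplex_le_iff _ _).1 hst.2.le)
  refine (SSet.Subcomplex.ofSimplex_le_iff _ _).2 ?_
  change R (X.δ (h.index s).rev (R (h.simplex s))) ∈
    (SSet.Subcomplex.ofSimplex (R (R (h.simplex t)))).obj _ at h₁
  rwa [reverse_δ R hR hmap, hR, hR, Fin.rev_rev] at h₁

end Reverse

/-- Reversing the order of vertices in a product of standard simplices. -/
def reverse {m n d : ℕ} (z : (Δ[m] ⊗ Δ[n] : SSet.{u}) _⦋d⦌) : (Δ[m] ⊗ Δ[n] : SSet.{u}) _⦋d⦌ :=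
  (SSet.stdSimplex.objEquiv.symm (SimplexCategory.rev.map (SSet.stdSimplex.objEquiv z.1)),
    SSet.stdSimplex.objEquiv.symm (SimplexCategory.rev.map (SSet.stdSimplex.objEquiv z.2)))

theorem reverse_fst_apply {m n d : ℕ} (z : (Δ[m] ⊗ Δ[n] : SSet.{u}) _⦋d⦌) (j : Fin (d + 1)) :
    (reverse z).1 j = (z.1 j.rev).rev := rfl

theorem reverse_snd_apply {m n d : ℕ} (z : (Δ[m] ⊗ Δ[n] : SSet.{u}) _⦋d⦌) (j : Fin (d + 1)) :
    (reverse z).2 j = (z.2 j.rev).rev := rfl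

theorem reverse_reverse {m n d : ℕ} (z : (Δ[m] ⊗ Δ[n] : SSet.{u}) _⦋d⦌) :
    reverse (reverse z) = z := by
  refine Prod.ext (SSet.stdSimplex.ext _ _ fun j => ?_) (SSet.stdSimplex.ext _ _ fun j => ?_)
  · rw [reverse_fst_apply, reverse_fst_apply, Fin.rev_rev, Fin.rev_rev]
  · rw [reverse_snd_apply, reverse_snd_apply, Fin.rev_rev, Fin.rev_rev]

theorem reverse_map {m n d e : ℕ} (f : ⦋d⦌ ⟶ ⦋e⦌) (z : (Δ[m] ⊗ Δ[n] : SSet.{u}) _⦋e⦌) :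
    reverse ((Δ[m] ⊗ Δ[n] : SSet.{u}).map f.op z) =
      (Δ[m] ⊗ Δ[n] : SSet.{u}).map (SimplexCategory.rev.map f).op (reverse z) := by
  refine Prod.ext (SSet.stdSimplex.ext _ _ fun j => ?_) (SSet.stdSimplex.ext _ _ fun j => ?_)
  · change (z.1 (f j.rev)).rev = (z.1 ((f j.rev).rev).rev).rev
    rw [Fin.rev_rev]
  · change (z.2 (f j.rev)).rev = (z.2 ((f j.rev).rev).rev).rev
    rw [Fin.rev_rev]

theorem mem_unionProd_horn_boundary_iff {m n d : ℕ} (k : Fin (m + 2))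
    (z : (Δ[m + 1] ⊗ Δ[n] : SSet.{u}) _⦋d⦌) :
    z ∈ (SSet.Subcomplex.unionProd (SSet.horn (m + 1) k) (SSet.boundary n)).obj _ ↔
      ¬ ((∀ i ≠ k, ∃ j, z.1 j = i) ∧ ∀ i, ∃ j, z.2 j = i) := by
  refine (SSet.Subcomplex.mem_unionProd_iff (X := Δ[m + 1]) (Y := Δ[n]) _ _ z).trans ?_
  refine (or_congr (SSet.mem_boundary_iff_notMem_range z.2)
    (SSet.mem_horn_iff_notMem_range z.1 k)).trans ?_
  simp only [Set.mem_range, not_and_or, not_forall]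
  rw [or_comm]

/-- The simplex `z` of `Δ[m] ⊗ Δ[n]` contains an edge from `(a, t)` to `(a + 1, t)`, at the
position `l`. -/
def HasStep {m n d : ℕ} (a : ℕ) (z : (Δ[m] ⊗ Δ[n] : SSet.{u}) _⦋d + 1⦌) (l : Fin (d + 1)) : Prop :=
  (z.1 l.castSucc : ℕ) = a ∧ (z.1 l.succ : ℕ) = a + 1 ∧ z.2 l.succ = z.2 l.castSucc

theorem HasStep.reverse {m n d a b : ℕ} {z : (Δ[m] ⊗ Δ[n] : SSet.{u}) _⦋d + 1⦌} {l : Fin (d + 1)}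
    (h : HasStep a z l) (hab : a + b + 1 = m) : HasStep b (MBSSet.reverse z) l.rev := by
  have e₁ : l.rev.castSucc.rev = l.succ := by rw [Fin.rev_castSucc, Fin.rev_rev]
  have e₂ : l.rev.succ.rev = l.castSucc := by rw [Fin.rev_succ, Fin.rev_rev]
  obtain ⟨h₁, h₂, h₃⟩ := h
  refine ⟨?_, ?_, ?_⟩
  · refine (congrArg (fun i => (Fin.rev (z.1 i) : ℕ)) e₁).trans ?_
    refine (Fin.val_rev _).trans ?_
    lia
  · refine (congrArg (fun i => (Fin.rev (z.1 i) : ℕ)) e₂).trans ?_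
    refine (Fin.val_rev _).trans ?_
    lia
  · refine (congrArg (fun i => (Fin.rev (z.2 i))) e₂).trans (Eq.trans ?_
      (congrArg (fun i => (Fin.rev (z.2 i))) e₁).symm)
    exact congrArg Fin.rev h₃.symm

theorem eq_of_nonDegenerate {m n d : ℕ} {z : (Δ[m] ⊗ Δ[n] : SSet.{u}) _⦋d⦌}
    (hz : z ∈ (Δ[m] ⊗ Δ[n] : SSet.{u}).nonDegenerate d) {i j : Fin (d + 1)}
    (h₁ : z.1 i = z.1 j) (h₂ : z.2 i = z.2 j) : i = j :=
  ((SSet.prodStdSimplex.nonDegenerate_iff_strictMono_objEquiv z).1 hz).injective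
    (Prod.ext h₁ h₂)

/-- A pairing for the inclusion of `Λ[m + 1, k] ⊗ Δ[n] ⊔ Δ[m + 1] ⊗ ∂Δ[n]`, such that all
simplices to be attached contain an edge from `(a, t)` to `(a + 1, t)`, the omitted face being
opposite to the initial vertex of this edge if `ε = 0`, and to the final vertex if `ε = 1`. -/
structure StepPairing (m n : ℕ) (k : Fin (m + 2)) (a ε : ℕ) where
  /-- The pairing. -/
  core : SSet.Subcomplex.PairingCore.{u}
    (SSet.Subcomplex.unionProd (SSet.horn.{u} (m + 1) k) (SSet.boundary.{u} n))
  isRegular : core.IsRegular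
  le_one : ε ≤ 1
  step (s : core.ι) : ∃ l, HasStep a (core.simplex s) l ∧ (core.index s : ℕ) = l + ε

/-- The pairing for a horn which does not omit the face opposite to the final vertex. -/
noncomputable def stepPairing {m : ℕ} (k : Fin (m + 1)) (n : ℕ) :
    StepPairing.{u} m n k.castSucc k 0 where
  core := SSet.prodStdSimplex.pairingCore k n
  isRegular := inferInstance
  le_one := zero_le_one
  step s := ⟨s.index, ⟨congrArg Fin.val s.isIndex.1, congrArg Fin.val s.isIndex.2.1,
    s.isIndex.2.2⟩, rfl⟩

theorem reverse_mem_unionProd_iff {m n d : ℕ} (z : (Δ[m + 1] ⊗ Δ[n] : SSet.{u}) _⦋d⦌) :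
    reverse z ∈ (SSet.Subcomplex.unionProd (SSet.horn (m + 1) (Fin.last (m + 1)))
        (SSet.boundary n)).obj _ ↔
      z ∈ (SSet.Subcomplex.unionProd (SSet.horn (m + 1) (0 : Fin (m + 1)).castSucc)
        (SSet.boundary n)).obj _ := by
  rw [mem_unionProd_horn_boundary_iff, mem_unionProd_horn_boundary_iff, not_iff_not]
  refine and_congr ⟨fun h i hi => ?_, fun h i hi => ?_⟩ ⟨fun h i => ?_, fun h i => ?_⟩
  · obtain ⟨j, hj⟩ := h i.rev fun e => hi (by
      rw [← Fin.rev_rev i, e, Fin.rev_last]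
      rfl)
    rw [reverse_fst_apply] at hj
    exact ⟨j.rev, Fin.rev_injective hj⟩
  · obtain ⟨j, hj⟩ := h i.rev fun e => hi (by
      rw [← Fin.rev_rev i, e, Fin.castSucc_zero, Fin.rev_zero])
    refine ⟨j.rev, ?_⟩
    rw [reverse_fst_apply, Fin.rev_rev, hj, Fin.rev_rev]
  · obtain ⟨j, hj⟩ := h i.rev
    rw [reverse_snd_apply] at hj
    exact ⟨j.rev, Fin.rev_injective hj⟩
  · obtain ⟨j, hj⟩ := h i.rev
    refine ⟨j.rev, ?_⟩
    rw [reverse_snd_apply, Fin.rev_rev, hj, Fin.rev_rev]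

/-- The pairing for a horn which omits the face opposite to the final vertex. -/
noncomputable def stepPairingLast (m n : ℕ) :
    StepPairing.{u} m n (Fin.last (m + 1)) m 1 where
  core := reversePairingCore reverse reverse_reverse reverse_map reverse_mem_unionProd_iff
    (SSet.prodStdSimplex.pairingCore (0 : Fin (m + 1)) n)
  isRegular := isRegular_reversePairingCore _ _ _ _ _
  le_one := le_rfl
  step s := ⟨s.index.rev, HasStep.reverse (a := 0) ⟨congrArg Fin.val s.isIndex.1,
    congrArg Fin.val s.isIndex.2.1, s.isIndex.2.2⟩ (by lia),
      congrArg Fin.val (Fin.rev_castSucc s.index)⟩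

namespace StepPairing

variable {m n : ℕ} {k : Fin (m + 2)} {a ε : ℕ} (P : StepPairing.{u} m n k a ε)

/-- If such a simplex were the omitted face of some `x`, its step would straddle the vertex removed
from `x`. By monotonicity that vertex would coincide with an end of the step, contradicting
nondegeneracy. Decorations on simplices with a step thus never fall on omitted faces. -/
theorem exists_cell {d : ℕ} {z : (Δ[m + 1] ⊗ Δ[n] : SSet.{u}) _⦋d + 1⦌}
    (hz : z ∈ (Δ[m + 1] ⊗ Δ[n] : SSet.{u}).nonDegenerate _)
    (hz' : z ∉ (SSet.Subcomplex.unionProd (SSet.horn (m + 1) k) (SSet.boundary n)).obj _)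
    {l : Fin (d + 1)} (hl : HasStep a z l) :
    ∃ s : P.core.ι, SSet.S.mk z = SSet.S.mk (P.core.simplex s) ∧
      (P.core.index s : ℕ) = l + ε := by
  obtain ⟨s, hs | hs⟩ := P.core.surjective' (SSet.Subcomplex.N.mk z hz hz')
  · refine ⟨s, hs, ?_⟩
    obtain ⟨l', hl', hi⟩ := P.step s
    have hs' : SSet.S.mk z = SSet.S.mk (P.core.simplex s) := hs
    have hd : d = P.core.dim s := by
      have := dim_eq_of_mk_eq hs'
      lia
    rw [hi]
    clear hi hs
    generalize P.core.simplex s = x at *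
    generalize P.core.dim s = d' at *
    subst hd
    rw [SSet.S.ext_iff'] at hs'
    obtain ⟨_, hs'⟩ := hs'
    obtain rfl : z = x := hs'
    -- The first coordinate passes from `a` to `a + 1` only once, so the two positions agree.
    have h₁ : ¬ l.succ ≤ l'.castSucc := fun h => by
      have : (z.1 l.succ : ℕ) ≤ z.1 l'.castSucc := SSet.stdSimplex.monotone_apply z.1 h
      have := hl.2.1
      have := hl'.1
      lia
    have h₂ : ¬ l'.succ ≤ l.castSucc := fun h => by
      have : (z.1 l'.succ : ℕ) ≤ z.1 l.castSucc := SSet.stdSimplex.monotone_apply z.1 h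
      have := hl'.2.1
      have := hl.1
      lia
    rw [Fin.le_def] at h₁ h₂
    simp only [Fin.val_succ, Fin.val_castSucc] at h₁ h₂
    lia
  · exfalso
    obtain ⟨l', hl', hi⟩ := P.step s
    have hs' : SSet.S.mk z = SSet.S.mk ((Δ[m + 1] ⊗ Δ[n] : SSet.{u}).δ (P.core.index s)
      (P.core.simplex s)) := hs
    have hx := P.core.nonDegenerate₁ s
    have hd : d + 1 = P.core.dim s := dim_eq_of_mk_eq hs'
    generalize P.core.index s = i at *
    generalize P.core.simplex s = x at *
    generalize P.core.dim s = d' at *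
    subst hd
    rw [SSet.S.ext_iff'] at hs'
    obtain ⟨_, hs'⟩ := hs'
    obtain rfl : z = (Δ[m + 1] ⊗ Δ[n] : SSet.{u}).δ i x := hs'
    obtain ⟨h₁, h₂, h₃⟩ := hl
    change (x.1 (i.succAbove l.castSucc) : ℕ) = a at h₁
    change (x.1 (i.succAbove l.succ) : ℕ) = a + 1 at h₂
    change x.2 (i.succAbove l.succ) = x.2 (i.succAbove l.castSucc) at h₃
    have hp : i.succAbove l.castSucc < i.succAbove l.succ :=
      Fin.strictMono_succAbove i (Fin.castSucc_lt_succ (i := l))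
    have hpi := Fin.succAbove_ne i l.castSucc
    have hpi' := Fin.succAbove_ne i l.succ
    generalize i.succAbove l.castSucc = p at *
    generalize i.succAbove l.succ = p' at *
    have hp₁ : ¬ l'.succ ≤ p := fun h => by
      have : (x.1 l'.succ : ℕ) ≤ x.1 p := SSet.stdSimplex.monotone_apply x.1 h
      have := hl'.2.1
      lia
    have hp₂ : ¬ p' ≤ l'.castSucc := fun h => by
      have : (x.1 p' : ℕ) ≤ x.1 l'.castSucc := SSet.stdSimplex.monotone_apply x.1 h
      have := hl'.1
      lia
    rw [Fin.le_def] at hp₁ hp₂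
    simp only [Fin.val_succ, Fin.val_castSucc] at hp₁ hp₂
    rw [Fin.lt_def] at hp
    have hmono (q : Fin (d + 1 + 1 + 1)) (hq : p ≤ q) (hq' : q ≤ p') :
        x.2 q = x.2 p ∧ x.2 q = x.2 p' := by
      have h₄ : x.2 p ≤ x.2 q := SSet.stdSimplex.monotone_apply x.2 hq
      have h₅ : x.2 q ≤ x.2 p' := SSet.stdSimplex.monotone_apply x.2 hq'
      rw [h₃] at h₅ ⊢
      exact ⟨le_antisymm h₅ h₄, le_antisymm h₅ h₄⟩
    have hε := P.le_one
    rcases Nat.le_one_iff_eq_zero_or_eq_one.1 hε with rfl | rfl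
    -- The removed vertex lies between `p` and `p'` and has first coordinate `a`, so it coincides
    -- with the vertex at `p`. For `ε = 1` it has first coordinate `a + 1` and coincides with the
    -- vertex at `p'`.
    · obtain rfl : i = l'.castSucc := Fin.ext hi
      refine hpi (eq_of_nonDegenerate hx (Fin.ext (h₁.trans hl'.1.symm)) ?_)
      exact (hmono _ (by rw [Fin.le_def, Fin.val_castSucc]; lia)
        (by rw [Fin.le_def, Fin.val_castSucc]; lia)).1.symm
    · obtain rfl : i = l'.succ := Fin.ext hi
      refine hpi' (eq_of_nonDegenerate hx (Fin.ext (h₂.trans hl'.2.1.symm)) ?_)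
      exact (hmono _ (by rw [Fin.le_def, Fin.val_succ]; lia)
        (by rw [Fin.le_def, Fin.val_succ]; lia)).2.symm

end StepPairing

end MBSSet

namespace MBSSet

/-! ### Decorations generated by those over a horn -/

/-- Decorations outside the subcomplex are invisible in `Sub.toMB`, so they need not be compared. -/
theorem subExtends_of_sat_inter_le {Z : SSet.{u}} {W : MorphismProperty MBSSet.{u}}
    [W.IsStableUnderCobaseChange] [W.ContainsIdentities] {p q : Sub Z} (hpq : p ≤ q)
    (h₁ : q.1 ≤ p.1) (h₂ : ∀ k, ∀ z ∈ q.1.obj _, z ∈ q.2.sat k → z ∈ p.2.sat k) :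
    SubExtends W p q :=
  have : Mono (Hom.hom (𝟙 p.toMB)) := inferInstanceAs (Mono (𝟙 p.1.toSSet))
  subExtends_of_attach (𝟙 p.toMB) (W.id_mem _) hpq p.1.ι
    (fun n g => Sub.fst_le hpq n g.2) (fun _ k => k.2) (fun n _ hz => Or.inl (h₁ n hz))
    (fun _ g _ => ⟨g, rfl⟩) (fun _ g _ _ => Or.inl ⟨g, rfl⟩)
    (fun k e he => (p.mem_toMB_deco k e).1 he)
    (fun k e he => DecoSet.sat_mono (Sub.snd_le hpq) k ((p.mem_toMB_deco k e).1 he))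
    (fun k z hz hz' => Or.inr (Or.inl ⟨h₁ _ hz, h₂ k z hz hz'⟩))

/-- A decorated simplex which belongs to the source of the pushout-product of two inclusions
with induced decorations is decorated in the source. -/
theorem mem_ppSub_sat {Y B : MBSSet.{u}} {X A : SSet.{u}} (i : X ⟶ Y.toSSet) (j : A ⟶ B.toSSet)
    (k : Kind) (z : (prod Y B).toSSet _⦋k.dim⦌) (hz : z ∈ (prod Y B).deco k)
    (hz' : z ∈ (ppSub (inducedHom Y i) (inducedHom B j)).1.obj _) :
    z ∈ (ppSub (inducedHom Y i) (inducedHom B j)).2.sat k := by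
  rw [mem_prod_deco] at hz
  refine DecoSet.subset_sat _ _ ?_
  rcases hz' with ⟨⟨x, b⟩, rfl⟩ | ⟨⟨y, a⟩, rfl⟩
  · exact Or.inl ⟨(x, b), (mem_prod_deco (X := induced Y i) (Y := B) k _).2 
      ⟨(mem_induced_deco Y i k x).2 hz.1, hz.2⟩, rfl⟩
  · exact Or.inr ⟨(y, a), (mem_prod_deco (X := Y) (Y := induced B j) k _).2 
      ⟨hz.1, (mem_induced_deco B j k a).2 hz.2⟩, rfl⟩

/-- A family of decorations on `Y × B`, where `Y` is a quotient of `Δ[n + 1]`, contains all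
decorated simplices over the subcomplex `X`, and the decorated simplices which are degenerate
over `B` along an edge of `Δ[n + 1]` from `a` to `a + 1`. -/
structure Generates {Y B : MBSSet.{u}} {n : ℕ} (π : (Δ[n] : SSet.{u}) ⟶ Y.toSSet)
    (X : Y.toSSet.Subcomplex) (a ε : ℕ) (M : DecoSet (prod Y B).toSSet) : Prop where
  mem : ∀ k, ∀ y ∈ X.obj _, ∀ b, pair y b ∈ (prod Y B).decoSet k → pair y b ∈ M k
  marked : ∀ w : (Δ[n] : SSet.{u}) _⦋1⦌, (w 0 : ℕ) = a → (w 1 : ℕ) = a + 1 →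
    ∀ b : B.toSSet _⦋0⦌, pair (π.app _ w) (B.toSSet.σ 0 b) ∈ (prod Y B).decoSet .marked →
      pair (π.app _ w) (B.toSSet.σ 0 b) ∈ M .marked
  thin : ∀ (w : (Δ[n] : SSet.{u}) _⦋2⦌) (l : Fin 2), (w l.castSucc : ℕ) = a →
    (w l.succ : ℕ) = a + 1 → (l : ℕ) + ε = 1 →
    ∀ b : B.toSSet _⦋1⦌, pair (π.app _ w) (B.toSSet.σ l b) ∈ (prod Y B).decoSet .thin →
      pair (π.app _ w) (B.toSSet.σ l b) ∈ M .thin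
  lean : ∀ (w : (Δ[n] : SSet.{u}) _⦋2⦌) (l : Fin 2), (w l.castSucc : ℕ) = a →
    (w l.succ : ℕ) = a + 1 →
    ∀ b : B.toSSet _⦋1⦌, pair (π.app _ w) (B.toSSet.σ l b) ∈ (prod Y B).decoSet .lean →
      pair (π.app _ w) (B.toSSet.σ l b) ∈ M .lean

/-- Reduction of pushout-products with monomorphisms to pushout-products with boundary
inclusions. -/
theorem pushoutProduct_mem_of_boundary {Y B A : MBSSet.{u}} {X : SSet.{u}} (i : X ⟶ Y.toSSet)
    [Mono i] {n : ℕ} (π : (Δ[n] : SSet.{u}) ⟶ Y.toSSet) (a ε : ℕ)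
    (h₁ : ∀ m, mbAnodyne (pushoutProduct (inducedHom Y i)
      (inducedHom (flat Δ[m]) (SSet.boundary m).ι)))
    (h₂ : ∀ M : DecoSet (prod Y B).toSSet, IsClosed mbAnodyne (prod Y B).decoSet M →
      M ≤ (prod Y B).decoSet → Generates π (SSet.Subcomplex.range i) a ε M →
      (prod Y B).decoSet ≤ M) (g : A ⟶ B) [Mono g.hom] :
    mbAnodyne (pushoutProduct (inducedHom Y i) g) := by
  -- Saturation in the second variable splits `g` into undecorated cells, covered by `h₁`, and a
  -- change of decorations on `B`.
  refine mem_of_boundary (W := pushoutProductRight mbAnodyne (inducedHom Y i)) h₁ g ?_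
  rw [← mem_toHom_iff (W := pushoutProductRight mbAnodyne (inducedHom Y i))
    (DecoSet.toSub (image g).2) (image_snd_le g)]
  let g' := (DecoSet.toSub (image g).2).toHom (image_snd_le g)
  have : Mono (Hom.hom (inducedHom Y i)) := inferInstanceAs (Mono i)
  have : Mono (Hom.hom g') := inferInstanceAs (Mono (⊤ : B.toSSet.Subcomplex).ι)
  change mbAnodyne (pushoutProduct (inducedHom Y i) g')
  rw [pushoutProduct_mem_iff_subExtends (W := mbAnodyne)]
  have htop : (ppSub (inducedHom Y i) g').1 = ⊤ :=
    top_le_iff.1 fun n ⟨y, b⟩ _ => Or.inr ⟨(y, ⟨b, trivial⟩), rfl⟩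
  have hp : ppSub (inducedHom Y i) g' = DecoSet.toSub (ppSub (inducedHom Y i) g').2 :=
    Prod.ext htop rfl
  rw [hp]
  refine subExtends_of_isClosed (ppSub_snd_le _ _) (degenerate_subset_deco _) (thin_subset_lean' _)
    fun M hDM hMT hM => h₂ M hM hMT ?_
  -- Degenerate simplices of `B` are decorated before the change as well; this covers the last three
  -- fields of `Generates`.
  have hdeg {k : Kind} {y : Y.toSSet _⦋k.dim⦌} {b : B.toSSet _⦋k.dim⦌}
      (hb : b ∈ B.toSSet.degenerate k.dim) (h : pair y b ∈ (prod Y B).decoSet k) :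
      pair y b ∈ M k :=
    hDM k (Or.inr ⟨(y, ⟨b, trivial⟩), (mem_prod_deco (X := Y) k _).2
      ⟨((mem_prod_deco (X := Y) (Y := B) k _).1 h).1,
        (Sub.mem_toMB_deco _ k _).2 (DecoSet.degenerate_subset_sat _ k hb)⟩, rfl⟩)
  refine ⟨?_, fun w _ _ b => hdeg (k := .marked) (σ_mem_deg _ _),
    fun w l _ _ _ b => hdeg (k := .thin) (σ_mem_deg _ _),
    fun w l _ _ b => hdeg (k := .lean) (σ_mem_deg _ _)⟩
  rintro k _ ⟨x, rfl⟩ b h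
  have h' := (mem_prod_deco (X := Y) (Y := B) k _).1 h
  exact hDM k (Or.inl ⟨(x, b), (mem_prod_deco (X := induced Y i) (Y := B) k _).2
    ⟨(mem_induced_deco Y i k x).2 h'.1, h'.2⟩, rfl⟩)

end MBSSet

namespace MBSSet

/-! ### Pushout-products with boundary inclusions -/

section

variable {Y : MBSSet.{u}} {N m : ℕ} (π : (Δ[N] : SSet.{u}) ⟶ Y.toSSet)

/-- A simplex of `Δ[N] ⊗ Δ[m]`, as a simplex of the product of a quotient of `Δ[N]`
with `Δ[m]`. -/
abbrev quot {d : ℕ} (x : (Δ[N] ⊗ Δ[m] : SSet.{u}) _⦋d⦌) : (prod Y (flat Δ[m])).toSSet _⦋d⦌ :=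
  (π ▷ (Δ[m] : SSet.{u})).app _ x

/-- A family of decorations contains all decorated simplices with an edge from `(a, t)` to
`(a + 1, t)`, with a restriction for thin triangles. -/
structure StepDeco (a ε : ℕ) (D : DecoSet (prod Y (flat Δ[m])).toSSet) : Prop where
  marked : ∀ x : (Δ[N] ⊗ Δ[m] : SSet.{u}) _⦋1⦌, HasStep a x 0 →
    quot π x ∈ (prod Y (flat Δ[m])).decoSet .marked → quot π x ∈ D .marked
  thin : ∀ (x : (Δ[N] ⊗ Δ[m] : SSet.{u}) _⦋2⦌) (l : Fin 2), HasStep a x l → (l : ℕ) + ε = 1 →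
    quot π x ∈ (prod Y (flat Δ[m])).decoSet .thin → quot π x ∈ D .thin
  lean : ∀ (x : (Δ[N] ⊗ Δ[m] : SSet.{u}) _⦋2⦌) (l : Fin 2), HasStep a x l →
    quot π x ∈ (prod Y (flat Δ[m])).decoSet .lean → quot π x ∈ D .lean

variable {X : SSet.{u}} (i : X ⟶ Y.toSSet)

theorem ppSub_fst_boundary {A : Δ[N].Subcomplex} (hπ : ∀ n, Function.Surjective (π.app n))
    (hr : SSet.Subcomplex.range i = A.image π) :
    (ppSub (inducedHom Y i) (inducedHom (flat Δ[m]) (SSet.boundary m).ι)).1 =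
      (A.unionProd (SSet.boundary m)).image (π ▷ (Δ[m] : SSet.{u})) := by
  apply le_antisymm
  · rintro n _ (⟨⟨x, b⟩, rfl⟩ | ⟨⟨y, b⟩, rfl⟩)
    · have hx : i.app _ x ∈ (A.image π).obj _ := Set.mem_of_eq_of_mem (s := (A.image π).obj n) rfl
        (hr ▸ ⟨x, rfl⟩)
      obtain ⟨w, hw, e⟩ := hx
      exact ⟨(w, b), (SSet.Subcomplex.mem_unionProd_iff (X := Δ[N]) (Y := Δ[m]) _ _ (w, b)).2
        (Or.inr hw), Prod.ext e rfl⟩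
    · obtain ⟨w, rfl⟩ := hπ _ y
      exact ⟨(w, b.1), (SSet.Subcomplex.mem_unionProd_iff (X := Δ[N]) (Y := Δ[m]) _ _ (w, b.1)).2
        (Or.inl b.2), rfl⟩
  · rintro n _ ⟨⟨w, b⟩, hw, rfl⟩
    rcases (SSet.Subcomplex.mem_unionProd_iff (X := Δ[N]) (Y := Δ[m]) _ _ (w, b)).1 hw with hb | hw
    · exact Or.inr ⟨(π.app _ w, ⟨b, hb⟩), rfl⟩
    · have : π.app _ w ∈ (SSet.Subcomplex.range i).obj _ := by
        rw [hr]
        exact ⟨w, hw, rfl⟩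
      obtain ⟨x, hx⟩ := this
      exact Or.inl ⟨(x, b), Prod.ext hx rfl⟩

end

theorem mk_app_eq_of_mk_eq {Z' Z : SSet.{u}} (q : Z' ⟶ Z) {n m : ℕ} {x : Z' _⦋n⦌} {y : Z' _⦋m⦌}
    (h : SSet.S.mk x = SSet.S.mk y) : SSet.S.mk (q.app _ x) = SSet.S.mk (q.app _ y) := by
  obtain rfl := dim_eq_of_mk_eq h
  rw [SSet.S.ext_iff'] at h
  obtain ⟨_, h⟩ := h
  exact congrArg (fun y => SSet.S.mk (q.app _ y)) h

/-- Three inclusions are composed. The first is an isomorphism, as the auxiliary decorations `D`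
agree with the given ones on the source. The second attaches all pairs of the pairing with `D`
fixed, by `hA`. The third adds the decorations which are missing in `D`, by closure and `hM`. -/
theorem pushoutProduct_boundary {Y : MBSSet.{u}} {X : SSet.{u}} (i : X ⟶ Y.toSSet) [Mono i]
    {N m : ℕ} {k : Fin (N + 2)} {a ε : ℕ} (P : StepPairing.{u} N m k a ε)
    (π : (Δ[N + 1] : SSet.{u}) ⟶ Y.toSSet) (hπ : ∀ n, Function.Surjective (π.app n))
    (hr : SSet.Subcomplex.range i = (SSet.horn (N + 1) k).image π)
    (hinj : ∀ n (z z' : (Δ[N + 1] : SSet.{u}) _⦋n⦌), z ∉ (SSet.horn (N + 1) k).obj _ →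
      π.app _ z = π.app _ z' → z = z')
    (hA : ∀ {d : ℕ} (x : (Δ[N + 1] ⊗ Δ[m] : SSet.{u}) _⦋d + 1⦌),
      x ∉ (SSet.Subcomplex.unionProd (SSet.horn (N + 1) k) (SSet.boundary m)).obj _ →
      ∀ l, HasStep a x l → ∀ j : Fin (d + 2), (j : ℕ) = l + ε → ∀ D S, StepDeco π a ε D →
      HornData S D (quot π x) j → SubExtends mbAnodyne (Sub.mk S D)
        (Sub.mk (S ⊔ SSet.Subcomplex.ofSimplex (quot π x)) D))
    (hM : ∀ M : DecoSet (prod Y (flat Δ[m])).toSSet,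
      IsClosed mbAnodyne (prod Y (flat Δ[m])).decoSet M →
      M ≤ (prod Y (flat Δ[m])).decoSet → Generates π (SSet.Subcomplex.range i) a ε M →
      (prod Y (flat Δ[m])).decoSet ≤ M) :
    mbAnodyne (pushoutProduct (inducedHom Y i)
      (inducedHom (flat Δ[m]) (SSet.boundary m).ι)) := by
  have : Mono (Hom.hom (inducedHom Y i)) := inferInstanceAs (Mono i)
  have : Mono (Hom.hom (inducedHom (flat Δ[m]) (SSet.boundary m).ι)) :=
    inferInstanceAs (Mono (SSet.boundary m).ι)
  rw [pushoutProduct_mem_iff_subExtends (W := mbAnodyne)]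
  let q := π ▷ (Δ[m] : SSet.{u})
  let U := SSet.Subcomplex.unionProd (SSet.horn.{u} (N + 1) k) (SSet.boundary.{u} m)
  have hU : (ppSub (inducedHom Y i) (inducedHom (flat Δ[m]) (SSet.boundary m).ι)).1 =
    U.image q := ppSub_fst_boundary π i hπ hr
  let T := (prod Y (flat Δ[m])).decoSet
  -- Among the two new simplices of a pair only the larger one may be decorated, since no generating
  -- horn of dimension at least two decorates the omitted face. A thin attached triangle requires an
  -- inner horn, hence the index 1.
  let D : DecoSet (prod Y (flat Δ[m])).toSSet := fun κ => {z | z ∈ T κ ∧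
    (z ∈ (prod Y (flat Δ[m])).toSSet.degenerate κ.dim ∨ z ∈ (U.image q).obj _ ∨
      ∃ s : P.core.ι, SSet.S.mk z = SSet.S.mk (q.app _ (P.core.simplex s)) ∧
        (κ = .thin → (P.core.index s : ℕ) = 1))}
  have hDT : D ≤ T := fun κ z hz => hz.1
  have hDsat (κ : Kind) : D.sat κ ⊆ {z | z ∈ T κ ∧
      (z ∈ (prod Y (flat Δ[m])).toSSet.degenerate κ.dim ∨ z ∈ (U.image q).obj _ ∨
      ∃ s : P.core.ι, SSet.S.mk z = SSet.S.mk (q.app _ (P.core.simplex s)) ∧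
        (κ = .thin → (P.core.index s : ℕ) = 1))} := by
    refine DecoSet.sat_subset (T := D) (fun κ z hz => ⟨degenerate_subset_deco _ κ hz, Or.inl hz⟩)
      (fun z hz => ⟨thin_subset_lean' _ hz.1, hz.2.imp_right fun h => h.imp_right
        fun ⟨s, hs, _⟩ => ⟨s, hs, fun h => by cases h⟩⟩) le_rfl κ
  have hstep {d : ℕ} (x : (Δ[N + 1] ⊗ Δ[m] : SSet.{u}) _⦋d + 1⦌) (l) (hl : HasStep a x l) :
      quot π x ∈ (prod Y (flat Δ[m])).toSSet.degenerate (d + 1) ∨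
      quot π x ∈ (U.image q).obj _ ∨
      ∃ s : P.core.ι, SSet.S.mk (quot π x) = SSet.S.mk (q.app _ (P.core.simplex s)) ∧
        (P.core.index s : ℕ) = l + ε := by
    by_cases hx : x ∈ (Δ[N + 1] ⊗ Δ[m] : SSet.{u}).degenerate (d + 1)
    · exact Or.inl (SSet.app_mem_degenerate q hx)
    by_cases hx' : x ∈ U.obj _
    · exact Or.inr (Or.inl ⟨x, hx', rfl⟩)
    · obtain ⟨s, hs, hi⟩ := P.exists_cell hx hx' hl
      exact Or.inr (Or.inr ⟨s, mk_app_eq_of_mk_eq q hs, hi⟩)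
  have hD : StepDeco π a ε D := by
    refine ⟨fun x hx hxT => ⟨hxT, (hstep x 0 hx).imp_right fun h => h.imp_right
      fun ⟨s, hs, _⟩ => ⟨s, hs, fun h => by cases h⟩⟩,
      fun x l hx hl hxT => ⟨hxT, (hstep x l hx).imp_right fun h => h.imp_right
      fun ⟨s, hs, h⟩ => ⟨s, hs, fun _ => h.trans hl⟩⟩,
      fun x l hx hxT => ⟨hxT, (hstep x l hx).imp_right fun h => h.imp_right
      fun ⟨s, hs, _⟩ => ⟨s, hs, fun h => by cases h⟩⟩⟩
  have h₁ : SubExtends mbAnodyne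
      (ppSub (inducedHom Y i) (inducedHom (flat Δ[m]) (SSet.boundary m).ι))
      (Sub.mk (U.image q) D) := by
    refine subExtends_of_sat_inter_le ⟨hU.le, sup_le ?_ ?_⟩ hU.ge fun κ z hz hzD =>
      mem_ppSub_sat i _ κ z (hDsat κ hzD).1 ?_
    · rintro κ _ ⟨z, hz, rfl⟩
      refine ⟨image_snd_le _ _ ⟨z, hz, rfl⟩, Or.inr (Or.inl ?_)⟩
      rw [← hU]
      exact Or.inl ⟨z, rfl⟩
    · rintro κ _ ⟨z, hz, rfl⟩
      refine ⟨image_snd_le _ _ ⟨z, hz, rfl⟩, Or.inr (Or.inl ?_)⟩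
      rw [← hU]
      exact Or.inr ⟨z, rfl⟩
    · rw [hU]
      exact hz
  have h₂ : SubExtends mbAnodyne (Sub.mk (U.image q) D) D.toSub := by
    have := P.isRegular
    refine subExtends_of_pairingCore (Z' := Δ[N + 1] ⊗ Δ[m]) q P.core ?_ ?_ D
      (fun κ z hz => (hDsat κ hz).2) fun s S _ hS => ?_
    · rintro n ⟨y, b⟩
      obtain ⟨w, rfl⟩ := hπ n y
      exact ⟨(w, b), rfl⟩
    · rintro n ⟨w, b⟩ ⟨w', b'⟩ hz h
      have hb : b = b' := congrArg Prod.snd h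
      refine Prod.ext (hinj _ _ _ (fun hw => hz ?_) (congrArg Prod.fst h)) hb
      exact (SSet.Subcomplex.mem_unionProd_iff (X := Δ[N + 1]) (Y := Δ[m]) _ _ (w, b)).2
        (Or.inr hw)
    · obtain ⟨l, hl, hj⟩ := P.step s
      exact hA _ (P.core.notMem₁ s) l hl _ hj D S hD hS
  have h₃ : SubExtends mbAnodyne D.toSub T.toSub := by
    refine subExtends_of_isClosed hDT (degenerate_subset_deco _) (thin_subset_lean' _)
      fun M hDM hMT hM' => hM M hM' hMT ⟨?_, ?_, ?_, ?_⟩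
    · intro κ y hy b h
      refine hDM κ ⟨h, Or.inr (Or.inl ?_)⟩
      rw [← hU]
      obtain ⟨x, rfl⟩ := hy
      exact Or.inl ⟨(x, b), rfl⟩
    · intro w h h' b hT
      exact hDM .marked (hD.marked (w, (Δ[m] : SSet.{u}).σ 0 b) ⟨h, h', rfl⟩ hT)
    · intro w l h h' hl (b : (Δ[m] : SSet.{u}) _⦋1⦌) hT
      refine hDM .thin (hD.thin (w, (Δ[m] : SSet.{u}).σ l b) l ⟨h, h', ?_⟩ hl hT)
      change b (l.predAbove l.succ) = b (l.predAbove l.castSucc)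
      rw [Fin.predAbove_succ_self, Fin.predAbove_castSucc_self]
    · intro w l h h' (b : (Δ[m] : SSet.{u}) _⦋1⦌) hT
      refine hDM .lean (hD.lean (w, (Δ[m] : SSet.{u}).σ l b) l ⟨h, h', ?_⟩ hT)
      change b (l.predAbove l.succ) = b (l.predAbove l.castSucc)
      rw [Fin.predAbove_succ_self, Fin.predAbove_castSucc_self]
  exact h₁.trans (h₂.trans h₃)

end MBSSet

namespace MBSSet

/-! ### Attaching the simplices of a step pairing -/

theorem mem_degenerate_of_eq {n d : ℕ} (w : (Δ[n] : SSet.{u}) _⦋d + 1⦌) (l : Fin (d + 1))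
    (h : w l.succ = w l.castSucc) : w ∈ (Δ[n] : SSet.{u}).degenerate (d + 1) := by
  by_contra hw
  exact (((SSet.stdSimplex.mem_nonDegenerate_iff_strictMono w).1 hw)
    (Fin.castSucc_lt_succ (i := l))).ne' h

section

variable {Y : MBSSet.{u}} {N m d a ε : ℕ} (π : (Δ[N + 1] : SSet.{u}) ⟶ Y.toSSet)

theorem yonedaEquiv_symm_quot_app {e : ℕ} (x : (Δ[N + 1] ⊗ Δ[m] : SSet.{u}) _⦋d⦌)
    (t : (Δ[d] : SSet.{u}) _⦋e⦌) :
    (SSet.yonedaEquiv.symm (quot π x)).app _ t = quot π ((Δ[N + 1] ⊗ Δ[m] : SSet.{u}).map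
      (SSet.stdSimplex.objEquiv t).op x) :=
  (NatTrans.naturality_apply (π ▷ (Δ[m] : SSet.{u})) (SSet.stdSimplex.objEquiv t).op x).symm

theorem quot_mem (k : Kind) (z : (Δ[N + 1] ⊗ Δ[m] : SSet.{u}) _⦋k.dim⦌)
    (hz : π.app _ z.1 ∈ Y.deco k) (hz' : z.2 ∈ (Δ[m] : SSet.{u}).degenerate k.dim) :
    quot π z ∈ (prod Y (flat Δ[m])).decoSet k := by
  refine pair_mem (Y := Y) (B := flat Δ[m]) hz ?_
  rw [flat_deco]
  exact hz'

variable {x : (Δ[N + 1] ⊗ Δ[m] : SSet.{u}) _⦋d + 1⦌} {l : Fin (d + 1)} (hl : HasStep a x l) {D : DecoSet (prod Y (flat Δ[m])).toSSet}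
  (hD : StepDeco π a ε D)

include hl hD

/-- An edge or triangle containing the step is degenerate over `Δ[m]`, hence decorated there, so
only the component in `Y` matters. The same reason applies to thin and lean triangles below. -/
theorem yonedaEquiv_symm_quot_app_mem_marked (t : (Δ[d + 1] : SSet.{u}) _⦋1⦌)
    (h₀ : t 0 = l.castSucc) (h₁ : t 1 = l.succ)
    (h : ∀ w ∈ dEdge (N + 1) a (a + 1), π.app _ w ∈ Y.marked) :
    (SSet.yonedaEquiv.symm (quot π x)).app _ t ∈ D .marked := by
  rw [yonedaEquiv_symm_quot_app]
  have hs : HasStep a ((Δ[N + 1] ⊗ Δ[m] : SSet.{u}).map (SSet.stdSimplex.objEquiv t).op x) 0 :=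
    ⟨(congrArg (fun i => (x.1 i : ℕ)) h₀).trans hl.1,
      (congrArg (fun i => (x.1 i : ℕ)) h₁).trans hl.2.1,
      (congrArg (fun i => x.2 i) h₁).trans (hl.2.2.trans (congrArg (fun i => x.2 i) h₀).symm)⟩
  exact hD.marked _ hs (quot_mem π .marked _ (h _ ⟨hs.1, hs.2.1⟩)
    (mem_degenerate_of_eq _ 0 hs.2.2))

theorem yonedaEquiv_symm_quot_app_mem_thin (t : (Δ[d + 1] : SSet.{u}) _⦋2⦌) (l' : Fin 2)
    (h₀ : t l'.castSucc = l.castSucc) (h₁ : t l'.succ = l.succ) (hl' : (l' : ℕ) + ε = 1)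
    (h : ∀ w : (Δ[N + 1] : SSet.{u}) _⦋2⦌, (∀ i, w i = x.1 (t i)) → π.app _ w ∈ Y.thin) :
    (SSet.yonedaEquiv.symm (quot π x)).app _ t ∈ D .thin := by
  rw [yonedaEquiv_symm_quot_app]
  have hs : HasStep a ((Δ[N + 1] ⊗ Δ[m] : SSet.{u}).map (SSet.stdSimplex.objEquiv t).op x) l' :=
    ⟨(congrArg (fun i => (x.1 i : ℕ)) h₀).trans hl.1,
      (congrArg (fun i => (x.1 i : ℕ)) h₁).trans hl.2.1,
      (congrArg (fun i => x.2 i) h₁).trans (hl.2.2.trans (congrArg (fun i => x.2 i) h₀).symm)⟩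
  exact hD.thin _ l' hs hl' (quot_mem π .thin _ (h _ fun i => rfl)
    (mem_degenerate_of_eq _ l' hs.2.2))

theorem yonedaEquiv_symm_quot_app_mem_lean (t : (Δ[d + 1] : SSet.{u}) _⦋2⦌) (l' : Fin 2)
    (h₀ : t l'.castSucc = l.castSucc) (h₁ : t l'.succ = l.succ)
    (h : ∀ w : (Δ[N + 1] : SSet.{u}) _⦋2⦌, (∀ i, w i = x.1 (t i)) → π.app _ w ∈ Y.lean) :
    (SSet.yonedaEquiv.symm (quot π x)).app _ t ∈ D .lean := by
  rw [yonedaEquiv_symm_quot_app]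
  have hs : HasStep a ((Δ[N + 1] ⊗ Δ[m] : SSet.{u}).map (SSet.stdSimplex.objEquiv t).op x) l' :=
    ⟨(congrArg (fun i => (x.1 i : ℕ)) h₀).trans hl.1,
      (congrArg (fun i => (x.1 i : ℕ)) h₁).trans hl.2.1,
      (congrArg (fun i => x.2 i) h₁).trans (hl.2.2.trans (congrArg (fun i => x.2 i) h₀).symm)⟩
  exact hD.lean _ l' hs (quot_mem π .lean _ (h _ fun i => rfl)
    (mem_degenerate_of_eq _ l' hs.2.2))

omit hl hD

variable {k : Fin (N + 2)}

theorem exists_fst_eq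
    (hx : x ∉ (SSet.Subcomplex.unionProd (SSet.horn (N + 1) k) (SSet.boundary m)).obj _)
    (i : Fin (N + 2)) (hi : i ≠ k) : ∃ j, x.1 j = i := by
  rw [mem_unionProd_horn_boundary_iff, not_not] at hx
  exact hx.1 i hi

variable {S : (prod Y (flat Δ[m])).toSSet.Subcomplex}

/-- The case of an edge from `(a, t)` to `(a + 1, t)` which is not the first one, the face
opposite to its initial vertex being omitted. -/
theorem subExtends_step_of_pos
    (hx : x ∉ (SSet.Subcomplex.unionProd (SSet.horn (N + 1) k) (SSet.boundary m)).obj _)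
    (hl : HasStep a x l) (hD : StepDeco π a 0 D) (hk : (k : ℕ) = a)
    (hl0 : 0 < (l : ℕ)) (hY : 0 < a → ∀ w ∈ dTri (N + 1) (a - 1) a (a + 1), π.app _ w ∈ Y.thin)
    (h : HornData S D (quot π x) l.castSucc) : SubExtends mbAnodyne (Sub.mk S D)
      (Sub.mk (S ⊔ SSet.Subcomplex.ofSimplex (quot π x)) D) := by
  refine subExtends_innerHorn h (by rw [Fin.lt_def]; exact hl0) (Fin.castSucc_lt_last l) ?_
  rintro t ⟨h₀, h₁, h₂⟩
  refine DecoSet.subset_sat _ .thin (yonedaEquiv_symm_quot_app_mem_thin π hl hD t 1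
    (Fin.ext h₁) (Fin.ext h₂) rfl fun w hw => ?_)
  have hw1 : (w 1 : ℕ) = a := by
    rw [hw]
    exact (congrArg (fun i => (x.1 i : ℕ)) (Fin.ext h₁)).trans hl.1
  have hw2 : (w 2 : ℕ) = a + 1 := by
    rw [hw]
    exact (congrArg (fun i => (x.1 i : ℕ)) (Fin.ext h₂)).trans hl.2.1
  have hw01 : (w 0 : ℕ) ≤ w 1 := SSet.stdSimplex.monotone_apply w (Fin.zero_le _)
  -- The triangle has the vertices `l - 1`, `l`, `l + 1` of `x`. Over `Δ[N + 1]` it is degenerate or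
  -- begins at `a - 1`, because outside the source every vertex other than `k = a` is attained.
  by_cases hwa : (w 0 : ℕ) = a
  · refine Y.degenerate_subset_thin (SSet.app_mem_degenerate π (mem_degenerate_of_eq w 0 ?_))
    exact Fin.ext (hw1.trans hwa.symm)
  · refine hY (by lia) w ⟨?_, hw1, hw2⟩
    obtain ⟨j, hj⟩ := exists_fst_eq hx ⟨a - 1, by lia⟩ (fun h => by
      have := congrArg Fin.val h
      simp only at this
      lia)
    have hjl : j < l.castSucc := by
      by_contra! hjl
      have : (x.1 l.castSucc : ℕ) ≤ x.1 j := SSet.stdSimplex.monotone_apply x.1 hjl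
      rw [hj, hl.1] at this
      simp only at this
      lia
    have : (x.1 j : ℕ) ≤ x.1 (t 0) := SSet.stdSimplex.monotone_apply x.1 (by
      rw [Fin.le_def, h₀]
      rw [Fin.lt_def, Fin.val_castSucc] at hjl
      rw [Fin.val_castSucc]
      lia)
    rw [hj, ← hw] at this
    simp only at this
    lia

/-- The case of an edge from `(N, t)` to `(N + 1, t)` which is not the last one, the face
opposite to its final vertex being omitted. -/
theorem subExtends_step_of_lt (hl : HasStep N x l) (hD : StepDeco π N 1 D)
    (hld : (l : ℕ) < d) (h : HornData S D (quot π x) l.succ) : SubExtends mbAnodyne (Sub.mk S D)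
      (Sub.mk (S ⊔ SSet.Subcomplex.ofSimplex (quot π x)) D) := by
  refine subExtends_innerHorn h (Fin.succ_pos l) (by
    rw [Fin.lt_def, Fin.val_succ, Fin.val_last]; lia) ?_
  rintro t ⟨h₀, h₁, h₂⟩
  have h₀' : t 0 = l.castSucc := Fin.ext (by rw [h₀, Fin.val_succ, Fin.val_castSucc]; lia)
  refine DecoSet.subset_sat _ .thin (yonedaEquiv_symm_quot_app_mem_thin π hl hD t 0
    h₀' (Fin.ext h₁) rfl fun w hw => ?_)
  -- After the step the first coordinate is maximal, so the triangle on `l`, `l + 1`, `l + 2` is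
  -- degenerate over `Y`.
  refine Y.degenerate_subset_thin (SSet.app_mem_degenerate π (mem_degenerate_of_eq w 1 ?_))
  have hw1 : (w 1 : ℕ) = N + 1 := by
    rw [hw]
    exact (congrArg (fun i => (x.1 i : ℕ)) (Fin.ext h₁)).trans hl.2.1
  have hw12 : (w 1 : ℕ) ≤ w 2 := SSet.stdSimplex.monotone_apply w (by decide)
  apply Fin.ext
  change (w 2 : ℕ) = w 1
  have := (w 2).isLt
  lia

/-- The case of a first edge from `(0, t)` to `(1, t)`, the face opposite to its initial vertex
being omitted. -/
theorem subExtends_step_of_zero {y₀ : Y.toSSet _⦋0⦌} (hN : 0 < N)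
    (hx : x ∉ (SSet.Subcomplex.unionProd (SSet.horn (N + 1) k) (SSet.boundary m)).obj _)
    (hl : HasStep 0 x l) (hD : StepDeco π 0 0 D) (hk : (k : ℕ) = 0) (hl0 : (l : ℕ) = 0)
    (he : ∀ w ∈ dEdge (N + 1) 0 1, π.app _ w = Y.toSSet.σ 0 y₀)
    (hY : ∀ w ∈ dTri (N + 1) 0 1 (N + 1), π.app _ w ∈ Y.lean)
    (h : HornData S D (quot π x) l.castSucc) : SubExtends mbAnodyne (Sub.mk S D)
      (Sub.mk (S ⊔ SSet.Subcomplex.ofSimplex (quot π x)) D) := by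
  obtain ⟨j, hj⟩ := exists_fst_eq hx (Fin.last (N + 1)) (fun h => by
    have := congrArg Fin.val h
    rw [Fin.val_last] at this
    lia)
  have hlast : (x.1 (Fin.last (d + 1)) : ℕ) = N + 1 := by
    have h' : (x.1 j : ℕ) ≤ x.1 (Fin.last (d + 1)) :=
      SSet.stdSimplex.monotone_apply x.1 (Fin.le_last j)
    have := (x.1 (Fin.last (d + 1))).isLt
    rw [hj, Fin.val_last] at h'
    lia
  -- As `0 < N`, the vertex `N + 1` is not reached by the step from 0 to 1 alone.
  have hd : d ≠ 0 := by
    rintro rfl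
    have h₁ := hl.2.1
    have : l.succ = Fin.last 1 := Fin.ext (by rw [Fin.val_succ, Fin.val_last, hl0])
    rw [this] at h₁
    lia
  obtain ⟨d, rfl⟩ := Nat.exists_eq_succ_of_ne_zero hd
  obtain rfl : l = 0 := Fin.ext hl0
  -- The first edge is degenerate in `Y` and constant over `Δ[m]`, so it is the degeneracy of the
  -- vertex given here.
  refine subExtends_leftHorn h ((y₀, SSet.stdSimplex.objEquiv.symm
    (SimplexCategory.const _ _ (x.2 0))) : (prod Y (flat Δ[m])).toSSet _⦋0⦌) ?_ ?_
  · rw [yonedaEquiv_symm_quot_app]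
    refine Prod.ext (he _ ⟨hl.1, hl.2.1⟩) (SSet.stdSimplex.ext _ _ fun i => ?_)
    fin_cases i
    · rfl
    · exact hl.2.2
  · rintro t ⟨h₀, h₁, h₂⟩
    refine DecoSet.subset_sat _ .lean (yonedaEquiv_symm_quot_app_mem_lean π hl hD t 0
      (Fin.ext h₀) (Fin.ext h₁) fun w hw => hY w ⟨?_, ?_, ?_⟩)
    · rw [hw]
      exact (congrArg (fun i => (x.1 i : ℕ)) (Fin.ext h₀)).trans hl.1
    · rw [hw]
      exact (congrArg (fun i => (x.1 i : ℕ)) (Fin.ext h₁)).trans hl.2.1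
    · rw [hw]
      exact (congrArg (fun i => (x.1 i : ℕ)) (Fin.ext h₂)).trans hlast

/-- The case of a last edge from `(N, t)` to `(N + 1, t)`, the face opposite to its final vertex
being omitted. -/
theorem subExtends_step_of_eq
    (hx : x ∉ (SSet.Subcomplex.unionProd (SSet.horn (N + 1) k) (SSet.boundary m)).obj _)
    (hl : HasStep N x l) (hD : StepDeco π N 1 D) (hk : (k : ℕ) = N + 1) (hld : (l : ℕ) = d)
    (he : ∀ w ∈ dEdge (N + 1) N (N + 1), π.app _ w ∈ Y.marked)
    (hY : ∀ w ∈ dTri (N + 1) 0 N (N + 1), π.app _ w ∈ Y.lean)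
    (h : HornData S D (quot π x) l.succ) : SubExtends mbAnodyne (Sub.mk S D)
      (Sub.mk (S ⊔ SSet.Subcomplex.ofSimplex (quot π x)) D) := by
  obtain rfl : l = Fin.last d := Fin.ext hld
  -- If the step is the whole simplex, the horn is a single vertex and (A5) replaces (A4).
  obtain _ | d := d
  · refine subExtends_terminalVertex h (DecoSet.subset_sat _ .marked ?_)
    refine hD.marked x hl (quot_mem π .marked x (he _ ⟨hl.1, hl.2.1⟩)
      (mem_degenerate_of_eq _ 0 hl.2.2))
  · obtain ⟨j, hj⟩ := exists_fst_eq hx 0 (fun h => by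
      have := congrArg Fin.val h
      rw [Fin.val_zero] at this
      lia)
    have h0 : (x.1 0 : ℕ) = 0 := by
      have h' : (x.1 0 : ℕ) ≤ x.1 j := SSet.stdSimplex.monotone_apply x.1 (Fin.zero_le j)
      rw [hj, Fin.val_zero] at h'
      lia
    refine subExtends_outerHorn h (fun e ⟨h₀, h₁⟩ => DecoSet.subset_sat _ .marked
      (yonedaEquiv_symm_quot_app_mem_marked π hl hD e (Fin.ext h₀) (Fin.ext h₁) he)) ?_
    rintro t ⟨h₀, h₁, h₂⟩
    refine DecoSet.subset_sat _ .lean (yonedaEquiv_symm_quot_app_mem_lean π hl hD t 1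
      (Fin.ext h₁) (Fin.ext h₂) fun w hw => hY w ⟨?_, ?_, ?_⟩)
    · rw [hw]
      exact (congrArg (fun i => (x.1 i : ℕ)) (Fin.ext h₀)).trans h0
    · rw [hw]
      exact (congrArg (fun i => (x.1 i : ℕ)) (Fin.ext h₁)).trans hl.1
    · rw [hw]
      exact (congrArg (fun i => (x.1 i : ℕ)) (Fin.ext h₂)).trans hl.2.1

end

end MBSSet

namespace MBSSet

/-! ### Simplices of horns of dimension at least two -/

/-- The nondegenerate simplex of maximal dimension of `Δ[n]`. -/
abbrev top (n : ℕ) : (Δ[n] : SSet.{u}) _⦋n⦌ := SSet.stdSimplex.objEquiv.symm (𝟙 ⦋n⦌)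

theorem mem_horn_of_ne {n d : ℕ} {c : Fin (n + 1)} (w : (Δ[n] : SSet.{u}) _⦋d⦌) (j : Fin (n + 1))
    (hj : j ≠ c) (h : ∀ i, w i ≠ j) : w ∈ (SSet.horn n c).obj _ :=
  (SSet.mem_horn_iff_notMem_range w c).2 ⟨j, hj, fun ⟨i, hi⟩ => h i hi⟩

theorem mem_horn_of_mem_degenerate_one {n : ℕ} (c : Fin (n + 3))
    {w : (Δ[n + 2] : SSet.{u}) _⦋1⦌} (hw : w ∈ (Δ[n + 2] : SSet.{u}).degenerate 1) :
    w ∈ (SSet.horn (n + 2) c).obj _ := by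
  rw [SSet.degenerate_eq_iUnion_range_σ, Set.mem_iUnion] at hw
  obtain ⟨i, v, rfl⟩ := hw
  refine (SSet.horn (n + 2) c).map _ ?_
  rw [SSet.horn_obj_eq_univ c 0]
  trivial

theorem mem_horn_one {n : ℕ} (c : Fin (n + 4)) (w : (Δ[n + 3] : SSet.{u}) _⦋1⦌) :
    w ∈ (SSet.horn (n + 3) c).obj _ := by
  rw [SSet.horn_obj_eq_univ c 1]
  trivial

theorem mem_horn_of_mem_degenerate_two {n : ℕ} (c : Fin (n + 4))
    {w : (Δ[n + 3] : SSet.{u}) _⦋2⦌} (hw : w ∈ (Δ[n + 3] : SSet.{u}).degenerate 2) :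
    w ∈ (SSet.horn (n + 3) c).obj _ := by
  rw [SSet.degenerate_eq_iUnion_range_σ, Set.mem_iUnion] at hw
  obtain ⟨i, v, rfl⟩ := hw
  exact (SSet.horn (n + 3) c).map _ (mem_horn_one c v)

/-- A triangle through `c` has at most two other vertices, while at least three vertices differ from
`c`; one of them is missed. -/
theorem mem_horn_of_exists_eq {n : ℕ} (c : Fin (n + 4))
    (w : (Δ[n + 3] : SSet.{u}) _⦋2⦌) (h : ∃ i, w i = c) : w ∈ (SSet.horn (n + 3) c).obj _ := by
  have hcard : (Finset.univ.image fun i : Fin 3 => w i).card < Fintype.card (Fin (n + 4)) := by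
    refine Finset.card_image_le.trans_lt ?_
    simp
  obtain ⟨j, hj⟩ := Finset.exists_mem_notMem_of_card_lt_card (s := Finset.univ.image fun i : Fin 3 => w i)
    (t := Finset.univ) hcard
  have hj' (i : Fin 3) : w i ≠ j := fun e => hj.2 (Finset.mem_image.2 ⟨i, Finset.mem_univ _, e⟩)
  obtain ⟨i, hi⟩ := h
  exact mem_horn_of_ne w j (fun e => hj' i (hi.trans e.symm)) hj'

theorem mem_horn_or_of_mem_degenerate_two (c : Fin 3)
    {w : (Δ[2] : SSet.{u}) _⦋2⦌} (hw : w ∈ (Δ[2] : SSet.{u}).degenerate 2) :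
    w ∈ (SSet.horn 2 c).obj _ ∨ ∃ i, w = (Δ[2] : SSet.{u}).σ i ((Δ[2] : SSet.{u}).δ c (top 2)) := by
  rw [SSet.degenerate_eq_iUnion_range_σ, Set.mem_iUnion] at hw
  obtain ⟨i, v, rfl⟩ := hw
  by_cases hv : v ∈ (SSet.horn 2 c).obj _
  · exact Or.inl ((SSet.horn 2 c).map _ hv)
  · rcases degenerate_or_eq_δ v with h | ⟨j, rfl⟩
    · exact (hv (mem_horn_of_mem_degenerate_one (n := 0) c h)).elim
    · obtain rfl : j = c := (SSet.objEquiv_symm_δ_notMem_horn_iff j c).1 hv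
      exact Or.inr ⟨i, rfl⟩

theorem eq_top_of_mem_dTri {w : (Δ[2] : SSet.{u}) _⦋2⦌} (h : w ∈ dTri 2 0 1 2) : w = top 2 := by
  apply SSet.stdSimplex.ext
  intro i
  fin_cases i
  exacts [Fin.ext h.1, Fin.ext h.2.1, Fin.ext h.2.2]

theorem δ_top_mem_horn {c j : Fin 3} (h : j ≠ c) :
    (Δ[2] : SSet.{u}).δ j (top 2) ∈ (SSet.horn 2 c).obj _ := by
  by_contra hj
  exact h ((SSet.objEquiv_symm_δ_notMem_horn_iff j c).1 hj)

section

variable {X Z : SSet.{u}} {π : X ⟶ Z}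

theorem exists_mem_degenerate (hπ : ∀ n, Function.Surjective (π.app n)) {n : ℕ} {y : Z _⦋n⦌}
    (hy : y ∈ Z.degenerate n) : ∃ w ∈ X.degenerate n, π.app _ w = y := by
  obtain ⟨m, hm, p, z, rfl⟩ := hy
  obtain ⟨z, rfl⟩ := hπ _ z
  exact ⟨_, ⟨m, hm, p, z, rfl⟩, NatTrans.naturality_apply π p.op z⟩

end

theorem Generates.of_eq {Y B : MBSSet.{u}} {n : ℕ} {π : (Δ[n] : SSet.{u}) ⟶ Y.toSSet}
    {X X' : Y.toSSet.Subcomplex} {a ε : ℕ} {M : DecoSet (prod Y B).toSSet}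
    (h : Generates π X a ε M) (e : X = X') : Generates π X' a ε M :=
  e ▸ h

/-! ### Inner horns -/

section

variable {B : MBSSet.{u}}

/-- Only dimension two needs an argument. In higher dimension the thin triangle contains the vertex
`k`, so it lies in the horn. -/
theorem le_of_generates_innerHorn (n : ℕ) (k : Fin (n + 2)) (h0 : 0 < k)
    (hn : k < Fin.last (n + 1))
    {M : DecoSet (prod (mk' Δ[n + 1] ∅ (dTri (n + 1) (k - 1) k (k + 1)) ∅) B).toSSet}
    (hM : IsClosed mbAnodyne (prod (mk' Δ[n + 1] ∅ (dTri (n + 1) (k - 1) k (k + 1)) ∅) B).decoSet M)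
    (hMT : M ≤ (prod (mk' Δ[n + 1] ∅ (dTri (n + 1) (k - 1) k (k + 1)) ∅) B).decoSet)
    (h : Generates (Y := mk' Δ[n + 1] ∅ (dTri (n + 1) (k - 1) k (k + 1)) ∅) (𝟙 Δ[n + 1])
      (SSet.horn (n + 1) k) k 0 M) :
    (prod (mk' Δ[n + 1] ∅ (dTri (n + 1) (k - 1) k (k + 1)) ∅) B).decoSet ≤ M := by
  have hX := h.mem
  have hk0 : 0 < (k : ℕ) := h0
  have hkn : (k : ℕ) < n + 1 := hn
  obtain _ | _ | n := n
  · lia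
  · obtain rfl : k = 1 := Fin.ext (by change (k : ℕ) = 1; lia)
    refine decoSet_le_of_innerHorn (Y := mk' Δ[2] ∅ (dTri 2 0 1 2) ∅) hM hMT hX (top 2)
      (Or.inr ⟨rfl, rfl, rfl⟩) (δ_top_mem_horn (by decide)) (δ_top_mem_horn (by decide)) ?_ ?_ ?_
    · rintro y (hy | hy)
      · exact mem_horn_of_mem_degenerate_one (n := 0) _ hy
      · exact hy.elim
    · rintro y (hy | hy | hy)
      · exact (mem_horn_or_of_mem_degenerate_two 1 hy).imp_right Or.inr
      · exact Or.inr (Or.inl (eq_top_of_mem_dTri hy))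
      · exact hy.elim
    · intro b
      exact h.thin (top 2) 1 rfl rfl rfl b (pair_mem (k := .thin) (Or.inr ⟨rfl, rfl, rfl⟩)
        (deg_deco .thin (σ_mem_deg 1 b)))
  · refine decoSet_le_of_subset (Y := mk' Δ[n + 3] ∅ (dTri (n + 3) (k - 1) k (k + 1)) ∅)
      hM hMT hX (fun y _ => mem_horn_one k y) ?_
    rintro y (hy | hy | hy)
    · exact mem_horn_of_mem_degenerate_two _ hy
    · exact mem_horn_of_exists_eq _ _ ⟨1, Fin.ext hy.2.1⟩
    · exact hy.elim

theorem pushoutProduct_innerHorn (n : ℕ) (i : Fin (n + 1)) (h0 : 0 < i) (hn : i < Fin.last n)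
    {A : MBSSet.{u}} (g : A ⟶ B) [Mono g.hom] : mbAnodyne (pushoutProduct
      (inducedHom (mk' Δ[n] ∅ (dTri n (i - 1) i (i + 1)) ∅) (SSet.horn n i).ι) g) := by
  obtain _ | n := n
  · rw [Fin.lt_def, Fin.val_last] at hn
    lia
  obtain ⟨k, rfl⟩ := Fin.eq_castSucc_of_ne_last hn.ne
  let Y : MBSSet.{u} := mk' Δ[n + 1] ∅ (dTri (n + 1) (k.castSucc - 1) k.castSucc (k.castSucc + 1)) ∅
  let ι : (SSet.horn.{u} (n + 1) k.castSucc).toSSet ⟶ Y.toSSet := (SSet.horn (n + 1) k.castSucc).ι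
  have : Mono ι := inferInstanceAs (Mono (SSet.horn.{u} (n + 1) k.castSucc).ι)
  refine pushoutProduct_mem_of_boundary ι (𝟙 Δ[n + 1]) k.castSucc 0 (fun m => ?_)
    (fun M hM hMT h => le_of_generates_innerHorn n _ h0 hn hM hMT
      (h.of_eq (Subfunctor.range_ι _))) g
  refine pushoutProduct_boundary ι (stepPairing k m) (𝟙 Δ[n + 1])
    (fun _ x => ⟨x, rfl⟩) (range_ι_eq _) (fun _ _ _ _ h => h) ?_
    (fun M hM hMT h => le_of_generates_innerHorn n _ h0 hn hM hMT
      (h.of_eq (Subfunctor.range_ι _)))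
  intro d x hx l hl j hj D S hD hS
  obtain rfl : j = l.castSucc := Fin.ext hj
  refine subExtends_step_of_pos (Y := Y) (𝟙 Δ[n + 1]) hx hl hD rfl ?_ (fun _ w hw => Or.inr hw) hS
  -- Since `0 < k`, the vertex 0 is attained, so the step from `k` to `k + 1` cannot be the first
  -- edge.
  obtain ⟨j, hj₀⟩ := exists_fst_eq hx 0 h0.ne
  by_contra! hl0
  obtain rfl : l = 0 := Fin.ext (Nat.le_zero.1 hl0)
  have : (x.1 0 : ℕ) ≤ x.1 j := SSet.stdSimplex.monotone_apply x.1 (Fin.zero_le _)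
  rw [hj₀] at this
  have h₃ : ((0 : Fin (n + 2)) : ℕ) = 0 := rfl
  have h₁ : (x.1 0 : ℕ) = k := hl.1
  have h₂ : 0 < (k : ℕ) := h0
  lia

end

end MBSSet

namespace MBSSet

section

variable {B : MBSSet.{u}}

/-! ### Outer horns -/

theorem le_of_generates_outerHorn (n : ℕ)
    {M : DecoSet (prod (mk' Δ[n + 2] (dEdge (n + 2) (n + 1) (n + 2)) ∅
      (dTri (n + 2) 0 (n + 1) (n + 2))) B).toSSet}
    (hM : IsClosed mbAnodyne (prod (mk' Δ[n + 2] (dEdge (n + 2) (n + 1) (n + 2)) ∅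
      (dTri (n + 2) 0 (n + 1) (n + 2))) B).decoSet M)
    (hMT : M ≤ (prod (mk' Δ[n + 2] (dEdge (n + 2) (n + 1) (n + 2)) ∅
      (dTri (n + 2) 0 (n + 1) (n + 2))) B).decoSet)
    (h : Generates (Y := mk' Δ[n + 2] (dEdge (n + 2) (n + 1) (n + 2)) ∅
      (dTri (n + 2) 0 (n + 1) (n + 2))) (𝟙 Δ[n + 2])
      (SSet.horn (n + 2) (Fin.last (n + 2))) (n + 1) 1 M) :
    (prod (mk' Δ[n + 2] (dEdge (n + 2) (n + 1) (n + 2)) ∅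
      (dTri (n + 2) 0 (n + 1) (n + 2))) B).decoSet ≤ M := by
  have hX := h.mem
  obtain _ | n := n
  · refine decoSet_le_of_outerHorn (Y := mk' Δ[2] (dEdge 2 1 2) ∅ (dTri 2 0 1 2)) hM hMT hX (top 2)
      (Or.inr (Or.inr ⟨rfl, rfl, rfl⟩)) (δ_top_mem_horn (by decide)) (Or.inr ⟨rfl, rfl⟩)
      (δ_top_mem_horn (by decide)) ?_ ?_ ?_
    · intro (y : (Δ[2] : SSet.{u}) _⦋1⦌) hy
      rcases hy with hy | hy
      · exact mem_horn_of_mem_degenerate_one (n := 0) _ hy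
      · refine mem_horn_of_ne _ 0 (by decide) fun i => ?_
        obtain ⟨h₀, h₁⟩ := hy
        intro hi
        have hi' := congrArg Fin.val hi
        rw [Fin.val_zero] at hi'
        fin_cases i
        · change (y 0 : ℕ) = 0 at hi'
          lia
        · change (y 1 : ℕ) = 0 at hi'
          lia
    · rintro y (hy | hy | hy)
      · exact (mem_horn_or_of_mem_degenerate_two 2 hy).imp_right Or.inr
      · exact hy.elim
      · exact Or.inr (Or.inl (eq_top_of_mem_dTri hy))
    · intro b
      exact h.lean (top 2) 1 rfl rfl b (pair_mem (k := .lean) (Or.inr (Or.inr ⟨rfl, rfl, rfl⟩))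
        (deg_deco .lean (σ_mem_deg 1 b)))
  · refine decoSet_le_of_subset (Y := mk' Δ[n + 3] (dEdge (n + 3) (n + 2) (n + 3)) ∅
      (dTri (n + 3) 0 (n + 2) (n + 3))) hM hMT hX (fun y _ => mem_horn_one _ y) ?_
    rintro y (hy | hy | hy)
    · exact mem_horn_of_mem_degenerate_two _ hy
    · exact hy.elim
    · exact mem_horn_of_exists_eq _ _ ⟨2, Fin.ext hy.2.2⟩

theorem pushoutProduct_outerHorn (n : ℕ) {A : MBSSet.{u}} (g : A ⟶ B) [Mono g.hom] :
    mbAnodyne (pushoutProduct (inducedHom (mk' Δ[n + 2] (dEdge (n + 2) (n + 1) (n + 2)) ∅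
      (dTri (n + 2) 0 (n + 1) (n + 2))) (SSet.horn (n + 2) (Fin.last (n + 2))).ι) g) := by
  let Y : MBSSet.{u} := mk' Δ[n + 2] (dEdge (n + 2) (n + 1) (n + 2)) ∅
      (dTri (n + 2) 0 (n + 1) (n + 2))
  let ι : (SSet.horn.{u} (n + 2) (Fin.last (n + 2))).toSSet ⟶ Y.toSSet :=
    (SSet.horn (n + 2) (Fin.last (n + 2))).ι
  have : Mono ι := inferInstanceAs (Mono (SSet.horn.{u} (n + 2) (Fin.last (n + 2))).ι)
  refine pushoutProduct_mem_of_boundary ι (𝟙 Δ[n + 2]) (n + 1) 1 (fun m => ?_)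
    (fun M hM hMT h => le_of_generates_outerHorn n hM hMT (h.of_eq (Subfunctor.range_ι _))) g
  refine pushoutProduct_boundary ι (stepPairingLast (n + 1) m) (𝟙 Δ[n + 2])
    (fun _ x => ⟨x, rfl⟩) (range_ι_eq _) (fun _ _ _ _ h => h) ?_
    (fun M hM hMT h => le_of_generates_outerHorn n hM hMT (h.of_eq (Subfunctor.range_ι _)))
  intro d x hx l hl j hj D S hD hS
  obtain rfl : j = l.succ := Fin.ext hj
  -- A step before the last edge gives an inner horn; at the last edge it gives (A4) or (A5).
  rcases (Nat.lt_succ_iff.1 l.isLt).lt_or_eq with hld | hld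
  · exact subExtends_step_of_lt (Y := Y) (𝟙 Δ[n + 2]) hl hD hld hS
  · exact subExtends_step_of_eq (Y := Y) (𝟙 Δ[n + 2]) hx hl hD rfl hld (fun w hw => Or.inr hw)
      (fun w hw => Or.inr (Or.inr hw)) hS

/-! ### Left horns with a collapsed edge -/

theorem eq_or_exists_of_isPushout {X₁ X₂ X₃ X₄ : Type u} {t : X₁ ⟶ X₂} {l : X₁ ⟶ X₃}
    {r : X₂ ⟶ X₄} {b : X₃ ⟶ X₄} (h : IsPushout t l r b) (ht : Function.Injective t) {x y : X₂}
    (hxy : r x = r y) : x = y ∨ ∃ s, x = t s := by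
  have : Mono t := (mono_iff_injective t).2 ht
  have e : r ≫ h.desc _ _ (Types.Pushout.condition t l) = Types.Pushout.inl t l := h.inl_desc _ _ _
  have h' : Types.Pushout.inl t l x = Types.Pushout.inl t l y := by
    rw [← e]
    exact congrArg (h.desc _ _ (Types.Pushout.condition t l)) hxy
  refine ((Types.Pushout.inl_rel'_inl_iff t l x y).1
    ((Types.Pushout.quot_mk_eq_iff t l _ _).1 h')).imp_right ?_
  rintro ⟨s, _, _, hs, _⟩
  exact ⟨s, hs⟩

theorem collapseMap_injective (n : ℕ) {d : ℕ} (z z' : (Δ[n + 2] : SSet.{u}) _⦋d⦌)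
    (hz : z ∉ (SSet.horn (n + 2) 0).obj _)
    (h : (collapseMap (n + 1)).app _ z = (collapseMap (n + 1)).app _ z') : z = z' := by
  refine (eq_or_exists_of_isPushout
    ((isPushout_collapseHorn n).map ((evaluation SimplexCategoryᵒᵖ (Type u)).obj (op ⦋d⦌)))
    Subtype.val_injective h).resolve_right ?_
  rintro ⟨s, rfl⟩
  exact hz s.2

theorem collapseMap_dEdge (n : ℕ) : ∃ v : (collapse.{u} (n + 1)) _⦋0⦌,
    ∀ w ∈ dEdge (n + 2) 0 1, (collapseMap (n + 1)).app _ w = (collapse.{u} (n + 1)).σ 0 v := by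
  refine ⟨(pushout.inr (edge01.{u} (n + 1)) toPoint.{u}).app _ (top 0), fun w hw => ?_⟩
  have hw' : w = (edge01 (n + 1)).app _ (top 1) := by
    apply SSet.stdSimplex.ext
    intro i
    fin_cases i
    exacts [Fin.ext hw.1, Fin.ext hw.2]
  have h := congrArg (fun f => f.app _ (top 1))
    (pushout.condition (f := edge01.{u} (n + 1)) (g := toPoint.{u}))
  rw [hw']
  refine Eq.trans h ?_
  refine Eq.trans ?_ (SSet.σ_naturality_apply (pushout.inr (edge01.{u} (n + 1)) toPoint.{u}) 0 (top 0))
  refine congrArg ((pushout.inr (edge01.{u} (n + 1)) toPoint.{u}).app _) ?_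
  apply SSet.stdSimplex.ext
  intro i
  exact Subsingleton.elim (α := Fin 1) _ _

/-- The target of the generating map given by a left horn with a collapsed edge. -/
noncomputable abbrev leftHornTarget (n : ℕ) : MBSSet.{u} :=
  mk' (collapse (n + 1)) ∅ ∅ ((collapseMap (n + 1)).app _ '' dTri (n + 2) 0 1 (n + 2))

theorem le_of_generates_leftHorn (n : ℕ) {M : DecoSet (prod (leftHornTarget n) B).toSSet}
    (hM : IsClosed mbAnodyne (prod (leftHornTarget n) B).decoSet M)
    (hMT : M ≤ (prod (leftHornTarget n) B).decoSet)
    (h : Generates (Y := leftHornTarget n) (collapseMap (n + 1))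
      ((SSet.horn (n + 2) 0).image (collapseMap (n + 1))) 0 0 M) :
    (prod (leftHornTarget n) B).decoSet ≤ M := by
  have hX := h.mem
  have hmarked : ∀ y ∈ (leftHornTarget n).deco .marked,
      y ∈ ((SSet.horn.{u} (n + 2) 0).image (collapseMap (n + 1))).obj _ := by
    rintro y (hy | hy)
    · obtain ⟨w, hw, rfl⟩ := exists_mem_degenerate (collapseMap_surjective (n + 1)) hy
      exact ⟨w, mem_horn_of_mem_degenerate_one _ hw, rfl⟩
    · exact hy.elim
  obtain _ | n := n
  · refine decoSet_le_of_leftHorn (Y := leftHornTarget 0) hM hMT hX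
      ((collapseMap 1).app _ (top 2)) (Or.inr (Or.inr ⟨_, ⟨rfl, rfl, rfl⟩, rfl⟩))
      ⟨_, δ_top_mem_horn (j := 2) (by decide), SSet.δ_naturality_apply _ _ _⟩ ?_
      ⟨_, δ_top_mem_horn (j := 1) (by decide), SSet.δ_naturality_apply _ _ _⟩ hmarked ?_ ?_
    · obtain ⟨v, hv⟩ := collapseMap_dEdge.{u} 0
      refine ⟨v, ?_⟩
      refine Eq.trans ?_ (SSet.δ_naturality_apply (collapseMap 1) 2 (top 2))
      exact (hv _ ⟨rfl, rfl⟩).symm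
    · rintro y (hy | hy | hy)
      · obtain ⟨w, hw, rfl⟩ := exists_mem_degenerate (collapseMap_surjective 1) hy
        rcases mem_horn_or_of_mem_degenerate_two 0 hw with hw' | ⟨i, rfl⟩
        · exact Or.inl ⟨w, hw', rfl⟩
        · refine Or.inr (Or.inr ⟨i, ?_⟩)
          refine (SSet.σ_naturality_apply (collapseMap 1) i _).trans ?_
          exact congrArg _ (SSet.δ_naturality_apply (collapseMap 1) 0 (top 2))
      · exact hy.elim
      · obtain ⟨w, hw, rfl⟩ := hy
        exact Or.inr (Or.inl (congrArg _ (eq_top_of_mem_dTri hw)))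
    · intro b
      exact h.lean (top 2) 0 rfl rfl b (pair_mem (k := .lean)
        (Or.inr (Or.inr ⟨_, ⟨rfl, rfl, rfl⟩, rfl⟩)) (deg_deco .lean (σ_mem_deg 0 b)))
  · refine decoSet_le_of_subset (Y := leftHornTarget (n + 1)) hM hMT hX hmarked ?_
    rintro y (hy | hy | hy)
    · obtain ⟨w, hw, rfl⟩ := exists_mem_degenerate (collapseMap_surjective (n + 2)) hy
      exact ⟨w, mem_horn_of_mem_degenerate_two _ hw, rfl⟩
    · exact hy.elim
    · obtain ⟨w, hw, rfl⟩ := hy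
      exact ⟨w, mem_horn_of_exists_eq _ _ ⟨0, Fin.ext hw.1⟩, rfl⟩

theorem pushoutProduct_leftHorn (n : ℕ) {A : MBSSet.{u}} (g : A ⟶ B) [Mono g.hom] :
    mbAnodyne (pushoutProduct (inducedHom (leftHornTarget n) (collapseHorn n)) g) := by
  let ι : pushout (hornEdge01.{u} n) toPoint ⟶ (leftHornTarget n).toSSet := collapseHorn n
  have : Mono ι := inferInstanceAs (Mono (collapseHorn n))
  refine pushoutProduct_mem_of_boundary ι (collapseMap (n + 1)) 0 0 (fun m => ?_)
    (fun M hM hMT h => le_of_generates_leftHorn n hM hMT (h.of_eq (range_collapseHorn n))) g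
  refine pushoutProduct_boundary ι (stepPairing (0 : Fin (n + 2)) m) (collapseMap (n + 1))
    (collapseMap_surjective _) (range_collapseHorn n)
    (fun d z z' => collapseMap_injective n z z') ?_
    (fun M hM hMT h => le_of_generates_leftHorn n hM hMT (h.of_eq (range_collapseHorn n)))
  intro d x hx l hl j hj D S hD hS
  obtain rfl : j = l.castSucc := Fin.ext hj
  -- At position 0 the step is collapsed in the target and gives (A3). At a later position it gives
  -- an inner horn whose triangle is degenerate over the target, as the first coordinate is 0 up to
  -- the step.
  rcases Nat.eq_zero_or_pos l with hl0 | hl0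
  · obtain ⟨v, hv⟩ := collapseMap_dEdge.{u} n
    exact subExtends_step_of_zero (Y := leftHornTarget n) (collapseMap (n + 1))
      (Nat.succ_pos n) hx hl hD rfl hl0 hv (fun w hw => Or.inr (Or.inr ⟨w, hw, rfl⟩)) hS
  · exact subExtends_step_of_pos (Y := leftHornTarget n) (collapseMap (n + 1)) hx hl hD rfl hl0
      (fun h => (lt_irrefl _ h).elim) hS

/-! ### The inclusion of the terminal vertex -/

/-- The target of the generating map given by the inclusion of the terminal vertex. -/
abbrev terminalVertexTarget : MBSSet.{u} := mk' Δ[1] Set.univ Set.univ Set.univ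

theorem range_δ_zero : SSet.Subcomplex.range
    (SSet.stdSimplex.δ (0 : Fin 2) : (Δ[0] : SSet.{u}) ⟶ Δ[1]) = SSet.horn 1 1 := by
  rw [SSet.Subcomplex.range_eq_ofSimplex, SSet.stdSimplex.ofSimplex_yonedaEquiv_δ]
  refine le_antisymm (SSet.face_le_horn 0 1 (by decide)) ?_
  rw [SSet.horn_eq_iSup, iSup_le_iff]
  rintro ⟨j, hj⟩
  have : j = 0 := by
    have : j ≠ 1 := hj
    lia
  subst this
  exact le_rfl

theorem le_of_generates_terminalVertex {M : DecoSet (prod terminalVertexTarget B).toSSet}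
    (hM : IsClosed mbAnodyne (prod terminalVertexTarget B).decoSet M)
    (hMT : M ≤ (prod terminalVertexTarget B).decoSet)
    (h : Generates (Y := terminalVertexTarget) (𝟙 Δ[1]) (SSet.horn 1 1) 0 1 M)
    (hS : B.deco .marked ⊆ B.toSSet.degenerate 1 ∨ ∀ s ∈ M .thin,
      (prod terminalVertexTarget B).toSSet.δ 0 s ∈ M .marked →
      (prod terminalVertexTarget B).toSSet.δ 1 s ∈ M .marked →
      (prod terminalVertexTarget B).toSSet.δ 2 s ∈ (prod terminalVertexTarget B).decoSet .marked →
      (prod terminalVertexTarget B).toSSet.δ 2 s ∈ M .marked) :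
    (prod terminalVertexTarget B).decoSet ≤ M := by
  have h01 (a : Fin 2) : a = 0 ∨ a = 1 := by fin_cases a <;> simp
  refine decoSet_le_of_terminalVertex (Y := terminalVertexTarget) hM hMT h.mem (top 1)
    (Or.inr trivial) (fun i => Or.inr trivial)
    ?_ (fun (y : (Δ[1] : SSet.{u}) _⦋1⦌) => ?_) (fun (y : (Δ[1] : SSet.{u}) _⦋2⦌) => ?_)
    (fun v => h.marked (top 1) rfl rfl v
      (pair_mem (k := .marked) (Or.inr trivial) (deg_deco .marked (σ_mem_deg 0 v))))
    (fun b => h.thin ((Δ[1] : SSet.{u}).σ 1 (top 1)) 0 rfl rfl rfl b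
      (pair_mem (k := .thin) (Or.inr trivial) (deg_deco .thin (σ_mem_deg 0 b))))
    (fun b => h.lean ((Δ[1] : SSet.{u}).σ 0 (top 1)) 1 rfl rfl b
      (pair_mem (k := .lean) (Or.inr (Or.inr trivial)) (deg_deco .lean (σ_mem_deg 1 b)))) hS
  · exact mem_horn_of_ne ((Δ[1] : SSet.{u}).δ 0 (top 1)) 0 (by decide) fun i => by
      fin_cases i
      exact Fin.zero_lt_one.ne'
  · have hy : y 0 ≤ y 1 := SSet.stdSimplex.monotone_apply y (by decide)
    rcases h01 (y 0) with h0 | h0 <;> rcases h01 (y 1) with h1 | h1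
    · refine Or.inr (Or.inr (SSet.stdSimplex.ext _ _ fun i => ?_))
      fin_cases i
      exacts [h0, h1]
    · refine Or.inr (Or.inl (SSet.stdSimplex.ext _ _ fun i => ?_))
      fin_cases i
      exacts [h0, h1]
    · rw [h0, h1] at hy
      exact (hy.not_gt Fin.zero_lt_one).elim
    · refine Or.inl (mem_horn_of_ne y 0 (by decide) fun i => ?_)
      fin_cases i
      exacts [h0.trans_ne Fin.zero_lt_one.ne', h1.trans_ne Fin.zero_lt_one.ne']
  · have hy : y 0 ≤ y 1 := SSet.stdSimplex.monotone_apply y (by decide)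
    have hy' : y 1 ≤ y 2 := SSet.stdSimplex.monotone_apply y (by decide)
    rcases h01 (y 0) with h0 | h0 <;> rcases h01 (y 1) with h1 | h1 <;>
    rcases h01 (y 2) with h2 | h2
    · refine Or.inr (Or.inr (Or.inr (SSet.stdSimplex.ext _ _ fun i => ?_)))
      fin_cases i
      exacts [h0, h1, h2]
    · refine Or.inr (Or.inl (SSet.stdSimplex.ext _ _ fun i => ?_))
      fin_cases i
      exacts [h0, h1, h2]
    · rw [h1, h2] at hy'
      exact (hy'.not_gt Fin.zero_lt_one).elim
    · refine Or.inr (Or.inr (Or.inl (SSet.stdSimplex.ext _ _ fun i => ?_)))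
      fin_cases i
      exacts [h0, h1, h2]
    · rw [h0, h1] at hy
      exact (hy.not_gt Fin.zero_lt_one).elim
    · rw [h0, h1] at hy
      exact (hy.not_gt Fin.zero_lt_one).elim
    · rw [h1, h2] at hy'
      exact (hy'.not_gt Fin.zero_lt_one).elim
    · refine Or.inl (mem_horn_of_ne y 0 (by decide) fun i => ?_)
      fin_cases i
      exacts [h0.trans_ne Fin.zero_lt_one.ne', h1.trans_ne Fin.zero_lt_one.ne',
        h2.trans_ne Fin.zero_lt_one.ne']

/-- The cells need no cancellation rule because `flat Δ[m]` has only degenerate marked edges. The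
rule enters only through the change of decorations on `B`. -/
theorem pushoutProduct_terminalVertex_of_or {A : MBSSet.{u}} (g : A ⟶ B) [Mono g.hom]
    (hB : B.deco .marked ⊆ B.toSSet.degenerate 1 ∨
      ∀ M : DecoSet (prod terminalVertexTarget B).toSSet,
      IsClosed mbAnodyne (prod terminalVertexTarget B).decoSet M →
      M ≤ (prod terminalVertexTarget B).decoSet → ∀ s ∈ M .thin,
      (prod terminalVertexTarget B).toSSet.δ 0 s ∈ M .marked →
      (prod terminalVertexTarget B).toSSet.δ 1 s ∈ M .marked →
      (prod terminalVertexTarget B).toSSet.δ 2 s ∈ (prod terminalVertexTarget B).decoSet .marked →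
      (prod terminalVertexTarget B).toSSet.δ 2 s ∈ M .marked) :
    mbAnodyne (pushoutProduct (inducedHom terminalVertexTarget
      (SSet.stdSimplex.δ (0 : Fin 2) : (Δ[0] : SSet.{u}) ⟶ Δ[1])) g) := by
  let ι : (Δ[0] : SSet.{u}) ⟶ terminalVertexTarget.toSSet := SSet.stdSimplex.δ (0 : Fin 2)
  have : Mono ι := inferInstanceAs (Mono (SSet.stdSimplex.δ (0 : Fin 2) : (Δ[0] : SSet.{u}) ⟶ Δ[1]))
  refine pushoutProduct_mem_of_boundary ι (𝟙 Δ[1]) 0 1 (fun m => ?_)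
    (fun M hM hMT h => le_of_generates_terminalVertex hM hMT (h.of_eq range_δ_zero)
      (hB.imp_right fun h => h M hM hMT)) g
  refine pushoutProduct_boundary ι (stepPairingLast 0 m) (𝟙 Δ[1])
    (fun _ x => ⟨x, rfl⟩) (range_δ_zero.trans (image_id _).symm) (fun _ _ _ _ h => h) ?_
    (fun M hM hMT h => le_of_generates_terminalVertex hM hMT (h.of_eq range_δ_zero)
      (Or.inl (flat_deco _ .marked).le))
  intro d x hx l hl j hj D S hD hS
  obtain rfl : j = l.succ := Fin.ext hj
  rcases (Nat.lt_succ_iff.1 l.isLt).lt_or_eq with hld | hld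
  · exact subExtends_step_of_lt (Y := terminalVertexTarget) (𝟙 Δ[1]) hl hD hld hS
  · exact subExtends_step_of_eq (Y := terminalVertexTarget) (𝟙 Δ[1]) hx hl hD rfl hld
      (fun w hw => Or.inr trivial) (fun w hw => Or.inr (Or.inr trivial)) hS

end

end MBSSet

namespace MBSSet

/-! ### A contractible Kan complex -/

/-- The simplicial set whose `n`-simplices are all families of `n + 1` elements of `S`. -/
def codiscrete (S : Type u) : SSet.{u} where
  obj n := Fin (n.unop.len + 1) → S
  map f := ↾fun x i => x (f.unop.toOrderHom i)

open SSet.modelCategoryQuillen in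
theorem kanComplex_codiscrete (S : Type u) [Nonempty S] : SSet.KanComplex (codiscrete S) := by
  classical
  refine (HomotopicalAlgebra.isFibrant_iff _).2 ⟨?_⟩
  rw [SSet.modelCategoryQuillen.fibrations_eq]
  intro _ _ _ hf
  simp only [SSet.modelCategoryQuillen.J, MorphismProperty.iSup_iff] at hf
  obtain ⟨n, ⟨i⟩⟩ := hf
  refine ⟨fun {t _} _ => ⟨⟨?_⟩⟩⟩
  let v (a : Fin (n + 2)) : (Δ[n + 1] : SSet.{u}) _⦋0⦌ :=
    SSet.stdSimplex.objEquiv.symm (SimplexCategory.const _ _ a)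
  -- A simplex of a codiscrete simplicial set is an arbitrary word of vertices, so a filler is a
  -- choice of values on vertices. Only one-dimensional horns miss a vertex, and there the value is
  -- arbitrary.
  let w (a : Fin (n + 2)) : S := if h : v a ∈ (SSet.horn (n + 1) i).obj _ then
    (t.app _ ⟨v a, h⟩ : (codiscrete S) _⦋0⦌) 0 else Classical.arbitrary S
  refine
    { l :=
        { app d := ↾fun (g : (Δ[n + 1] : SSet.{u}).obj d) a =>
            w ((SSet.stdSimplex.objEquiv g).toOrderHom a)
          naturality _ _ _ := rfl }
      fac_left := ?_
      fac_right := by subsingleton }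
  ext d g
  funext a
  have hg : v ((SSet.stdSimplex.objEquiv g.1).toOrderHom a) ∈ (SSet.horn.{u} (n + 1) i).obj _ :=
    (SSet.horn.{u} (n + 1) i).map (SimplexCategory.const ⦋0⦌ d.unop a).op g.2
  have e : (SSet.horn.{u} (n + 1) i).toSSet.map (SimplexCategory.const ⦋0⦌ d.unop a).op g =
      ⟨v ((SSet.stdSimplex.objEquiv g.1).toOrderHom a), hg⟩ := Subtype.ext rfl
  have h' : w ((SSet.stdSimplex.objEquiv g.1).toOrderHom a) =
    (t.app _ ⟨v ((SSet.stdSimplex.objEquiv g.1).toOrderHom a), hg⟩ :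
      (codiscrete S) _⦋0⦌) 0 := dif_pos hg
  have h := congrFun (NatTrans.naturality_apply t (SimplexCategory.const ⦋0⦌ d.unop a).op g) 0
  rw [e] at h
  exact h'.trans h

end MBSSet

namespace MBSSet

/-! ### A triangle with a doubled initial vertex -/

/-- The nerve of the preorder with four elements `0`, `1`, `2`, `3`, where `0` and `1` are
isomorphic, and `1 < 2 < 3`. -/
def dblTri : SSet.{u} where
  obj n := ULift.{u} {x : Fin (n.unop.len + 1) → ℕ // (∀ i, x i < 4) ∧ Monotone fun i => x i - 1}
  map f := ↾fun x => ⟨fun i => x.down.1 (f.unop.toOrderHom i),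
    fun i => x.down.2.1 (f.unop.toOrderHom i),
    fun _ _ h => x.down.2.2 (f.unop.toOrderHom.monotone h)⟩

/-- The vertices of a simplex of `dblTri`. -/
def vert {n : ℕ} (x : dblTri.{u} _⦋n⦌) (i : Fin (n + 1)) : ℕ := x.down.1 i

theorem vert_lt {n : ℕ} (x : dblTri.{u} _⦋n⦌) (i : Fin (n + 1)) : vert x i < 4 := x.down.2.1 i

theorem vert_mono {n : ℕ} (x : dblTri.{u} _⦋n⦌) {i j : Fin (n + 1)} (h : i ≤ j) :
    vert x i - 1 ≤ vert x j - 1 := x.down.2.2 h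

/-- The simplex with given vertices. -/
def ofVert {n : ℕ} (x : Fin (n + 1) → ℕ) (h : ∀ i, x i < 4) (hx : Monotone fun i => x i - 1) :
    dblTri.{u} _⦋n⦌ := ⟨x, h, hx⟩

theorem vert_ext {n : ℕ} {x y : dblTri.{u} _⦋n⦌} (h : ∀ i, vert x i = vert y i) : x = y :=
  ULift.down_injective (Subtype.ext (funext h))

theorem vert_δ {n : ℕ} (x : dblTri.{u} _⦋n + 1⦌) (j : Fin (n + 2)) (i : Fin (n + 1)) :
    vert (dblTri.{u}.δ j x) i = vert x (j.succAbove i) := rfl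

theorem vert_σ {n : ℕ} (x : dblTri.{u} _⦋n⦌) (j : Fin (n + 1)) (i : Fin (n + 2)) :
    vert (dblTri.{u}.σ j x) i = vert x (j.predAbove i) := rfl

theorem eq_σ_δ {n : ℕ} (x : dblTri.{u} _⦋n + 1⦌) (i : Fin (n + 1))
    (h : vert x i.castSucc = vert x i.succ) :
    x = dblTri.{u}.σ i (dblTri.{u}.δ i.castSucc x) := by
  refine vert_ext fun j => ?_
  rw [vert_σ, vert_δ]
  by_cases hj : j = i.castSucc
  · rw [hj, Fin.predAbove_castSucc_self, Fin.succAbove_castSucc_self, h]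
  · rw [Fin.succAbove_predAbove hj]

theorem mem_nonDegenerate {n : ℕ} (x : dblTri.{u} _⦋n⦌)
    (h : ∀ i j : Fin (n + 1), (j : ℕ) = i + 1 → vert x i ≠ vert x j) :
    x ∈ dblTri.{u}.nonDegenerate n := by
  intro hx
  obtain _ | n := n
  · rw [SSet.degenerate_zero] at hx
    exact hx
  rw [SSet.degenerate_eq_iUnion_range_σ, Set.mem_iUnion] at hx
  obtain ⟨i, y, rfl⟩ := hx
  refine h i.castSucc i.succ rfl ?_
  rw [vert_σ, vert_σ, Fin.predAbove_castSucc_self, Fin.predAbove_succ_self]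

theorem mem_ofSimplex {n m : ℕ} (x : dblTri.{u} _⦋n⦌) (y : dblTri.{u} _⦋m⦌)
    (f : Fin (n + 1) → Fin (m + 1)) (hf : Monotone f) (h : ∀ i, vert x i = vert y (f i)) :
    x ∈ (SSet.Subcomplex.ofSimplex y).obj _ := by
  rw [SSet.Subcomplex.mem_ofSimplex_obj_iff]
  exact ⟨SimplexCategory.Hom.mk ⟨f, hf⟩, vert_ext fun i => (h i).symm⟩

theorem exists_of_mem_ofSimplex {n m : ℕ} {x : dblTri.{u} _⦋n⦌} {y : dblTri.{u} _⦋m⦌}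
    (hx : ∀ i j : Fin (n + 1), (j : ℕ) = i + 1 → vert x i ≠ vert x j)
    (h : x ∈ (SSet.Subcomplex.ofSimplex y).obj _) :
    ∃ f : Fin (n + 1) → Fin (m + 1), StrictMono f ∧ ∀ i, vert x i = vert y (f i) := by
  rw [SSet.Subcomplex.mem_ofSimplex_obj_iff] at h
  obtain ⟨f, rfl⟩ := h
  refine ⟨f.toOrderHom, Fin.strictMono_iff_lt_succ.2 fun i => ?_, fun i => rfl⟩
  refine lt_of_le_of_ne (f.toOrderHom.monotone (Fin.castSucc_le_succ i)) fun h => ?_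
  exact hx i.castSucc i.succ rfl (congrArg (vert y) h)

/-- The triangle with vertices `0`, `2`, `3`. -/
def baseTri : dblTri.{u} _⦋2⦌ := ofVert (fun i => if (i : ℕ) = 0 then 0 else i + 1)
  (fun i => by split_ifs <;> omega) (fun i j h => by
    rw [Fin.le_def] at h
    dsimp only
    split_ifs <;> omega)

theorem mem_baseTri_iff {n : ℕ} (x : dblTri.{u} _⦋n⦌) :
    x ∈ (SSet.Subcomplex.ofSimplex baseTri).obj _ ↔ ∀ i, vert x i ≠ 1 := by
  constructor
  · intro h i
    rw [SSet.Subcomplex.mem_ofSimplex_obj_iff] at h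
    obtain ⟨f, rfl⟩ := h
    change (if (f.toOrderHom i : ℕ) = 0 then 0 else (f.toOrderHom i : ℕ) + 1) ≠ 1
    split_ifs <;> omega
  · intro h
    refine mem_ofSimplex x _ (fun i => ⟨vert x i - 1, by have := vert_lt x i; lia⟩)
      (fun i j hij => vert_mono x hij) fun i => ?_
    change _ = if vert x i - 1 = 0 then 0 else vert x i - 1 + 1
    have := h i
    split_ifs <;> omega

/-- The simplex with `m + 1` alternating vertices `0` and `1`, ending with `e`, and one further
vertex `3 - e`. -/
def wordOne (m : ℕ) (e : Fin 2) : dblTri.{u} _⦋m + 1⦌ :=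
  ofVert (fun i => if (i : ℕ) ≤ m then (m - i + e) % 2 else 3 - e)
    (fun i => by split_ifs <;> omega) (fun i j h => by
      rw [Fin.le_def] at h
      dsimp only
      split_ifs <;> omega)

/-- The simplex with `m + 1` alternating vertices `0` and `1`, ending with `e`, and the further
vertices `2` and `3`. -/
def wordTwo (m : ℕ) (e : Fin 2) : dblTri.{u} _⦋m + 2⦌ :=
  ofVert (fun i => if (i : ℕ) ≤ m then (m - i + e) % 2 else i - m + 1)
    (fun i => by split_ifs <;> omega) (fun i j h => by
      rw [Fin.le_def] at h
      dsimp only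
      split_ifs <;> omega)

theorem vert_wordOne (m : ℕ) (e : Fin 2) (i : Fin (m + 2)) : vert (wordOne.{u} m e) i =
    if (i : ℕ) ≤ m then (m - i + e) % 2 else 3 - e := rfl

theorem vert_wordTwo (m : ℕ) (e : Fin 2) (i : Fin (m + 3)) : vert (wordTwo.{u} m e) i =
    if (i : ℕ) ≤ m then (m - i + e) % 2 else i - m + 1 := rfl

/-- Let `k` be the last position of a vertex 0 or 1, so `k < m`. Without repeated neighbours the
vertices alternate up to `k`, and only 2 and 3 can follow: the simplex is a face of `wordTwo k e`.
If there is no such position, it is a face of `baseTri`. -/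
theorem wordTwo_mem_of_ne (m : ℕ) (S : dblTri.{u}.Subcomplex) (hS : baseTri ∈ S.obj _)
    (h : ∀ k < m, ∀ e, wordTwo k e ∈ S.obj _) {n : ℕ} (x : dblTri.{u} _⦋n⦌)
    (hx : ∀ i : Fin (n + 1), m ≤ i → 2 ≤ vert x i)
    (hne : ∀ i j : Fin (n + 1), (j : ℕ) = i + 1 → vert x i ≠ vert x j) : x ∈ S.obj _ := by
  by_cases hx' : ∀ i, 2 ≤ vert x i
  · refine (SSet.Subcomplex.ofSimplex_le_iff baseTri S).2 hS _ ((mem_baseTri_iff x).2 fun i => ?_)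
    have := hx' i
    lia
  push Not at hx'
  let s : Finset (Fin (n + 1)) := Finset.univ.filter fun i => vert x i < 2
  have hs : s.Nonempty := by
    obtain ⟨i, hi⟩ := hx'
    exact ⟨i, Finset.mem_filter.2 ⟨Finset.mem_univ _, hi⟩⟩
  let k := s.max' hs
  have hk : vert x k < 2 := (Finset.mem_filter.1 (s.max'_mem hs)).2
  have hk' (i : Fin (n + 1)) (hi : k < i) : 2 ≤ vert x i := by
    by_contra! h
    exact (s.le_max' i (Finset.mem_filter.2 ⟨Finset.mem_univ _, h⟩)).not_gt hi
  have hk'' (i : Fin (n + 1)) (hi : i ≤ k) : vert x i < 2 := by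
    have := vert_mono x hi
    lia
  clear_value k
  have hkm : (k : ℕ) < m := by
    by_contra! h
    exact (hx k h).not_gt hk
  have halt (t : ℕ) (i : Fin (n + 1)) (hi : (i : ℕ) + t = k) :
      vert x i = (t + vert x k) % 2 := by
    induction t generalizing i with
    | zero =>
      obtain rfl : i = k := Fin.ext hi
      omega
    | succ t ih =>
      have h₁ := ih ⟨i + 1, by omega⟩ (by dsimp only; omega)
      have h₂ := hk'' i (by rw [Fin.le_def]; omega)
      have h₃ := hne i ⟨i + 1, by omega⟩ rfl
      omega
  -- In `wordTwo k e` the vertices 2 and 3 sit at the positions `k + 1` and `k + 2`.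
  refine (SSet.Subcomplex.ofSimplex_le_iff _ S).2 (h k hkm ⟨vert x k, hk⟩) _
    (mem_ofSimplex x _ (fun i => ⟨if (i : ℕ) ≤ k then i else k + vert x i - 1, ?_⟩) ?_ ?_)
  · have := vert_lt x i
    split_ifs with hi
    · omega
    · omega
  · intro i j hij
    rw [Fin.le_def]
    have h₁ := vert_mono x hij
    rw [Fin.le_def] at hij
    dsimp only
    split_ifs with h₂ h₃ h₃
    · exact hij
    · have := hk' j (Fin.lt_def.2 (by omega))
      omega
    · exact (h₂ (le_trans hij h₃)).elim
    · have := hk' i (Fin.lt_def.2 (by omega))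
      omega
  · intro i
    rw [vert_wordTwo]
    dsimp only
    by_cases hi : (i : ℕ) ≤ k
    · simp only [if_pos hi]
      exact halt (k - i) i (by omega)
    · have h₁ := hk' i (Fin.lt_def.2 (by omega))
      simp only [if_neg hi]
      rw [if_neg (by omega)]
      omega

/-- A subcomplex contains all simplices with few vertices `0` and `1` if it contains certain
generators. -/
theorem mem_of_wordTwo_mem (m : ℕ) (S : dblTri.{u}.Subcomplex) (hS : baseTri ∈ S.obj _)
    (h : ∀ k < m, ∀ e, wordTwo k e ∈ S.obj _) {n : ℕ} (x : dblTri.{u} _⦋n⦌)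
    (hx : ∀ i : Fin (n + 1), m ≤ i → 2 ≤ vert x i) : x ∈ S.obj _ := by
  by_cases hne : ∀ i j : Fin (n + 1), (j : ℕ) = i + 1 → vert x i ≠ vert x j
  · exact wordTwo_mem_of_ne m S hS h x hx hne
  push Not at hne
  obtain ⟨i, j, hij, hne⟩ := hne
  induction n with
  | zero => omega
  | succ n ih =>
    obtain ⟨i, rfl⟩ := Fin.eq_castSucc_of_ne_last (x := i) (fun hi => by
      rw [hi, Fin.val_last] at hij
      omega)
    obtain rfl : j = i.succ := Fin.ext hij
    -- Removing a repeated vertex moves the later ones only towards the beginning, so the hypothesis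
    -- on positions is kept.
    rw [eq_σ_δ x i hne]
    refine S.map _ ?_
    have hδ (a : Fin (n + 1)) (ha : m ≤ a) : 2 ≤ vert (dblTri.δ i.castSucc x) a := by
      rw [vert_δ]
      refine hx _ (ha.trans ?_)
      rw [Fin.succAbove]
      split_ifs
      · rfl
      · exact Nat.le_succ _
    by_cases hne' : ∀ a b : Fin (n + 1), (b : ℕ) = a + 1 →
        vert (dblTri.δ i.castSucc x) a ≠ vert (dblTri.δ i.castSucc x) b
    · exact wordTwo_mem_of_ne m S hS h _ hδ hne'
    · push Not at hne'
      obtain ⟨a, b, hab, hne'⟩ := hne'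
      exact ih _ hδ a b hab hne'

end MBSSet

/-! ### Attaching the words of the doubled triangle. -/

namespace MBSSet

/-- The edges from `0` to `3`, from `1` to `2`, and from `2` to `3`. -/
def DblEdge (a b : ℕ) : Prop := a = 0 ∧ b = 3 ∨ a = 1 ∧ b = 2 ∨ a = 2 ∧ b = 3

/-- The decorations of `dblTri` which are used when attaching simplices. -/
def dblDeco : MBSSet.{u} :=
  mk' dblTri {e | DblEdge (vert e 0) (vert e 1)} {t | vert t 1 = 2 ∧ vert t 2 = 3}
    {t | DblEdge (vert t 1) (vert t 2)}

theorem dblDeco_sat (k : Kind) : dblDeco.{u}.decoSet.sat k = dblDeco.deco k := decoSet_sat _ k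

theorem marked_mem_sat {e : dblTri.{u} _⦋1⦌} (h : DblEdge (vert e 0) (vert e 1)) :
    e ∈ dblDeco.{u}.decoSet.sat .marked := by
  rw [dblDeco_sat]
  exact Or.inr h

theorem thin_mem_sat {t : dblTri.{u} _⦋2⦌} (h : vert t 1 = 2 ∧ vert t 2 = 3) :
    t ∈ dblDeco.{u}.decoSet.sat .thin := by
  rw [dblDeco_sat]
  exact Or.inr h

theorem lean_mem_sat {t : dblTri.{u} _⦋2⦌} (h : DblEdge (vert t 1) (vert t 2)) :
    t ∈ dblDeco.{u}.decoSet.sat .lean := by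
  rw [dblDeco_sat]
  exact Or.inr (Or.inr h)

/-- The nondegenerate decorations of `dblDeco` are visible on the last edge. Omitted faces are
recognised as undecorated by looking at this edge. -/
theorem dblEdge_of_mk_eq (k : Kind) (z : dblTri.{u} _⦋k.dim⦌)
    (hz : z ∈ dblDeco.{u}.decoSet.sat k) (hz' : z ∉ dblTri.{u}.degenerate k.dim) {n : ℕ}
    {x : dblTri.{u} _⦋n⦌} (h : SSet.S.mk z = SSet.S.mk x) :
    n = k.dim ∧ ∃ i j : Fin (n + 1), (i : ℕ) + 1 = n ∧ (j : ℕ) = n ∧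
      DblEdge (vert x i) (vert x j) ∧ (k = .thin → vert x i = 2 ∧ vert x j = 3) := by
  obtain rfl := dim_eq_of_mk_eq h
  rw [SSet.S.ext_iff'] at h
  obtain ⟨_, h⟩ := h
  obtain rfl : z = x := h
  rw [dblDeco_sat] at hz
  refine ⟨rfl, ?_⟩
  cases k
  · exact ⟨0, 1, rfl, rfl, hz.resolve_left hz', fun h => by cases h⟩
  · have h := hz.resolve_left hz'
    exact ⟨1, 2, rfl, rfl, Or.inr (Or.inr h), fun _ => h⟩
  · rcases hz.resolve_left hz' with h | h
    · exact ⟨1, 2, rfl, rfl, Or.inr (Or.inr h), fun h => by cases h⟩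
    · exact ⟨1, 2, rfl, rfl, h, fun h => by cases h⟩

theorem vert_yonedaEquiv_symm {n m : ℕ} (y : dblTri.{u} _⦋n⦌) (g : (Δ[n] : SSet.{u}) _⦋m⦌)
    (i : Fin (m + 1)) : vert ((SSet.yonedaEquiv.symm y).app _ g) i = vert y (g i) := rfl

/-- The last edge is `0 → 3` or `1 → 2`, hence marked, and triangles ending with it are lean. So
(A4), or (A5) for `m = 0`, attaches the word together with its alternating part. For `m = 0` and `e
= 0` the edge already lies in the base triangle. -/
theorem subExtends_wordOne (m : ℕ) (e : Fin 2) (hme : m = 0 → e = 1) (S : dblTri.{u}.Subcomplex)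
    (hS : baseTri ∈ S.obj _) (h : ∀ k < m, ∀ e, wordTwo k e ∈ S.obj _)
    (hn : dblTri.δ (Fin.last (m + 1)) (wordOne m e) ∉ S.obj _) :
    SubExtends mbAnodyne (Sub.mk S dblDeco.decoSet)
      (Sub.mk (S ⊔ SSet.Subcomplex.ofSimplex (wordOne m e)) dblDeco.decoSet) := by
  have hδ (i : Fin (m + 1)) : vert (dblTri.{u}.δ (Fin.last (m + 1)) (wordOne m e)) i =
      (m - i + e) % 2 := by
    rw [vert_δ, vert_wordOne, Fin.succAbove_last, Fin.val_castSucc, if_pos (by omega)]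
  have hd : HornData S dblDeco.decoSet (wordOne.{u} m e) (Fin.last (m + 1)) := by
    refine ⟨?_, fun h => hn (S.map _ h), ?_, hn, ?_, ?_⟩
    · refine mem_nonDegenerate _ fun i j hij => ?_
      rw [vert_wordOne, vert_wordOne]
      split_ifs <;> omega
    · refine mem_nonDegenerate _ fun i j hij => ?_
      rw [hδ, hδ]
      omega
    · intro j hj
      refine mem_of_wordTwo_mem m S hS h _ fun i hi => ?_
      rw [vert_δ, vert_wordOne, if_neg]
      · omega
      · rw [Fin.succAbove_of_le_castSucc, Fin.val_succ]
        · omega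
        · rw [Fin.le_def, Fin.val_castSucc]
          have : (j : ℕ) ≠ m + 1 := fun h => hj (Fin.ext h)
          omega
    · intro k z hz
      by_cases hz' : z ∈ dblTri.{u}.degenerate k.dim
      · exact Or.inl hz'
      refine Or.inr ⟨fun h => ?_, fun hk h => ?_⟩
      · obtain ⟨_, i, j, hi, hj, hij, _⟩ := dblEdge_of_mk_eq k z hz hz' h
        rw [hδ, hδ] at hij
        rcases hij with hij | hij | hij <;> omega
      · obtain ⟨_, i, j, hi, hj, _, hij⟩ := dblEdge_of_mk_eq k z hz hz' h
        have := (hij hk).1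
        rw [vert_wordOne, if_pos (by omega)] at this
        omega
  have hlast (i j : Fin (m + 2)) (hi : (i : ℕ) = m) (hj : (j : ℕ) = m + 1) :
      DblEdge (vert (wordOne.{u} m e) i) (vert (wordOne.{u} m e) j) := by
    rw [vert_wordOne, vert_wordOne, if_pos hi.le, if_neg (by omega), hi, DblEdge]
    omega
  obtain _ | m := m
  · exact subExtends_terminalVertex hd (marked_mem_sat (hlast 0 1 rfl rfl))
  · refine subExtends_outerHorn hd (fun g hg => marked_mem_sat ?_) fun g hg => lean_mem_sat ?_
    · rw [vert_yonedaEquiv_symm, vert_yonedaEquiv_symm]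
      exact hlast _ _ hg.1 hg.2
    · rw [vert_yonedaEquiv_symm, vert_yonedaEquiv_symm]
      exact hlast _ _ hg.2.1 hg.2.2

/-- The missing face of `wordTwo m e`. -/
def wordTwoIndex (m : ℕ) (e : Fin 2) : Fin (m + 3) := ⟨m + 2 - e, by omega⟩

theorem vert_δ_wordTwo (m : ℕ) (e : Fin 2) (i : Fin (m + 2)) :
    vert (dblTri.{u}.δ (wordTwoIndex m e) (wordTwo m e)) i =
      if (i : ℕ) ≤ m then (m - i + e) % 2 else 2 + e := by
  rw [vert_δ, vert_wordTwo, Fin.succAbove]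
  simp only [wordTwoIndex, Fin.lt_def, Fin.val_castSucc]
  split_ifs <;> simp only [Fin.val_castSucc, Fin.val_succ] at * <;> omega

/-- The omitted face drops the vertex `3 - e`. For `e = 0` it is the last one and (A4) applies, as
`2 → 3` is marked; for `e = 1` the vertex 2 is dropped and (A1) applies, as `1 → 2 → 3` is thin.
Dropping `2 + e` gives `wordOne m e`, and the other faces have a shorter alternating part. -/
theorem subExtends_wordTwo (m : ℕ) (e : Fin 2) (hme : m = 0 → e = 1) (S : dblTri.{u}.Subcomplex)
    (hS : baseTri ∈ S.obj _) (h : ∀ k < m, ∀ e, wordTwo k e ∈ S.obj _)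
    (h₁ : wordOne m e ∈ S.obj _)
    (hn : dblTri.δ (wordTwoIndex m e) (wordTwo m e) ∉ S.obj _) :
    SubExtends mbAnodyne (Sub.mk S dblDeco.decoSet)
      (Sub.mk (S ⊔ SSet.Subcomplex.ofSimplex (wordTwo m e)) dblDeco.decoSet) := by
  have hd : HornData S dblDeco.decoSet (wordTwo.{u} m e) (wordTwoIndex m e) := by
    refine ⟨?_, fun h => hn (S.map _ h), ?_, hn, ?_, ?_⟩
    · refine mem_nonDegenerate _ fun i j hij => ?_
      rw [vert_wordTwo, vert_wordTwo]
      split_ifs <;> omega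
    · refine mem_nonDegenerate _ fun i j hij => ?_
      rw [vert_δ_wordTwo, vert_δ_wordTwo]
      split_ifs <;> omega
    · intro j hj
      have hj' : (j : ℕ) ≠ m + 2 - e := fun h => hj (Fin.ext h)
      by_cases hjm : (j : ℕ) ≤ m
      · refine mem_of_wordTwo_mem m S hS h _ fun i hi => ?_
        have hi' : (j.succAbove i : ℕ) = i + 1 := by
          rw [Fin.succAbove_of_le_castSucc, Fin.val_succ]
          rw [Fin.le_def, Fin.val_castSucc]
          omega
        rw [vert_δ, vert_wordTwo, hi', if_neg] <;> omega
      · refine Set.mem_of_eq_of_mem (s := S.obj _) ?_ h₁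
        refine vert_ext fun i => ?_
        rw [vert_δ, vert_wordTwo, vert_wordOne, Fin.succAbove]
        simp only [Fin.lt_def, Fin.val_castSucc]
        split_ifs <;> simp only [Fin.val_castSucc, Fin.val_succ] at * <;> omega
    · intro k z hz
      by_cases hz' : z ∈ dblTri.{u}.degenerate k.dim
      · exact Or.inl hz'
      refine Or.inr ⟨fun h => ?_, fun hk h => ?_⟩
      · obtain ⟨_, i, j, hi, hj, hij, _⟩ := dblEdge_of_mk_eq k z hz hz' h
        rw [vert_δ_wordTwo, vert_δ_wordTwo, if_pos (by omega), if_neg (by omega)] at hij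
        rcases hij with hij | hij | hij <;> omega
      · obtain ⟨hd, _⟩ := dblEdge_of_mk_eq k z hz hz' h
        subst hk
        change m + 2 = 2 at hd
        have := hme (by omega)
        simp only [wordTwoIndex, this]
        omega
  have hlast (i j : Fin (m + 3)) (hi : (i : ℕ) = m + 1) (hj : (j : ℕ) = m + 2) :
      vert (wordTwo.{u} m e) i = 2 ∧ vert (wordTwo.{u} m e) j = 3 := by
    rw [vert_wordTwo, vert_wordTwo, if_neg (by omega), if_neg (by omega)]
    omega
  rcases Fin.exists_fin_two.1 ⟨e, rfl⟩ with rfl | rfl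
  · refine subExtends_outerHorn hd (fun g hg => marked_mem_sat ?_) fun g hg => lean_mem_sat ?_
    · rw [vert_yonedaEquiv_symm, vert_yonedaEquiv_symm]
      exact Or.inr (Or.inr (hlast _ _ hg.1 hg.2))
    · rw [vert_yonedaEquiv_symm, vert_yonedaEquiv_symm]
      exact Or.inr (Or.inr (hlast _ _ hg.2.1 hg.2.2))
  · refine subExtends_innerHorn hd ?_ ?_ fun g hg => thin_mem_sat ?_
    · rw [Fin.lt_def]
      exact Nat.succ_pos m
    · rw [Fin.lt_def]
      exact Nat.lt_succ_self (m + 1)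
    · rw [vert_yonedaEquiv_symm, vert_yonedaEquiv_symm]
      exact hlast _ _ hg.2.1 hg.2.2

end MBSSet

/-! ### Filtering the doubled triangle by its words. -/

namespace MBSSet

/-- The subcomplex generated by `wordOne m e` or `wordTwo m e`. -/
def wordSub (m : ℕ) (e : Fin 2) (φ : Bool) : dblTri.{u}.Subcomplex := match φ with
  | false => SSet.Subcomplex.ofSimplex (wordOne m e)
  | true => SSet.Subcomplex.ofSimplex (wordTwo m e)

theorem le_val_of_strictMono {n m : ℕ} {f : Fin n → Fin m} (hf : StrictMono f) (i : Fin n) :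
    (i : ℕ) ≤ f i := by
  obtain ⟨i, hi⟩ := i
  induction i with
  | zero => exact Nat.zero_le _
  | succ i ih => exact (ih (by omega)).trans_lt (hf (Fin.lt_def.2 (Nat.lt_succ_self i)))

/-- A simplex without repeated neighbours embeds in the word by a strictly increasing map, which
moves positions to the right. Comparison with the length of the alternating part bounds `i`, and
equality determines the letters there. -/
theorem of_mem_wordSub {n : ℕ} {x : dblTri.{u} _⦋n⦌}
    (hx : ∀ i j : Fin (n + 1), (j : ℕ) = i + 1 → vert x i ≠ vert x j) (i : Fin (n + 1))
    (hi : vert x i < 2) {k : ℕ} {e : Fin 2} {φ : Bool} (h : x ∈ (wordSub k e φ).obj _) :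
    (i : ℕ) ≤ k ∧ ((i : ℕ) = k → vert x i = e ∧
      (φ = false → ∀ j : Fin (n + 1), (j : ℕ) = i + 1 → vert x j = 3 - e)) := by
  cases φ
  · obtain ⟨f, hf, hxf⟩ := exists_of_mem_ofSimplex hx h
    have h₁ := le_val_of_strictMono hf i
    have h₂ : (f i : ℕ) ≤ k := by
      rw [hxf, vert_wordOne] at hi
      split_ifs at hi <;> omega
    refine ⟨h₁.trans h₂, fun hik => ⟨?_, fun _ j hj => ?_⟩⟩
    · rw [hxf, vert_wordOne, if_pos h₂]
      omega
    · have h₃ : f i < f j := hf (Fin.lt_def.2 (by omega))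
      rw [Fin.lt_def] at h₃
      rw [hxf, vert_wordOne, if_neg (by omega)]
  · obtain ⟨f, hf, hxf⟩ := exists_of_mem_ofSimplex hx h
    have h₁ := le_val_of_strictMono hf i
    have h₂ : (f i : ℕ) ≤ k := by
      rw [hxf, vert_wordTwo] at hi
      split_ifs at hi <;> omega
    refine ⟨h₁.trans h₂, fun hik => ⟨?_, fun h => by cases h⟩⟩
    rw [hxf, vert_wordTwo, if_pos h₂]
    omega

/-- The hypothesis `hn` covers both kinds of omitted faces: alternating words ending in `e` at
position `m`, followed by `2 + e` in the case of `wordTwo`. For `m = 0` and `e = 0` the word lies in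
the base triangle and nothing is attached. -/
theorem subExtends_wordSub (m : ℕ) (e : Fin 2) (φ : Bool) (S : dblTri.{u}.Subcomplex)
    (hS : baseTri ∈ S.obj _) (h : ∀ k < m, ∀ e, wordTwo k e ∈ S.obj _)
    (h₁ : φ = true → wordOne m e ∈ S.obj _)
    (hn : ∀ {n : ℕ} (x : dblTri.{u} _⦋n⦌) (i : Fin (n + 1)), (i : ℕ) = m → vert x i = e →
      (∀ i j : Fin (n + 1), (j : ℕ) = i + 1 → vert x i ≠ vert x j) →
      (∃ i, vert x i = 1) →
      (φ = true → ∃ j : Fin (n + 1), (j : ℕ) = m + 1 ∧ vert x j = 2 + e) → x ∉ S.obj _) :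
    SubExtends mbAnodyne (Sub.mk S dblDeco.decoSet)
      (Sub.mk (S ⊔ wordSub m e φ) dblDeco.decoSet) := by
  by_cases hme : m = 0 → e = 1
  · have he : ∃ i : ℕ, i ≤ m ∧ (m - i + e) % 2 = 1 := by
      rcases Fin.exists_fin_two.1 ⟨e, rfl⟩ with rfl | rfl
      · have : m ≠ 0 := fun h => absurd (hme h) (by decide)
        refine ⟨m - 1, by omega, ?_⟩
        change (m - (m - 1) + 0) % 2 = 1
        omega
      · exact ⟨m, le_rfl, by rw [Nat.sub_self]; rfl⟩
    obtain ⟨i, hi, hi'⟩ := he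
    cases φ
    · have hδ (i : Fin (m + 1)) : vert (dblTri.{u}.δ (Fin.last (m + 1)) (wordOne m e)) i =
          (m - i + e) % 2 := by
        rw [vert_δ, vert_wordOne, Fin.succAbove_last, Fin.val_castSucc, if_pos (by omega)]
      refine subExtends_wordOne m e hme S hS h (hn _ (Fin.last m) rfl ?_ ?_ ?_ ?_)
      · rw [hδ, Fin.val_last]
        omega
      · intro i j hij
        rw [hδ, hδ]
        omega
      · exact ⟨⟨i, by omega⟩, (hδ _).trans hi'⟩
      · exact fun h => by cases h
    · refine subExtends_wordTwo m e hme S hS h (h₁ rfl) (hn _ ⟨m, by omega⟩ rfl ?_ ?_ ?_ ?_)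
      · rw [vert_δ_wordTwo, if_pos le_rfl]
        dsimp only
        omega
      · intro i j hij
        rw [vert_δ_wordTwo, vert_δ_wordTwo]
        split_ifs <;> omega
      · exact ⟨⟨i, by omega⟩, (vert_δ_wordTwo m e _).trans ((if_pos hi).trans hi')⟩
      · refine fun _ => ⟨Fin.last _, rfl, ?_⟩
        rw [vert_δ_wordTwo, if_neg (by rw [Fin.val_last]; omega)]
  · push Not at hme
    obtain ⟨rfl, he⟩ := hme
    have he' : (e : ℕ) = 0 := by
      have : (e : ℕ) ≠ 1 := fun h => he (Fin.ext h)
      omega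
    have hle : wordSub.{u} 0 e φ ≤ S := by
      cases φ
      · refine (SSet.Subcomplex.ofSimplex_le_iff _ _).2
          ((SSet.Subcomplex.ofSimplex_le_iff _ _).2 hS _ ((mem_baseTri_iff _).2 fun i => ?_))
        rw [vert_wordOne]
        split_ifs <;> omega
      · refine (SSet.Subcomplex.ofSimplex_le_iff _ _).2
          ((SSet.Subcomplex.ofSimplex_le_iff _ _).2 hS _ ((mem_baseTri_iff _).2 fun i => ?_))
        rw [vert_wordTwo]
        split_ifs <;> omega
    rw [sup_eq_left.2 hle]
    exact Extends.refl _

/-- Words are attached by increasing `m`, and `wordOne` before `wordTwo`. By length, an earlier word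
containing the omitted face would have the same `m` and `e`, so it would be `wordOne` against
`wordTwo`; but there the alternating part is followed by `3 - e`, not by `2 + e`. -/
theorem subExtends_dblTri : SubExtends mbAnodyne
    (Sub.mk (SSet.Subcomplex.ofSimplex baseTri.{u}) dblDeco.decoSet) dblDeco.decoSet.toSub := by
  suffices ∀ D : DecoSet dblTri.{u}, D = dblDeco.decoSet →
      SubExtends mbAnodyne (Sub.mk (SSet.Subcomplex.ofSimplex baseTri.{u}) D) D.toSub from
    this _ rfl
  intro D hD
  let I := ULift.{u} (ℕ × Fin 2 × Bool)
  let C (i : I) : dblTri.{u}.Subcomplex := wordSub i.down.1 i.down.2.1 i.down.2.2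
  let ρ (i : I) : ℕ := 2 * i.down.1 + i.down.2.2.toNat
  have e (T : Set I) : Sub.mk (SSet.Subcomplex.ofSimplex baseTri.{u}) D ⊔
      ⨆ i ∈ T, Sub.mk (C i) D =
      Sub.mk (SSet.Subcomplex.ofSimplex baseTri.{u} ⊔ ⨆ i ∈ T, C i) D := by
    simp only [Sub.iSup_mk]
    exact congrArg (Sub.mk _) (sup_eq_left.2 (iSup₂_le fun _ _ => le_rfl))
  have key : SubExtends mbAnodyne (Sub.mk (SSet.Subcomplex.ofSimplex baseTri.{u}) D)
      (Sub.mk (SSet.Subcomplex.ofSimplex baseTri.{u}) D ⊔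
        ⨆ i : I, Sub.mk (C i) D) := by
    refine subExtends_of_rank (W := mbAnodyne) ρ _ _ fun i T hT hT' hi => ?_
    rw [e, Sub.mk_sup, sup_idem]
    subst hD
    obtain ⟨m, a, φ⟩ := i
    have hle (j : I) (hj : j ∈ T) : C j ≤ SSet.Subcomplex.ofSimplex baseTri.{u} ⊔ ⨆ i ∈ T, C i :=
      (le_iSup₂_of_le (f := fun (i : I) (_ : i ∈ T) => C i) j hj le_rfl).trans le_sup_right
    refine subExtends_wordSub m a φ _ (Or.inl (SSet.Subcomplex.mem_ofSimplex_obj _)) ?_ ?_ ?_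
    · intro k hk b
      refine hle ⟨k, b, true⟩ (hT _ ?_) _ (SSet.Subcomplex.mem_ofSimplex_obj _)
      change 2 * k + 1 < 2 * m + φ.toNat
      omega
    · rintro rfl
      refine hle ⟨m, a, false⟩ (hT _ ?_) _ (SSet.Subcomplex.mem_ofSimplex_obj _)
      exact Nat.lt_succ_self _
    · intro n x i hi₁ hi₂ hne hx hφ hxS
      rcases hxS with hxS | hxS
      · obtain ⟨j, hj⟩ := hx
        exact (mem_baseTri_iff x).1 hxS j hj
      · simp only [Subfunctor.iSup_obj, Set.mem_iUnion] at hxS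
        obtain ⟨⟨k, b, ψ⟩, hj, hxS⟩ := hxS
        have h₁ := of_mem_wordSub (k := k) (e := b) (φ := ψ) hne i (by omega) hxS
        have h₂ : 2 * k + ψ.toNat ≤ 2 * m + φ.toNat := hT' _ hj
        have hφ' := φ.toNat_le
        obtain rfl : k = m := by omega
        obtain ⟨h₃, h₄⟩ := h₁.2 hi₁
        obtain rfl : a = b := Fin.ext (hi₂.symm.trans h₃)
        cases φ <;> cases ψ
        · exact hi hj
        · change 2 * k + 1 ≤ 2 * k at h₂
          omega
        · obtain ⟨j, hj₁, hj₂⟩ := hφ rfl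
          have := h₄ rfl j (by omega)
          omega
        · exact hi hj
  have e' := e Set.univ
  simp only [Set.mem_univ, iSup_pos] at e'
  rw [e'] at key
  have htop : SSet.Subcomplex.ofSimplex baseTri.{u} ⊔ ⨆ i : I, C i = ⊤ := by
    rw [eq_top_iff]
    intro d x _
    obtain ⟨d⟩ := d
    induction d using SimplexCategory.rec with | _ n
    refine mem_of_wordTwo_mem (n + 1)
      (SSet.Subcomplex.ofSimplex baseTri.{u} ⊔ ⨆ i : I, C i) (Or.inl (SSet.Subcomplex.mem_ofSimplex_obj _)) ?_ x ?_
    · intro k _ b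
      right
      simp only [Subfunctor.iSup_obj, Set.mem_iUnion]
      exact ⟨⟨k, b, true⟩, SSet.Subcomplex.mem_ofSimplex_obj _⟩
    · intro i hi
      omega
  rwa [htop] at key

end MBSSet

/-! ### Saturating the doubled triangle, and cancellation of marked edges. -/

namespace MBSSet

section

variable {M T : DecoSet dblTri.{u}}

/-- (S5) for the 3-simplex `(a, b, c, d)`: its last edge is marked, and the faces ending with this
edge are lean in `dblDeco`. -/
theorem lean_of_lean_of_dblEdge (hM : IsClosed mbAnodyne T M) (hMT : M ≤ T)
    (hD : dblDeco.decoSet ≤ M) (hT : ∀ t, t ∈ T .lean) {a b c d : ℕ} (h : DblEdge c d)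
    (hd : ∀ t : dblTri.{u} _⦋2⦌, vert t 0 = a → vert t 1 = b → vert t 2 = d → t ∈ M .lean)
    (t : dblTri.{u} _⦋2⦌) (h₀ : vert t 0 = a) (h₁ : vert t 1 = b) (h₂ : vert t 2 = c) :
    t ∈ M .lean := by
  have h01 : vert t 0 - 1 ≤ vert t 1 - 1 := vert_mono t (by decide)
  have h12 : vert t 1 - 1 ≤ vert t 2 - 1 := vert_mono t (by decide)
  have ht := vert_lt t
  have hcd : c - 1 ≤ d - 1 ∧ d < 4 := by
    rcases h with h | h | h <;> omega
  let y : dblTri.{u} _⦋3⦌ := ofVert (n := 3) ![vert t 0, vert t 1, vert t 2, d]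
    (fun i => by
      fin_cases i
      exacts [ht 0, ht 1, ht 2, hcd.2])
    (Fin.monotone_iff_le_succ.2 fun i => by
      fin_cases i
      exacts [h01, h12, by change vert t 2 - 1 ≤ d - 1; omega])
  have hy : dblTri.δ 3 y = t := vert_ext fun i => by
    fin_cases i <;> rfl
  rw [← hy]
  have h' : DblEdge (vert t 2) d := by rwa [h₂]
  exact hM.δ_three_mem_lean hMT y (hD .lean (Or.inr (Or.inr h'))) (hD .lean (Or.inr (Or.inr h')))
    (hd _ h₀ h₁ rfl) (hD .marked (Or.inr h')) (hT _)

/-- (S3) for the 3-simplex `(a, b, 2, 3)`, whose face `(b, 2, 3)` is thin. -/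
theorem lean_of_lean_of_le_one (hM : IsClosed mbAnodyne T M) (hMT : M ≤ T)
    (hD : dblDeco.decoSet ≤ M) (hT : ∀ t, t ∈ T .lean) {a b : ℕ} (hb : b ≤ 1)
    (hd : ∀ t : dblTri.{u} _⦋2⦌, vert t 0 = a → vert t 1 = b → vert t 2 = 2 → t ∈ M .lean)
    (t : dblTri.{u} _⦋2⦌) (h₀ : vert t 0 = a) (h₁ : vert t 1 = b) (h₂ : vert t 2 = 3) :
    t ∈ M .lean := by
  have h01 : vert t 0 - 1 ≤ vert t 1 - 1 := vert_mono t (by decide)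
  have ht := vert_lt t
  let y : dblTri.{u} _⦋3⦌ := ofVert (n := 3) ![vert t 0, vert t 1, 2, vert t 2]
    (fun i => by
      fin_cases i
      exacts [ht 0, ht 1, Nat.lt_of_sub_eq_succ rfl, ht 2])
    (Fin.monotone_iff_le_succ.2 fun i => by
      fin_cases i
      exacts [h01, by change vert t 1 - 1 ≤ 1; omega, by change 1 ≤ vert t 2 - 1; omega])
  have hy : dblTri.δ 2 y = t := vert_ext fun i => by
    fin_cases i <;> rfl
  rw [← hy]
  exact hM.δ_two_mem_lean hMT y (hD .thin (Or.inr ⟨rfl, h₂⟩))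
    (hD .lean (Or.inr (Or.inr (Or.inr (Or.inr ⟨rfl, h₂⟩))))) (hd _ h₀ h₁ rfl) (hT _)

/-- Starting from triangles whose last edge is marked, the last vertex is moved: from 3 to 2 to 1 if
the middle vertex is 0, and from 2 to 3 to 0 if it is 1. -/
theorem mem_lean_of_isClosed (hM : IsClosed mbAnodyne T M) (hMT : M ≤ T)
    (hD : dblDeco.decoSet ≤ M) (hT : ∀ t, t ∈ T .lean) (t : dblTri.{u} _⦋2⦌) : t ∈ M .lean := by
  have hA := fun {a b c d} => lean_of_lean_of_dblEdge hM hMT hD hT (a := a) (b := b) (c := c) (d := d)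
  have hE {a b c : ℕ} (h : DblEdge b c) (t : dblTri.{u} _⦋2⦌) (_ : vert t 0 = a)
      (h₁ : vert t 1 = b) (h₂ : vert t 2 = c) : t ∈ M .lean :=
    hD .lean (Or.inr (Or.inr (by
      change DblEdge (vert t 1) (vert t 2)
      rwa [h₁, h₂])))
  have hd (h : vert t 1 = vert t 2) : t ∈ M .lean := by
    rw [eq_σ_δ t 1 h]
    exact hM.deg_mem .lean (σ_mem_deg _ _)
  have e03 : DblEdge 0 3 := Or.inl ⟨rfl, rfl⟩
  have e12 : DblEdge 1 2 := Or.inr (Or.inl ⟨rfl, rfl⟩)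
  have e23 : DblEdge 2 3 := Or.inr (Or.inr ⟨rfl, rfl⟩)
  have h0 := vert_lt t 1
  have h1 := vert_lt t 2
  have h12 : vert t 1 - 1 ≤ vert t 2 - 1 := vert_mono t (by decide)
  generalize hb : vert t 1 = b at *
  generalize hc : vert t 2 = c at *
  interval_cases b
  · interval_cases c
    · exact hd rfl
    · exact hA e12 (hA e23 (hE e03)) t rfl hb hc
    · exact hA e23 (hE e03) t rfl hb hc
    · exact hE e03 t rfl hb hc
  · have h3 := lean_of_lean_of_le_one hM hMT hD hT le_rfl (hE (a := vert t 0) e12)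
    interval_cases c
    · exact hA e03 h3 t rfl hb hc
    · exact hd rfl
    · exact hE e12 t rfl hb hc
    · exact h3 t rfl hb hc
  · interval_cases c
    · omega
    · omega
    · exact hd rfl
    · exact hE e23 t rfl hb hc
  · interval_cases c
    · omega
    · omega
    · omega
    · exact hd rfl

/-- The edges of `dblTri` between the vertices `0` and `1`. -/
def codiscreteToDblTri : codiscrete (ULift.{u} Bool) ⟶ dblTri.{u} where
  app _ := ↾fun x => ⟨fun i => (x i).down.toNat, fun i => by
      have := (x i).down.toNat_le
      dsimp only
      omega,
    fun i j _ => by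
      have := (x i).down.toNat_le
      dsimp only
      omega⟩

/-- All triangles are thin, so (E) marks the edges between 0 and 1. The edges `0 → 2` and `1 → 3`
are then composites `0 → 1 → 2` and `1 → 0 → 3` of marked edges, and (S1) applies. -/
theorem mem_marked_of_isClosed (hM : IsClosed mbAnodyne T M) (hMT : M ≤ T)
    (hD : dblDeco.decoSet ≤ M) (hT : ∀ k t, t ∈ T k) (e : dblTri.{u} _⦋1⦌) : e ∈ M .marked := by
  have hthin (t : dblTri.{u} _⦋2⦌) : t ∈ M .thin :=
    hM.thin_of_lean hMT (mem_lean_of_isClosed hM hMT hD (hT .lean) t) (hT .thin t)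
  have hJ (e : dblTri.{u} _⦋1⦌) (h₀ : vert e 0 ≤ 1) (h₁ : vert e 1 ≤ 1) : e ∈ M .marked := by
    have := hM.marked_of_kanComplex hMT (kanComplex_codiscrete _) codiscreteToDblTri
      (fun t => hthin _) (fun e => hT .marked _) (fun i => ⟨decide (vert e i = 1)⟩)
    refine Set.mem_of_eq_of_mem (s := M .marked) (vert_ext fun i => ?_) this
    have hi : vert e i ≤ 1 := by
      fin_cases i
      exacts [h₀, h₁]
    change _ = (decide (vert e i = 1)).toNat
    generalize vert e i = a at *
    interval_cases a <;> rfl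
  have hE (e : dblTri.{u} _⦋1⦌) (h : DblEdge (vert e 0) (vert e 1)) : e ∈ M .marked :=
    hD .marked (Or.inr h)
  have hS (e : dblTri.{u} _⦋1⦌) (h₀ : vert e 0 ≤ 1)
      (h : DblEdge (1 - vert e 0) (vert e 1)) : e ∈ M .marked := by
    have he := vert_lt e
    let t : dblTri.{u} _⦋2⦌ := ofVert (n := 2) ![vert e 0, 1 - vert e 0, vert e 1]
      (fun i => by
        fin_cases i
        exacts [he 0, by change 1 - vert e 0 < 4; omega, he 1])
      (Fin.monotone_iff_le_succ.2 fun i => by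
        fin_cases i
        exacts [by change vert e 0 - 1 ≤ 1 - vert e 0 - 1; omega,
          by change 1 - vert e 0 - 1 ≤ vert e 1 - 1; omega])
    have ht : dblTri.δ 1 t = e := vert_ext fun i => by
      fin_cases i <;> rfl
    rw [← ht]
    exact hM.δ_one_mem_marked hMT t (hthin t) (hE _ h)
      (hJ _ h₀ (by change 1 - vert e 0 ≤ 1; omega)) (hT _ _)
  have hd (h : vert e 0 = vert e 1) : e ∈ M .marked := by
    rw [eq_σ_δ e 0 h]
    exact hM.deg_mem .marked (σ_mem_deg _ _)
  have h0 := vert_lt e 0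
  have h1 := vert_lt e 1
  have h01 : vert e 0 - 1 ≤ vert e 1 - 1 := vert_mono e (by decide)
  by_cases h : vert e 1 ≤ 1
  · exact hJ e (by omega) h
  by_cases h' : DblEdge (vert e 0) (vert e 1)
  · exact hE e h'
  by_cases h'' : vert e 0 = vert e 1
  · exact hd h''
  rw [DblEdge] at h'
  refine hS e (by omega) ?_
  rw [DblEdge]
  omega

end

/-- The triangle with doubled initial vertex, where all simplices are decorated. -/
def dblTarget : MBSSet.{u} := mk' dblTri Set.univ Set.univ Set.univ

theorem mem_dblTarget_deco (k : Kind) (x : dblTri.{u} _⦋k.dim⦌) : x ∈ dblTarget.deco k := by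
  cases k
  exacts [Or.inr trivial, Or.inr trivial, Or.inr (Or.inl trivial)]

theorem subExtends_dblTarget : SubExtends mbAnodyne
    (Sub.mk (SSet.Subcomplex.ofSimplex baseTri.{u}) dblDeco.decoSet) dblTarget.decoSet.toSub := by
  refine subExtends_dblTri.trans (subExtends_of_isClosed (Z := dblTri.{u})
    (fun k x _ => mem_dblTarget_deco k x) (fun k x _ => mem_dblTarget_deco k x)
    (fun x _ => mem_dblTarget_deco .lean x) fun M hD hMT hM k x _ => ?_)
  have hl := mem_lean_of_isClosed hM hMT hD (mem_dblTarget_deco .lean)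
  cases k
  · exact mem_marked_of_isClosed hM hMT hD mem_dblTarget_deco x
  · exact hM.thin_of_lean hMT (hl x) (mem_dblTarget_deco .thin x)
  · exact hl x

/-- The inclusion of `baseTri`. -/
def baseMap : (Δ[2] : SSet.{u}) ⟶ dblTri := SSet.yonedaEquiv.symm baseTri

/-- The retraction of `dblTri` to `baseTri`, which identifies the vertices `0` and `1`. -/
def dblRetraction : dblTri.{u} ⟶ Δ[2] where
  app _ := ↾fun x => SSet.stdSimplex.objEquiv.symm (SimplexCategory.Hom.mk
    ⟨fun i => (⟨x.down.1 i - 1, by have := x.down.2.1 i; omega⟩ : Fin 3), fun _ _ h => x.down.2.2 h⟩)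

theorem baseMap_dblRetraction : baseMap.{u} ≫ dblRetraction = 𝟙 _ := by
  apply SSet.yonedaEquiv.injective
  apply SSet.stdSimplex.ext
  intro i
  fin_cases i <;> rfl

instance : Mono baseMap.{u} :=
  have : Mono (baseMap.{u} ≫ dblRetraction) := by
    rw [baseMap_dblRetraction]
    infer_instance
  mono_of_mono baseMap dblRetraction

/-- The triangle in which all simplices except for the first edge are decorated. -/
abbrev backTriangle : MBSSet.{u} := mk' Δ[2] (dEdge 2 1 2 ∪ dEdge 2 0 2) Set.univ Set.univ

/-- The inclusion of `backTriangle` in `dblTarget`. -/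
def backTriangleMap : backTriangle.{u} ⟶ dblTarget :=
  homMk (X := backTriangle) (Y := dblTarget) baseMap fun k _ _ => mem_dblTarget_deco k _

/-- On the base triangle `0 → 2 → 3`, `dblDeco` restricts to the decorations of `backTriangle`: the
edges `2 → 3` and `0 → 3` are marked and the triangle is thin. -/
theorem mbAnodyne_backTriangleMap : mbAnodyne backTriangleMap.{u} := by
  have : Mono (Hom.hom backTriangleMap.{u}) := inferInstanceAs (Mono baseMap)
  rw [mem_iff_image (W := mbAnodyne)]
  refine Extends.trans ?_ subExtends_dblTarget
  have hr : (image backTriangleMap.{u}).1 = SSet.Subcomplex.ofSimplex baseTri.{u} :=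
    (SSet.Subcomplex.range_eq_ofSimplex baseMap.{u}).trans
      (congrArg _ (Equiv.apply_symm_apply _ _))
  have hdeco (k : Kind) (x : (Δ[2] : SSet.{u}) _⦋k.dim⦌) :
      baseMap.app _ x ∈ dblDeco.deco k ↔ x ∈ backTriangle.deco k := by
    have hthin (x : (Δ[2] : SSet.{u}) _⦋2⦌) : baseMap.app _ x ∈ dblDeco.deco .thin := by
      rcases degenerate_or_eq_id x with h | rfl
      · exact Or.inl (SSet.app_mem_degenerate _ h)
      · exact Or.inr ⟨rfl, rfl⟩
    cases k
    · refine or_congr (SSet.degenerate_iff_of_mono baseMap x) ?_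
      have h (a b : ℕ) : DblEdge (if a = 0 then 0 else a + 1) (if b = 0 then 0 else b + 1) ↔
          a = 1 ∧ b = 2 ∨ a = 0 ∧ b = 2 := by
        rw [DblEdge]
        split_ifs <;> grind
      exact h _ _
    · exact ⟨fun _ => Or.inr trivial, fun _ => hthin x⟩
    · exact ⟨fun _ => Or.inr (Or.inl trivial), fun _ => dblDeco.thin_subset_lean' (hthin x)⟩
  refine subExtends_of_sat_inter_le ⟨hr.le, ?_⟩ hr.ge ?_
  · rintro k _ ⟨x, hx, rfl⟩
    exact (hdeco k x).2 hx
  · intro k z hz hz'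
    rw [← hr] at hz
    obtain ⟨x, rfl⟩ := hz
    exact (mem_image_sat_iff backTriangleMap k x).2
      ((hdeco k x).1 (Set.mem_of_subset_of_mem (dblDeco_sat k).subset hz'))

/-- Identifying 0 with 1 retracts the doubled triangle onto its base and presents this map as a
retract of `backTriangleMap`. -/
theorem mbAnodyne_backTriangle : mbAnodyne (enlarge (Δ[2] : SSet.{u})
    (E := dEdge 2 1 2 ∪ dEdge 2 0 2) (E' := Set.univ) (T := Set.univ) (T' := Set.univ)
    (C := Set.univ) (C' := Set.univ) (Set.subset_univ _) subset_rfl subset_rfl) := by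
  have hY (k : Kind) (x : (Δ[2] : SSet.{u}) _⦋k.dim⦌) :
      x ∈ (mk' Δ[2] Set.univ Set.univ Set.univ).deco k := by
    cases k
    exacts [Or.inr trivial, Or.inr trivial, Or.inr (Or.inl trivial)]
  let s : mk' Δ[2] Set.univ Set.univ Set.univ ⟶ dblTarget.{u} :=
    homMk (X := mk' Δ[2] Set.univ Set.univ Set.univ) (Y := dblTarget) baseMap
      fun k _ _ => mem_dblTarget_deco k _
  let r : dblTarget.{u} ⟶ mk' Δ[2] Set.univ Set.univ Set.univ :=
    homMk (X := dblTarget) (Y := mk' Δ[2] Set.univ Set.univ Set.univ) dblRetraction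
      fun k _ _ => hY k _
  have hsr : s ≫ r = 𝟙 _ := hom_ext baseMap_dblRetraction
  refine mbAnodyne.of_retract (g := backTriangleMap)
    { i := Arrow.homMk (𝟙 _) s (hom_ext rfl)
      r := Arrow.homMk (𝟙 _) r (hom_ext baseMap_dblRetraction.symm)
      retract := Arrow.hom_ext _ _ (Category.comp_id _) hsr } mbAnodyne_backTriangleMap

/-- The cancellation rule, deduced from `mbAnodyne_backTriangle` just as composition of marked edges
is deduced from (S1). -/
theorem IsClosed.δ_two_mem_marked {Z : SSet.{u}} {T M : DecoSet Z} (hM : IsClosed mbAnodyne T M)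
    (hMT : M ≤ T) (t : Z _⦋2⦌) (ht : t ∈ M .thin) (h₀ : Z.δ 0 t ∈ M .marked)
    (h₁ : Z.δ 1 t ∈ M .marked) (hT : Z.δ 2 t ∈ T .marked) : Z.δ 2 t ∈ M .marked := by
  have hthin (s : (Δ[2] : SSet.{u}) _⦋2⦌) : (SSet.yonedaEquiv.symm t).app _ s ∈ M .thin :=
    yonedaEquiv_symm_app_mem t (hM.degenerate_subset .thin) ht s
  have he (e : (Δ[2] : SSet.{u}) _⦋1⦌) : (SSet.yonedaEquiv.symm t).app _ e ∈ T .marked :=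
    yonedaEquiv_symm_app_mem_of_δ t ((hM.degenerate_subset .marked).trans (hMT .marked)) e
      fun k _ => match k with
        | 0 => hMT .marked h₀
        | 1 => hMT .marked h₁
        | 2 => hT
  refine (hM.rule _ _ _ mbAnodyne_backTriangle (SSet.yonedaEquiv.symm t) ?_
    (fun s _ => hthin s) (fun s _ => hM.thin_subset (hthin s)) (fun e _ => he e)
    (fun s _ => hMT .thin (hthin s)) (fun s _ => hMT .lean (hM.thin_subset (hthin s)))).1
    (SSet.stdSimplex.objEquiv.symm (SimplexCategory.δ 2)) (Set.mem_univ _)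
  rintro e (h | h)
  · have : e = SSet.stdSimplex.objEquiv.symm (SimplexCategory.δ 0) := by
      apply SSet.stdSimplex.ext
      intro j
      fin_cases j
      · exact Fin.ext h.1
      · exact Fin.ext h.2
    rw [this]
    exact h₀
  · have : e = SSet.stdSimplex.objEquiv.symm (SimplexCategory.δ 1) := by
      apply SSet.stdSimplex.ext
      intro j
      fin_cases j
      · exact Fin.ext h.1
      · exact Fin.ext h.2
    rw [this]
    exact h₁

theorem pushoutProduct_terminalVertex {A B : MBSSet.{u}} (g : A ⟶ B) [Mono g.hom] :
    mbAnodyne (pushoutProduct (inducedHom terminalVertexTarget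
      (SSet.stdSimplex.δ (0 : Fin 2) : (Δ[0] : SSet.{u}) ⟶ Δ[1])) g) :=
  pushoutProduct_terminalVertex_of_or g (Or.inr fun _ hM hMT s hs h₀ h₁ h₂ =>
    hM.δ_two_mem_marked hMT s hs h₀ h₁ h₂)

end MBSSet

/-! ### Conclusion: all generators. -/

namespace MBSSet

theorem mbGen_le_pushoutProductLeft {A B : MBSSet.{u}} (g : A ⟶ B) [Mono g.hom] :
    MBGen ≤ pushoutProductLeft mbAnodyne g := by
  rintro X Y f hf
  cases hf with
  | innerHorn n i h0 hn => exact pushoutProduct_innerHorn n i h0 hn g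
  | wonky4 => exact pushoutProduct_enlarge _ _ _ (mbGen_le_mbAnodyne _ .wonky4) g
  | leftDegenerate n => exact pushoutProduct_leftHorn n g
  | outerHorn n => exact pushoutProduct_outerHorn n g
  | terminalVertex => exact pushoutProduct_terminalVertex g
  | compose => exact pushoutProduct_enlarge _ _ _ (mbGen_le_mbAnodyne _ .compose) g
  | leanToThin => exact pushoutProduct_enlarge _ _ _ (mbGen_le_mbAnodyne _ .leanToThin) g
  | innerSaturation i h0 h3 =>
    exact pushoutProduct_enlarge _ _ _ (mbGen_le_mbAnodyne _ (.innerSaturation i h0 h3)) g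
  | leftSaturation => exact pushoutProduct_enlarge _ _ _ (mbGen_le_mbAnodyne _ .leftSaturation) g
  | outerSaturation =>
    exact pushoutProduct_enlarge _ _ _ (mbGen_le_mbAnodyne _ .outerSaturation) g
  | equivalences K hK =>
    exact pushoutProduct_enlarge _ _ _ (mbGen_le_mbAnodyne _ (.equivalences K hK)) g

end MBSSet

theorem mainTheorem4 {X Y A B : MBSSet.{u}} (f : X ⟶ Y) (g : A ⟶ B)
    (hf : MBSSet.mbAnodyne f) (hg : MBSSet.cofibration g) :
    MBSSet.mbAnodyne (MBSSet.pushoutProduct f g) := by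
  have : Mono g.hom := hg
  exact MBSSet.mbAnodyne_le (MBSSet.mbGen_le_pushoutProductLeft g) _ hf
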